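/- **The braid group.** Let $\omega=\{0,1,2,\dots\}\subset\mathbb C$ and let $F_\omega$ be the space of injective maps $u:\omega\to\mathbb C$, a subspace of the product $\mathbb C^\omega$. An $\omega$-braid is a path $f:[0,1]\to F_\omega$ with $f(0)=\mathrm{id}_\omega$ and $f(1)=\sigma_f$ a permutation of $\omega$. Let $B_\omega$ be the set of homotopy classes $[f]$ of $\omega$-braids relative to $\{0,1\}$; it is a group under $[f][g]=[f\# g]$, where $f\# g$ is $f$ followed by the path $t\mapsto g(t)\circ\sigma_f$. **The unrestricted free product.** For a finite set $E\subset\omega$ let $\ast_{i\in E}\mathbb Z_i$ be the free group on generators $\delta_i$ $(i\in E)$. Write $m=\{0,\dots,m-1\}$. Let $\mathcal G_\omega=\varprojlim_n \ast_{i\in n}\mathbb Z_i$, where the bonding maps fix $\delta_i$ for the remaining $i$ and kill the others. Let $p_E:\mathcal G_\omega\to\ast_{i\in E}\mathbb Z_i$ be the induced projections. **The property $(\dagger)$.** An automorphism $a$ of $\mathcal G_\omega$ satisfies $(\dagger)$ if for every $m\in\omega$ there are a finite set $E\subset\omega$, an isomorphism $h:\ast_{i\in m}\mathbb Z_i\to\ast_{i\in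 E}\mathbb Z_i$ and a bijection $\sigma:m\to E$ such that $p_E\circ a=h\circ p_m$, each $h(\delta_i)$ $(i\in m)$ has the form $U_i^{-1}\delta_{\sigma(i)}U_i$, and $h(\prod_{i\in m}\delta_i)=\prod_{i\in E}\delta_i$, the products being taken in increasing order of the index. **The automorphism induced by a braid.** For $R$ large, identify $\ast_{i\in E}\mathbb Z_i$ with $\pi_1(\mathbb C\setminus E,\,R\sqrt{-1})$, where $\delta_k$ is the class of the loop that runs once counterclockwise around the triangle with vertices $R\sqrt{-1}$, $k-\frac12-\frac12\sqrt{-1}$, $k+\frac12-\frac12\sqrt{-1}$, and products are concatenations from left to right. The first $n$ strings of an $\omega$-braid $f$ then induce an isomorphism $e_n^f:\ast_{i\in n}\mathbb Z_i\to\ast_{i\in\sigma_f[n]}\mathbb Z_i$: a loop in the plane at time $0$ is moved to the plane at time $1$, with its base point fixed and without meeting these strings at any time. An automorphism $a$ of $\mathcal G_\omega$ is induced by $f$ if $p_{\sigma_f[n]}\circ a=e_n^f\circ p_n$ for all $n\in\omega$. **Theorem.** The automorphisms of $\mathcal G_\omega$ that satisfy $(\dagger)$ form a subgroup $D$ of $\operatorname{Aut}(\mathcal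 G_\omega)$. Each $\omega$-braid $f$ induces exactly one automorphism $a_f$ of $\mathcal G_\omega$, it depends only on $[f]$, and $[f]\mapsto a_f$ is an isomorphism from $B_\omega$ onto $D$ if automorphisms are composed from left to right. Equivalently, $[f]\mapsto a_f^{-1}$ is an isomorphism from $B_\omega$ onto $D$ under the usual composition of maps. -/

import Mathlib

namespace OmegaBraid

noncomputable section

/-! ### Configuration spaces and braid groups -/

/-- The space of injective maps `ι → ℂ`, with the topology induced by the product topology. -/
abbrev Config (ι : Type*) : Type _ := {u : ι → ℂ // Function.Injective u}

/-- The coordinate transformation `u ↦ u ∘ τ`. -/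
def Config.perm {ι : Type*} (τ : Equiv.Perm ι) (u : Config ι) : Config ι :=
  ⟨u.1 ∘ τ, u.2.comp τ.injective⟩

theorem Config.continuous_perm {ι : Type*} (τ : Equiv.Perm ι) :
    Continuous (Config.perm τ) := by
  have h : Continuous fun u : Config ι => u.1 ∘ τ :=
    continuous_pi fun i => (continuous_apply (τ i)).comp continuous_subtype_val
  exact h.subtype_mk _

/-- A braid on the indexed family `b` of distinct points of `ℂ`: a path in the configuration
space from `b` to a permutation of `b`.  The permutation is determined by the path, because `b`
is injective. -/
structure Braid {ι : Type*} (b : Config ι) where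
  perm : Equiv.Perm ι
  path : Path b (b.perm perm)

variable {ι : Type*} {b : Config ι}

namespace Braid

/-- Two braids are equivalent if they are homotopic relative to `{0, 1}`. -/
def Equivalent (f g : Braid b) : Prop :=
  ContinuousMap.HomotopicRel f.path.toContinuousMap g.path.toContinuousMap {0, 1}

theorem Equivalent.perm_eq {f g : Braid b} (h : f.Equivalent g) : f.perm = g.perm := by
  have h1 : f.path 1 = g.path 1 := h.fst_eq_snd (x := 1) (by simp)
  rw [f.path.target, g.path.target] at h1
  ext i
  exact b.2 (congrFun (congrArg Subtype.val h1) i)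

instance setoid (b : Config ι) : Setoid (Braid b) where
  r := Equivalent
  iseqv := ⟨fun _ => .refl _, fun h => h.symm, fun h h' => h.trans h'⟩

theorem equivalent_mk {σ : Equiv.Perm ι} {p q : Path b (b.perm σ)} (h : p.Homotopic q) :
    (⟨σ, p⟩ : Braid b) ≈ ⟨σ, q⟩ := h

theorem exists_mk_of_equiv {σ : Equiv.Perm ι} {p : Path b (b.perm σ)} {g : Braid b}
    (h : (⟨σ, p⟩ : Braid b) ≈ g) : ∃ q : Path b (b.perm σ), g = ⟨σ, q⟩ ∧ p.Homotopic q := by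
  obtain ⟨τ, q⟩ := g
  obtain rfl : σ = τ := Equivalent.perm_eq h
  exact ⟨q, rfl, h⟩

/-- The coordinate transform of a path, `t ↦ f t ∘ τ`. -/
def permPath (τ : Equiv.Perm ι) {u v : Config ι} (p : Path u v) : Path (u.perm τ) (v.perm τ) :=
  p.map (Config.continuous_perm τ)

/-- The product `f # g = f ⬝ g ^ f(1)`: first `f`, then `g` with strings relabelled by `f(1)`. -/
def mul (f g : Braid b) : Braid b where
  perm := g.perm * f.perm
  path := f.path.trans (permPath f.perm g.path)

/-- The constant braid. -/
def one (b : Config ι) : Braid b where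
  perm := 1
  path := Path.refl b

theorem perm_perm_inv (σ : Equiv.Perm ι) : b = (b.perm σ).perm σ⁻¹ := by
  apply Subtype.ext
  funext i
  simp [Config.perm]

/-- The reversed path, with strings relabelled by `f(1)⁻¹`. -/
def inv (f : Braid b) : Braid b where
  perm := f.perm⁻¹
  path := (permPath f.perm⁻¹ f.path.symm).cast (perm_perm_inv f.perm) rfl

theorem mul_congr {f f' g g' : Braid b} (hf : f ≈ f') (hg : g ≈ g') : f.mul g ≈ f'.mul g' := by
  obtain ⟨σ, p⟩ := f
  obtain ⟨τ, q⟩ := g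
  obtain ⟨p', rfl, hp⟩ := exists_mk_of_equiv hf
  obtain ⟨q', rfl, hq⟩ := exists_mk_of_equiv hg
  exact equivalent_mk (hp.hcomp (hq.map ⟨_, Config.continuous_perm σ⟩))

theorem inv_congr {f f' : Braid b} (hf : f ≈ f') : f.inv ≈ f'.inv := by
  obtain ⟨σ, p⟩ := f
  obtain ⟨p', rfl, hp⟩ := exists_mk_of_equiv hf
  exact equivalent_mk ((hp.symm₂.map ⟨_, Config.continuous_perm σ⁻¹⟩).pathCast _ _)

theorem mul_assoc' (f g k : Braid b) : (f.mul g).mul k ≈ f.mul (g.mul k) := by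
  refine equivalent_mk (Path.Homotopic.trans
    ⟨Path.Homotopy.transAssoc f.path (permPath f.perm g.path)
      (permPath f.perm (permPath g.perm k.path))⟩ ?_)
  have h : permPath f.perm (g.path.trans (permPath g.perm k.path)) =
      (permPath f.perm g.path).trans (permPath f.perm (permPath g.perm k.path)) :=
    Path.map_trans _ _ _
  change Path.Homotopic _ (f.path.trans (permPath f.perm (g.path.trans (permPath g.perm k.path))))
  rw [h]

theorem one_mul' (f : Braid b) : (one b).mul f ≈ f :=
  equivalent_mk ⟨Path.Homotopy.reflTrans f.path⟩

theorem mul_one' (f : Braid b) : f.mul (one b) ≈ f := by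
  refine equivalent_mk (Path.Homotopic.trans ?_ ⟨Path.Homotopy.transRefl f.path⟩)
  have h : permPath f.perm (Path.refl b) = Path.refl (b.perm f.perm) := rfl
  change Path.Homotopic (f.path.trans (permPath f.perm (Path.refl b))) _
  rw [h]

theorem inv_mul' (f : Braid b) : f.inv.mul f ≈ one b := by
  have key : ∀ {u v : Config ι} (p : Path u v) (h : b = v),
      ContinuousMap.HomotopicRel
        (((p.symm.cast h rfl).trans (p.cast rfl h)).toContinuousMap)
        (Path.refl b).toContinuousMap {0, 1} := by
    intro u v p h
    subst h
    exact ⟨(Path.Homotopy.reflSymmTrans p).symm⟩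
  have := key (permPath f.perm⁻¹ f.path) (perm_perm_inv f.perm)
  exact this

end Braid

/-- The braid group on `b`: equivalence classes of braids, with `[f] [g] = [f # g]`. -/
def BraidGroup (b : Config ι) : Type _ := Quotient (Braid.setoid b)

/-- The class `[f]` of a braid. -/
def BraidGroup.mk (f : Braid b) : BraidGroup b := Quotient.mk _ f

instance BraidGroup.group (b : Config ι) : Group (BraidGroup b) where
  mul := Quotient.map₂ Braid.mul fun _ _ h _ _ h' => Braid.mul_congr h h'
  one := BraidGroup.mk (Braid.one b)
  inv := Quotient.map Braid.inv fun _ _ h => Braid.inv_congr h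
  mul_assoc := by
    rintro ⟨f⟩ ⟨g⟩ ⟨k⟩
    exact Quotient.sound (Braid.mul_assoc' f g k)
  one_mul := by
    rintro ⟨f⟩
    exact Quotient.sound (Braid.one_mul' f)
  mul_one := by
    rintro ⟨f⟩
    exact Quotient.sound (Braid.mul_one' f)
  inv_mul_cancel := by
    rintro ⟨f⟩
    exact Quotient.sound (Braid.inv_mul' f)

/-- The configuration `0, 1, 2, …` of the non-negative integers in `ℂ`. -/
def omega : Config ℕ := ⟨fun n => (n : ℂ), Nat.cast_injective⟩

/-! ### The unrestricted free product -/

/-- The free product of copies `ℤ_i`, `i ∈ E`, of the integers, i.e. the free group on the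
generators `δ_i = FreeGroup.of i`, `i ∈ E`. -/
abbrev FreeOn (E : Finset ℕ) : Type := FreeGroup E

/-- The canonical projection, which sends `δ_i` to `δ_i` if `i ∈ E` and to `1` otherwise. -/
def proj (F E : Finset ℕ) : FreeOn F →* FreeOn E :=
  FreeGroup.lift fun i => if h : (i : ℕ) ∈ E then FreeGroup.of ⟨i, h⟩ else 1

/-- The unrestricted free product: the inverse limit of the free groups on `{0, …, n - 1}`. -/
def unrestricted : Subgroup (∀ n : ℕ, FreeOn (Finset.range n)) where
  carrier := {g | ∀ n m, n ≤ m → proj (Finset.range m) (Finset.range n) (g m) = g n}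
  mul_mem' := by
    intro g g' hg hg' n m h
    simp [hg n m h, hg' n m h]
  one_mem' := by
    intro n m _
    simp
  inv_mem' := by
    intro g hg n m h
    simp [hg n m h]

/-- The projection `p_n` of the inverse limit to the free group on `{0, …, n - 1}`. -/
def pNat (n : ℕ) : unrestricted →* FreeOn (Finset.range n) :=
  (Pi.evalMonoidHom (fun n : ℕ => FreeOn (Finset.range n)) n).comp unrestricted.subtype

/-- The induced projection `p_E` for a finite set `E` of non-negative integers: project to the
free group on some `{0, …, n - 1} ⊇ E`, then to the free group on `E`. -/
def pFin (E : Finset ℕ) : unrestricted →* FreeOn E :=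
  (proj (Finset.range (E.sup id + 1)) E).comp (pNat (E.sup id + 1))

theorem proj_comp_proj {E F G : Finset ℕ} (h : E ⊆ F) :
    (proj F E).comp (proj G F) = proj G E := by
  ext i
  by_cases hF : (i : ℕ) ∈ F
  · simp [proj, hF]
  · have hE : (i : ℕ) ∉ E := fun hE => hF (h hE)
    simp [proj, hF, hE]

/-- `p_E` does not depend on the choice of `n`. -/
theorem pFin_eq {E : Finset ℕ} {n : ℕ} (h : E ⊆ Finset.range n) (g : unrestricted) :
    pFin E g = proj (Finset.range n) E (pNat n g) := by
  have hE : E ⊆ Finset.range (E.sup id + 1) := fun i hi =>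
    Finset.mem_range.2 (Nat.lt_succ_of_le (Finset.le_sup (f := id) hi))
  have hn : E.sup id + 1 ≤ n ∨ n ≤ E.sup id + 1 := le_total _ _
  change proj _ E (g.1 (E.sup id + 1)) = proj _ E (g.1 n)
  rcases hn with hn | hn
  · rw [← g.2 _ _ hn, ← MonoidHom.comp_apply, proj_comp_proj hE]
  · rw [← g.2 _ _ hn, ← MonoidHom.comp_apply, proj_comp_proj h]

/-- The product of the generators `δ_i`, `i ∈ E`, in increasing order of `i`. -/
def orderedProd (E : Finset ℕ) : FreeOn E :=
  (((Finset.univ : Finset E).sort (· ≤ ·)).map FreeGroup.of).prod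

/-- The property `(†)` of an automorphism of the unrestricted free product. -/
def Dagger (a : MulAut unrestricted) : Prop :=
  ∀ m : ℕ, ∃ (E : Finset ℕ) (h : FreeOn (Finset.range m) ≃* FreeOn E)
    (σ : Finset.range m ≃ E),
    (∀ g, pFin E (a g) = h (pNat m g)) ∧
    (∀ i, ∃ U : FreeOn E, h (FreeGroup.of i) = U⁻¹ * FreeGroup.of (σ i) * U) ∧
    h (orderedProd (Finset.range m)) = orderedProd E

/-! ### The automorphism induced by a braid

The free group on `E` is the fundamental group of `ℂ ∖ E`, with a base point `R i` far up the
imaginary axis.  Strings move loops from the plane at time `0` to the plane at time `1`. -/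

/-- The base point `R i`. -/
def basePt (R : ℝ) : ℂ := R * Complex.I

/-- The loop of `δ_k`: the boundary of the triangle with vertices `R i`, `k - 1/2 - i/2` and
`k + 1/2 - i/2`, run through counterclockwise from `R i`. -/
def genLoop (R : ℝ) (k : ℕ) : Path (basePt R) (basePt R) :=
  ((Path.segment (basePt R) ((k : ℂ) - 1 / 2 - Complex.I / 2)).trans
    (Path.segment ((k : ℂ) - 1 / 2 - Complex.I / 2) ((k : ℂ) + 1 / 2 - Complex.I / 2))).trans
    (Path.segment ((k : ℂ) + 1 / 2 - Complex.I / 2) (basePt R))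

/-- The loop of a word in the generators and their inverses, letters read from left to right. -/
def wordLoop (R : ℝ) {E : Finset ℕ} : List (E × Bool) → Path (basePt R) (basePt R)
  | [] => Path.refl _
  | (k, true) :: w => (genLoop R k).trans (wordLoop R w)
  | (k, false) :: w => (genLoop R k).symm.trans (wordLoop R w)

/-- The loop of an element of the free group on `E`, through its reduced word. -/
def loopOf (R : ℝ) {E : Finset ℕ} (w : FreeOn E) : Path (basePt R) (basePt R) :=
  wordLoop R w.toWord

/-- The loop `γ` at time `0` can be moved to the loop `γ'` at time `1`, with a fixed base point
and without ever meeting the first `n` strings of `f`. -/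
def MovesTo (f : Braid omega) (n : ℕ) {x : ℂ} (γ γ' : Path x x) : Prop :=
  ∃ H : C(unitInterval × unitInterval, ℂ), (∀ s, H (s, 0) = γ s) ∧ (∀ s, H (s, 1) = γ' s) ∧
    (∀ t, H (0, t) = x ∧ H (1, t) = x) ∧
    ∀ s t, ∀ i < n, H (s, t) ≠ (f.path t).1 i

/-- The set `σ[n] = {σ(0), …, σ(n - 1)}` of the end points of the first `n` strings. -/
def endSet (f : Braid omega) (n : ℕ) : Finset ℕ := (Finset.range n).map f.perm.toEmbedding

/-- `e` is the isomorphism of free groups induced by the first `n` strings of `f`: if the base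
point is far enough away, then they carry the loop of each generator `δ_i` to the loop of
`e δ_i`. -/
def IsArtinIso (f : Braid omega) (n : ℕ)
    (e : FreeOn (Finset.range n) ≃* FreeOn (endSet f n)) : Prop :=
  ∀ᶠ R : ℝ in Filter.atTop, ∀ i : Finset.range n,
    MovesTo f n (genLoop R i) (loopOf R (e (FreeGroup.of i)))

/-- The automorphism `a` is induced by the braid `f`: for every `n` it covers the isomorphism
induced by the first `n` strings of `f`.  As `f # g` means first `f`, then `g`, it induces the
composite "`a_f`, then `a_g`", which is `a_g * a_f` in `MulAut`; so it is `[f] ↦ a_f⁻¹` that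
respects products in `MulAut`. -/
def Induces (f : Braid omega) (a : MulAut unrestricted) : Prop :=
  ∀ n : ℕ, ∃ e : FreeOn (Finset.range n) ≃* FreeOn (endSet f n),
    IsArtinIso f n e ∧ ∀ g, pFin (endSet f n) (a g) = e (pNat n g)

end

end OmegaBraid

open Set Filter Topology unitInterval

namespace OmegaBraid

noncomputable section

/-! ### Pushing points of the plane along with a moving configuration -/

/-! The proof combines Artin's theorem for finitely many strings with a passage to the limit in
which all choices agree strictly, not just up to homotopy.

A moving finite configuration is cut into short time steps. In each step a map of the plane close to
the identity drags the points of the complement along. This homotopy lifting property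
(`exists_carry`) shows that loops with a far base point can be moved, that the result is unique up
to homotopy, and that it depends only on the homotopy class of the motion. Loops are turned into
words by a covering of `ℂ ∖ E` with the free group as fibre, glued from a slit plane and strips
below the punctures. Its monodromy is the word of a path, and the word determines the homotopy class
(`classWord_injective`).

Hence each motion acts on free groups by isomorphisms (`exists_act_equiv`). Forgetting strings
corresponds to killing generators (`Act.restrict`), so the actions of the first `n` strings form a
compatible system and define an automorphism of the inverse limit. It satisfies `(†)`: a small loop
around a string travels with it and drags a tail, which gives a conjugate of a generator
(`Act.conj`), and a huge loop is not touched at all (`Act.orderedProd`).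

Injectivity: let the action be trivial. Once the first `n` strings are at rest, the last one runs
through a loop in their complement. The word of its dragged tail commutes with `δ_n`, so it dies
when `δ_n` is killed (`proj_eq_one_of_commute`), and the loop is contractible. The null-homotopy of
`n + 1` strings can be chosen to restrict exactly to a given one of `n` strings
(`exists_lift_isNull`), so these null-homotopies fit together to one of the whole sequence.

Surjectivity: exponent sums show that the bijections in `(†)` come from one permutation of `ω`
(`Dagger.exists_perm`). A system of conjugates of generators with the right product is simplified by
Hurwitz transformations that shorten the conjugators (`hurwitz_induction`), and such a
transformation is realized by exchanging two neighbours (`exists_twist`). So every finite level is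
realized by a motion. By injectivity at finite levels (`homotopic_of_act`), consecutive realizations
agree up to a homotopy; it extends over the last string (`exists_carry_last`), so they can be made
to agree exactly, and they glue to a braid. -/

/-- A Lipschitz bump: `1` for `r ≤ d / 4` and `0` for `r ≥ d / 2`. -/
def bump (d r : ℝ) : ℝ := max 0 (min 1 (2 - 4 * r / d))

theorem bump_of_le {d r : ℝ} (hd : 0 < d) (h : r ≤ d / 4) : bump d r = 1 := by
  have : 4 * r / d ≤ 1 := by rw [div_le_one hd]; linarith
  rw [bump, min_eq_left (by linarith), max_eq_right zero_le_one]

theorem bump_of_ge {d r : ℝ} (hd : 0 < d) (h : d / 2 ≤ r) : bump d r = 0 := by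
  have : 2 ≤ 4 * r / d := by rw [le_div_iff₀ hd]; linarith
  rw [bump, max_eq_left (min_le_of_right_le (by linarith))]

theorem abs_bump_sub_le {d : ℝ} (hd : 0 < d) (r s : ℝ) :
    |bump d r - bump d s| ≤ 4 / d * |r - s| := by
  have h1 : |bump d r - bump d s| ≤ |(2 - 4 * r / d) - (2 - 4 * s / d)| := by
    refine (abs_max_sub_max_le_max 0 _ 0 _).trans ?_
    refine max_le (by simp) ((abs_min_sub_min_le_max 1 _ 1 _).trans (max_le (by simp) le_rfl))
  refine h1.trans (le_of_eq ?_)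
  rw [← abs_of_pos (show (0 : ℝ) < 4 / d by positivity), ← abs_mul, ← abs_neg]
  congr 1
  ring

variable {ι : Type*} [Fintype ι]

/-- The map of the plane that moves `u i` to `v i` and is supported near the points `u i`. -/
def push (d : ℝ) (u v : ι → ℂ) (z : ℂ) : ℂ := z + ∑ i, (bump d ‖z - u i‖ : ℂ) * (v i - u i)

theorem push_self (d : ℝ) (u : ι → ℂ) (z : ℂ) : push d u u z = z := by simp [push]

theorem push_of_far {d : ℝ} (hd : 0 < d) (u v : ι → ℂ) {z : ℂ} (h : ∀ i, d / 2 ≤ ‖z - u i‖) :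
    push d u v z = z := by
  simp [push, bump_of_ge hd (h _)]

/-- The points `u j` are at least `d` apart, so a point within `d / 4` of one of them lies outside
the bumps of all others. -/
theorem push_of_near {d : ℝ} (hd : 0 < d) {u : ι → ℂ} (v : ι → ℂ)
    (hu : ∀ i j, i ≠ j → d ≤ ‖u i - u j‖) {z : ℂ} {i : ι} (h : ‖z - u i‖ ≤ d / 4) :
    push d u v z = z + (v i - u i) := by
  classical
  rw [push, Finset.sum_eq_single i]
  · simp [bump_of_le hd h]
  · intro j _ hj
    have h1 := hu i j hj.symm
    have h2 : ‖u i - u j‖ ≤ ‖z - u j‖ + ‖z - u i‖ := by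
      have : u i - u j = (z - u j) - (z - u i) := by ring
      rw [this]; exact norm_sub_le _ _
    rw [bump_of_ge hd (by linarith)]; simp
  · simp

/-- The displacement is a contraction: each bump is `4 / d`-Lipschitz and each `u i` moves by at
most `η`, so the Lipschitz constant is at most `4 * card ι * η / d < 1`. Hence no point other than
`u i` can land on `v i`. -/
theorem push_ne {d η : ℝ} (hd : 0 < d) {u v : ι → ℂ}
    (hu : ∀ i j, i ≠ j → d ≤ ‖u i - u j‖) (hη : ∀ i, ‖v i - u i‖ ≤ η)
    (hηd : 4 * Fintype.card ι * η < d) {z : ℂ} {i : ι} (hz : z ≠ u i) :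
    push d u v z ≠ v i := by
  intro h
  have h0 : push d u v (u i) = v i := by
    rw [push_of_near hd v hu (i := i) (by simp; positivity)]; ring
  have h1 : z - u i =
      ∑ j, ((bump d ‖u i - u j‖ - bump d ‖z - u j‖ : ℝ) : ℂ) * (v j - u j) := by
    have := h.trans h0.symm
    simp only [push] at this
    simp only [Complex.ofReal_sub, sub_mul, Finset.sum_sub_distrib]
    linear_combination this
  have h2 : ‖z - u i‖ ≤ ∑ _j : ι, 4 / d * ‖z - u i‖ * η := by
    rw [h1]
    refine (norm_sum_le _ _).trans (Finset.sum_le_sum fun j _ => ?_)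
    rw [← h1, norm_mul, Complex.norm_real, Real.norm_eq_abs]
    refine mul_le_mul ((abs_bump_sub_le hd _ _).trans ?_) (hη j) (norm_nonneg _) (by positivity)
    refine mul_le_mul_of_nonneg_left ?_ (by positivity)
    refine (abs_norm_sub_norm_le _ _).trans (le_of_eq ?_)
    rw [← norm_neg]; congr 1; ring
  rw [Finset.sum_const, Finset.card_univ, nsmul_eq_mul] at h2
  have h3 : 0 < ‖z - u i‖ := norm_pos_iff.2 (sub_ne_zero.2 hz)
  have h4 : (Fintype.card ι : ℝ) * (4 / d * ‖z - u i‖ * η) =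
      ‖z - u i‖ * ((4 * Fintype.card ι * η) / d) := by field_simp
  rw [h4] at h2
  have h5 : (4 * Fintype.card ι * η) / d < 1 := by rwa [div_lt_one hd]
  nlinarith

theorem continuous_push (d : ℝ) {X : Type*} [TopologicalSpace X] {u v : X → ι → ℂ} {z : X → ℂ}
    (hu : Continuous u) (hv : Continuous v) (hz : Continuous z) :
    Continuous fun x => push d (u x) (v x) (z x) := by
  unfold push bump
  refine hz.add (continuous_finsetSum _ fun i _ => ?_)
  have h1 : Continuous fun x => u x i := (continuous_apply i).comp hu
  have h2 : Continuous fun x => v x i := (continuous_apply i).comp hv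
  refine (Complex.continuous_ofReal.comp ?_).mul (h2.sub h1)
  exact continuous_const.max (continuous_const.min
    (continuous_const.sub ((continuous_const.mul (hz.sub h1).norm).div_const d)))

/-! ### Carrying points along in small time steps -/

/-- The number `min (j / N) 1` of the unit interval. -/
def gridPt (N j : ℕ) : I := ⟨min ((j : ℝ) / N) 1, by positivity, min_le_right _ _⟩

theorem gridPt_zero (N : ℕ) : gridPt N 0 = 0 := by ext; simp [gridPt]

theorem gridPt_self {N : ℕ} (hN : N ≠ 0) : gridPt N N = 1 := by
  ext; simp [gridPt, hN]

theorem dist_gridPt (N j : ℕ) (t : I) :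
    dist (min t (gridPt N j)) (min t (gridPt N (j + 1))) ≤ 1 / N := by
  have h1 : dist (min t (gridPt N j)) (min t (gridPt N (j + 1))) ≤
      |((gridPt N j : I) : ℝ) - (gridPt N (j + 1) : I)| := by
    rw [Subtype.dist_eq, Real.dist_eq]
    have := abs_min_sub_min_le_max (t : ℝ) (gridPt N j : I) t (gridPt N (j + 1) : I)
    have h0 : ∀ a b : I, ((min a b : I) : ℝ) = min (a : ℝ) b := fun a b => by
      rcases le_total a b with h | h
      · rw [min_eq_left h, min_eq_left (show (a : ℝ) ≤ b from h)]
      · rw [min_eq_right h, min_eq_right (show (b : ℝ) ≤ a from h)]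
    rw [h0, h0]
    simpa using this
  refine h1.trans ?_
  have := abs_min_sub_min_le_max ((j : ℝ) / N) 1 (((j + 1 : ℕ) : ℝ) / N) 1
  refine this.trans (max_le ?_ (by simp))
  rw [abs_sub_comm, show (((j + 1 : ℕ) : ℝ) / N) - (j : ℝ) / N = 1 / N by push_cast; ring]
  exact (abs_of_nonneg (by positivity)).le

variable {K : Type*} [TopologicalSpace K]

/-- Points of the plane carried along by a family of moving configurations, after `j` steps. -/
def carry (d : ℝ) (N : ℕ) (u : K × I → ι → ℂ) (g : K → ℂ) : ℕ → K × I → ℂ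
  | 0, p => g p.1
  | j + 1, p => push d (u (p.1, min p.2 (gridPt N j))) (u (p.1, min p.2 (gridPt N (j + 1))))
      (carry d N u g j p)

theorem continuous_carry (d : ℝ) (N : ℕ) {u : K × I → ι → ℂ} (hu : Continuous u) {g : K → ℂ}
    (hg : Continuous g) (j : ℕ) : Continuous (carry d N u g j) := by
  induction j with
  | zero => exact hg.comp continuous_fst
  | succ j ih =>
    refine continuous_push d (hu.comp ?_) (hu.comp ?_) ih
    · exact continuous_fst.prodMk (continuous_snd.min continuous_const)
    · exact continuous_fst.prodMk (continuous_snd.min continuous_const)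

/-- Lifting property: over a compact family of moving configurations of finitely many points,
points of the complement can be carried along.  They stay put if the configuration does or if
they are far from it, and they move in parallel with a point that is very close. -/
theorem exists_carry [CompactSpace K] (u : C(K × I, Config ι)) :
    ∃ ε > 0, ∀ g : C(K, ℂ), (∀ k i, g k ≠ (u (k, 0)).1 i) → ∃ G : C(K × I, ℂ),
      (∀ k, G (k, 0) = g k) ∧ (∀ k t i, G (k, t) ≠ (u (k, t)).1 i) ∧
      (∀ k, (∀ t, u (k, t) = u (k, 0)) → ∀ t, G (k, t) = g k) ∧
      (∀ k, (∀ t i, 1 ≤ ‖g k - (u (k, t)).1 i‖) → ∀ t, G (k, t) = g k) ∧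
      (∀ k i, ‖g k - (u (k, 0)).1 i‖ ≤ ε → ∀ t,
        G (k, t) = g k + ((u (k, t)).1 i - (u (k, 0)).1 i)) := by
  classical
  have huc : Continuous fun p => (u p).1 := continuous_subtype_val.comp u.continuous
  have huci : ∀ i, Continuous fun p => (u p).1 i := fun i => (continuous_apply i).comp huc
  -- A lower bound for the mutual distances exists by compactness. It is capped at `1` so that
  -- points at distance at least `1` from the configuration lie outside all bumps.
  obtain ⟨d, hd, hd1, hdu⟩ : ∃ d > 0, d ≤ 1 ∧ ∀ p i j, i ≠ j → d ≤ ‖(u p).1 i - (u p).1 j‖ := by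
    rcases isEmpty_or_nonempty (K × I) with hE | hE
    · exact ⟨1, one_pos, le_rfl, fun p => hE.elim p⟩
    have h1 : ∀ ij : ι × ι, ∃ d > 0, ij.1 ≠ ij.2 → ∀ p, d ≤ ‖(u p).1 ij.1 - (u p).1 ij.2‖ := by
      rintro ⟨i, j⟩
      by_cases hij : i = j
      · exact ⟨1, one_pos, fun h => (h hij).elim⟩
      obtain ⟨p, -, hp⟩ := isCompact_univ.exists_isMinOn (univ_nonempty)
        ((huci i).sub (huci j)).norm.continuousOn
      exact ⟨‖(u p).1 i - (u p).1 j‖, norm_pos_iff.2 (sub_ne_zero.2 fun h => hij ((u p).2 h)),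
        fun _ q => hp (mem_univ q)⟩
    choose d hd hdu using h1
    have hfin : ∃ e > 0, e ≤ 1 ∧ ∀ ij ∈ (Finset.univ : Finset (ι × ι)), e ≤ d ij := by
      induction (Finset.univ : Finset (ι × ι)) using Finset.induction_on with
      | empty => exact ⟨1, one_pos, le_rfl, by simp⟩
      | insert a s _ ih =>
        obtain ⟨e, he, he1, h⟩ := ih
        refine ⟨min e (d a), lt_min he (hd a), (min_le_left _ _).trans he1, fun ij hij => ?_⟩
        rcases Finset.mem_insert.1 hij with rfl | hij
        · exact min_le_right _ _
        · exact (min_le_left _ _).trans (h ij hij)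
    obtain ⟨e, he, he1, h⟩ := hfin
    exact ⟨e, he, he1, fun p i j hij =>
      (h (i, j) (Finset.mem_univ _)).trans (hdu (i, j) hij p)⟩
  obtain ⟨η, hη, hηd⟩ : ∃ η > 0, 4 * (Fintype.card ι : ℝ) * η < d := by
    refine ⟨d / (4 * Fintype.card ι + 1), by positivity, ?_⟩
    rw [← mul_div_assoc, div_lt_iff₀ (by positivity)]
    nlinarith
  obtain ⟨N, hN, hNu⟩ : ∃ N : ℕ, N ≠ 0 ∧ ∀ k (s t : I), dist s t ≤ 1 / N → ∀ i,
      ‖(u (k, t)).1 i - (u (k, s)).1 i‖ ≤ η := by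
    -- Currying makes the time step uniform in `k`: a continuous map from `I` to the metric space
    -- `C(K, ι → ℂ)` is uniformly continuous.
    let U : C(I, C(K, ι → ℂ)) :=
      (⟨fun p : I × K => (u (p.2, p.1)).1, huc.comp continuous_swap⟩ : C(I × K, ι → ℂ)).curry
    have hU := (CompactSpace.uniformContinuous_of_continuous U.continuous)
    obtain ⟨δ, hδ, hδU⟩ := Metric.uniformContinuous_iff.1 hU η hη
    obtain ⟨N, hN⟩ := exists_nat_one_div_lt hδ
    refine ⟨N + 1, by simp, fun k s t hst i => ?_⟩
    have h1 := hδU (a := t) (b := s) (by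
      rw [dist_comm]; exact lt_of_le_of_lt hst (by simpa using hN))
    have h2 := (ContinuousMap.dist_apply_le_dist (f := U t) (g := U s) k).trans h1.le
    have h3 := (dist_le_pi_dist _ _ i).trans h2
    rwa [dist_eq_norm] at h3
  refine ⟨d / 4, by positivity, fun g hg => ?_⟩
  let G := carry d N (fun p => (u p).1) g
  have hstep : ∀ j k t i, ‖(u (k, min t (gridPt N (j + 1)))).1 i -
      (u (k, min t (gridPt N j))).1 i‖ ≤ η := fun j k t i => hNu k _ _ (dist_gridPt N j t) i
  -- Step `j` runs from time `min t (j / N)` to `min t ((j + 1) / N)`: it starts from time `0`, is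
  -- idle once `t` is reached, and after `N` steps has arrived at time `t`.
  have hfin : ∀ t : I, min t (gridPt N N) = t := fun t => by
    rw [gridPt_self hN]; exact min_eq_left le_one'
  have hini : ∀ t : I, min t (gridPt N 0) = 0 := fun t => by
    rw [gridPt_zero]; exact min_eq_right nonneg'
  have hne : ∀ j k t i, G j (k, t) ≠ (u (k, min t (gridPt N j))).1 i := by
    intro j
    induction j with
    | zero => intro k t i; rw [hini]; exact hg k i
    | succ j ih =>
      intro k t i
      exact push_ne hd (hdu _) (fun i => hstep j k t i) hηd (ih k t i)
  have hst : ∀ k, (∀ t, u (k, t) = u (k, 0)) → ∀ j t, G j (k, t) = g k := by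
    intro k hk j t
    induction j with
    | zero => rfl
    | succ j ih =>
      change push d (u (k, min t (gridPt N j))).1 (u (k, min t (gridPt N (j + 1)))).1 (G j (k, t))
        = g k
      rw [hk (min t (gridPt N j)), hk (min t (gridPt N (j + 1))), push_self, ih]
  refine ⟨⟨G N, continuous_carry d N huc g.continuous N⟩, fun k => ?_, fun k t i => ?_,
    fun k hk t => hst k hk N t, fun k hk t => ?_, fun k i hi t => ?_⟩
  · have h0 : ∀ j, G j (k, 0) = g k := by
      intro j
      induction j with
      | zero => rfl
      | succ j ih =>
        change push d (u (k, min 0 (gridPt N j))).1 (u (k, min 0 (gridPt N (j + 1)))).1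
          (G j (k, 0)) = g k
        have h : ∀ s : I, min 0 s = 0 := fun s => min_eq_left nonneg'
        rw [h, h, push_self, ih]
    exact h0 N
  · have := hne N k t i
    rwa [hfin] at this
  · have h0 : ∀ j, G j (k, t) = g k := by
      intro j
      induction j with
      | zero => rfl
      | succ j ih =>
        change push d (u (k, min t (gridPt N j))).1 (u (k, min t (gridPt N (j + 1)))).1
          (G j (k, t)) = g k
        rw [ih, push_of_far hd]
        intro i
        have := hk (min t (gridPt N j)) i
        linarith
    exact h0 N
  · have h0 : ∀ j, G j (k, t) = g k + ((u (k, min t (gridPt N j))).1 i - (u (k, 0)).1 i) := by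
      intro j
      induction j with
      | zero => rw [hini]; simp [G, carry]
      | succ j ih =>
        change push d (u (k, min t (gridPt N j))).1 (u (k, min t (gridPt N (j + 1)))).1
          (G j (k, t)) = _
        rw [push_of_near hd _ (hdu _) (i := i), ih]
        · ring
        · rw [ih]
          refine le_trans (le_of_eq ?_) hi
          congr 1; ring
    have := h0 N
    rwa [hfin] at this

/-! ### Moving paths along with configurations -/

/-- The path `γ` avoids the set `S`. -/
def Off (S : Set ℂ) {x y : ℂ} (γ : Path x y) : Prop := ∀ t, γ t ∉ S

/-- The paths `γ` and `γ'` are homotopic, relative to their end points, in the complement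
of `S`. -/
def HomOff (S : Set ℂ) {x y : ℂ} (γ γ' : Path x y) : Prop :=
  ∃ H : C(I × I, ℂ), (∀ s, H (s, 0) = γ s) ∧ (∀ s, H (s, 1) = γ' s) ∧
    (∀ t, H (0, t) = x ∧ H (1, t) = y) ∧ ∀ s t, H (s, t) ∉ S

/-- The path `γ` at time `0` can be moved to `γ'` at time `1`, with fixed end points and without
meeting the strings of `p`. -/
def Moves {ι : Type*} {u v : Config ι} (p : Path u v) {x y : ℂ} (γ γ' : Path x y) : Prop :=
  ∃ H : C(I × I, ℂ), (∀ s, H (s, 0) = γ s) ∧ (∀ s, H (s, 1) = γ' s) ∧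
    (∀ t, H (0, t) = x ∧ H (1, t) = y) ∧ ∀ s t i, H (s, t) ≠ (p t).1 i

theorem exists_vconcat (H₁ H₂ : C(I × I, ℂ)) (h : ∀ s, H₁ (s, 1) = H₂ (s, 0)) :
    ∃ H : C(I × I, ℂ), ∀ s t, H (s, t) = if h : (t : ℝ) ≤ 1 / 2 then
      H₁ (s, ⟨2 * t, (unitInterval.mul_pos_mem_iff zero_lt_two).2 ⟨t.2.1, h⟩⟩)
      else H₂ (s, ⟨2 * t - 1, unitInterval.two_mul_sub_one_mem_iff.2 ⟨(not_le.1 h).le, t.2.2⟩⟩) := by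
  let c (H : C(I × I, ℂ)) : C(I, C(I, ℂ)) := (H.comp ⟨Prod.swap, continuous_swap⟩).curry
  let P₁ : Path (c H₁ 0) (c H₁ 1) := ⟨c H₁, rfl, rfl⟩
  let P₂ : Path (c H₁ 1) (c H₂ 1) := ⟨c H₂, by ext s; exact (h s).symm, rfl⟩
  refine ⟨(ContinuousMap.uncurry (P₁.trans P₂).toContinuousMap).comp
    ⟨Prod.swap, continuous_swap⟩, fun s t => ?_⟩
  change (P₁.trans P₂) t s = _
  rw [Path.trans_apply]
  split_ifs <;> rfl

/-- This reduces to `exists_vconcat` by exchanging the two coordinates. There, currying turns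
homotopies into paths in `C(I, ℂ)`, and continuity of the glued map is that of `Path.trans`. -/
theorem exists_hconcat (H₁ H₂ : C(I × I, ℂ)) (h : ∀ t, H₁ (1, t) = H₂ (0, t)) :
    ∃ H : C(I × I, ℂ), ∀ s t, H (s, t) = if h : (s : ℝ) ≤ 1 / 2 then
      H₁ (⟨2 * s, (unitInterval.mul_pos_mem_iff zero_lt_two).2 ⟨s.2.1, h⟩⟩, t)
      else H₂ (⟨2 * s - 1, unitInterval.two_mul_sub_one_mem_iff.2 ⟨(not_le.1 h).le, s.2.2⟩⟩, t) := by
  obtain ⟨H, hH⟩ := exists_vconcat (H₁.comp ⟨Prod.swap, continuous_swap⟩)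
    (H₂.comp ⟨Prod.swap, continuous_swap⟩) h
  exact ⟨H.comp ⟨Prod.swap, continuous_swap⟩, fun s t => hH t s⟩

namespace Moves

variable {ι : Type*} {u v w : Config ι} {x y z : ℂ}

theorem refl_iff {γ γ' : Path x y} : Moves (Path.refl u) γ γ' ↔ HomOff (range u.1) γ γ' := by
  simp only [Moves, HomOff, mem_range, not_exists, Path.refl_apply, ne_comm, ne_eq]

theorem trans_strings {p : Path u v} {q : Path v w} {γ γ' γ'' : Path x y} (h : Moves p γ γ')
    (h' : Moves q γ' γ'') : Moves (p.trans q) γ γ'' := by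
  obtain ⟨H₁, a₁, b₁, c₁, d₁⟩ := h
  obtain ⟨H₂, a₂, b₂, c₂, d₂⟩ := h'
  obtain ⟨H, hH⟩ := exists_vconcat H₁ H₂ fun s => by rw [b₁, a₂]
  refine ⟨H, fun s => ?_, fun s => ?_, fun t => ?_, fun s t i => ?_⟩
  · rw [hH, dif_pos (by simp)]
    convert a₁ s using 3
    ext; simp
  · rw [hH, dif_neg (by norm_num)]
    convert b₂ s using 3
    ext; simp; norm_num
  · rw [hH, hH]
    split_ifs
    exacts [c₁ _, c₂ _]
  · rw [hH, Path.trans_apply]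
    split_ifs
    exacts [d₁ _ _ _, d₂ _ _ _]

theorem symm_strings {p : Path u v} {γ γ' : Path x y} (h : Moves p γ γ') :
    Moves p.symm γ' γ := by
  obtain ⟨H, a, b, c, d⟩ := h
  refine ⟨H.comp ⟨fun q => (q.1, σ q.2), by fun_prop⟩, fun s => ?_, fun s => ?_, fun t => ?_,
    fun s t i => ?_⟩
  · simp [b]
  · simp [a]
  · exact c _
  · exact d _ _ _

theorem trans_paths {p : Path u v} {γ γ' : Path x y} {δ δ' : Path y z} (h : Moves p γ γ')
    (h' : Moves p δ δ') : Moves p (γ.trans δ) (γ'.trans δ') := by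
  obtain ⟨H₁, a₁, b₁, c₁, d₁⟩ := h
  obtain ⟨H₂, a₂, b₂, c₂, d₂⟩ := h'
  obtain ⟨H, hH⟩ := exists_hconcat H₁ H₂ fun t => by rw [(c₁ t).2, (c₂ t).1]
  refine ⟨H, fun s => ?_, fun s => ?_, fun t => ⟨?_, ?_⟩, fun s t i => ?_⟩
  · rw [hH, Path.trans_apply]
    split_ifs
    exacts [a₁ _, a₂ _]
  · rw [hH, Path.trans_apply]
    split_ifs
    exacts [b₁ _, b₂ _]
  · rw [hH, dif_pos (by simp)]
    convert (c₁ t).1 using 3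
    ext; simp
  · rw [hH, dif_neg (by norm_num)]
    convert (c₂ t).2 using 3
    ext; simp; norm_num
  · rw [hH]
    split_ifs
    exacts [d₁ _ _ _, d₂ _ _ _]

theorem symm_paths {p : Path u v} {γ γ' : Path x y} (h : Moves p γ γ') :
    Moves p γ.symm γ'.symm := by
  obtain ⟨H, a, b, c, d⟩ := h
  refine ⟨H.comp ⟨fun q => (σ q.1, q.2), by fun_prop⟩, fun s => ?_, fun s => ?_, fun t => ?_,
    fun s t i => ?_⟩
  · simp [a]
  · simp [b]
  · simpa using (c t).symm
  · exact d _ _ _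

theorem of_forall_ne {p : Path u v} {γ : Path x y} (h : ∀ s t i, γ s ≠ (p t).1 i) :
    Moves p γ γ :=
  ⟨γ.toContinuousMap.comp ⟨Prod.fst, continuous_fst⟩, fun _ => rfl, fun _ => rfl,
    fun _ => ⟨γ.source, γ.target⟩, fun s t i => h s t i⟩

theorem off_left {p : Path u v} {γ γ' : Path x y} (h : Moves p γ γ') : Off (range u.1) γ := by
  obtain ⟨H, a, b, c, d⟩ := h
  rintro s ⟨i, hi⟩
  have := d s 0 i
  rw [a, p.source] at this
  exact this hi.symm

theorem off_right {p : Path u v} {γ γ' : Path x y} (h : Moves p γ γ') : Off (range v.1) γ' :=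
  h.symm_strings.off_left

/-- Only the strings that are kept matter. -/
theorem map_strings {κ : Type*} {p : Path u v} {u' v' : Config κ} {p' : Path u' v'}
    {γ γ' : Path x y} (h : Moves p γ γ') (r : κ → ι) (hr : ∀ t i, (p' t).1 i = (p t).1 (r i)) :
    Moves p' γ γ' := by
  obtain ⟨H, a, b, c, d⟩ := h
  exact ⟨H, a, b, c, fun s t i => by rw [hr]; exact d s t (r i)⟩

/-- The whole trace of the motion, a family of points indexed by the square, is carried along in the
homotopy parameter. At times `0` and `1` the configuration does not depend on that parameter, so
both loops are kept; the end points are too far away to be affected. -/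
theorem of_homotopy [Fintype ι] {p q : Path u v} (F : p.Homotopy q)
    (hx : ∀ r i, 1 ≤ ‖x - (F r).1 i‖) (hy : ∀ r i, 1 ≤ ‖y - (F r).1 i‖) {γ γ' : Path x y}
    (h : Moves p γ γ') : Moves q γ γ' := by
  obtain ⟨H, a, b, c, d⟩ := h
  obtain ⟨ε, -, hε⟩ := exists_carry (K := I × I)
    (F.toContinuousMap.comp ⟨fun q => (q.2, q.1.2), by fun_prop⟩)
  obtain ⟨G, G0, G1, G2, G3, -⟩ := hε H fun k i => by
    have : F (0, k.2) = p k.2 := F.apply_zero _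
    change H k ≠ (F (0, k.2)).1 i
    rw [this]; exact d k.1 k.2 i
  refine ⟨G.comp ⟨fun q => (q, 1), by fun_prop⟩, fun s => ?_, fun s => ?_, fun t => ⟨?_, ?_⟩,
    fun s t i => ?_⟩
  · refine (G2 (s, 0) (fun t => ?_) 1).trans (a s)
    exact (F.source t).trans (F.source 0).symm
  · refine (G2 (s, 1) (fun t => ?_) 1).trans (b s)
    exact (F.target t).trans (F.target 0).symm
  · refine (G3 (0, t) (fun r i => ?_) 1).trans (c t).1
    rw [(c t).1]; exact hx _ _
  · refine (G3 (1, t) (fun r i => ?_) 1).trans (c t).2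
    rw [(c t).2]; exact hy _ _
  · have := G1 (s, t) 1 i
    have h2 : F (1, t) = q t := F.apply_one _
    change G ((s, t), 1) ≠ _
    rw [← h2]; exact this

end Moves

theorem norm_basePt_sub (R : ℝ) (z : ℂ) : R - ‖z‖ ≤ ‖basePt R - z‖ := by
  have h1 : ‖basePt R‖ = |R| := by simp [basePt]
  have := norm_sub_norm_le (basePt R) z
  have := le_abs_self R
  linarith

/-- The points of a compact family of finite configurations are far from the base point. -/
theorem eventually_far {ι K : Type*} [Finite ι] [TopologicalSpace K] [CompactSpace K]
    (F : C(K, Config ι)) : ∀ᶠ R in atTop, ∀ k i, ‖(F k).1 i‖ + 1 ≤ R := by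
  have h1 : ∀ i, ∀ᶠ R in atTop, ∀ k, ‖(F k).1 i‖ + 1 ≤ R := by
    intro i
    have hc : Continuous fun k => ‖(F k).1 i‖ :=
      ((continuous_apply i).comp (continuous_subtype_val.comp F.continuous)).norm
    obtain ⟨M, hM⟩ := (isCompact_range hc).bddAbove
    filter_upwards [eventually_ge_atTop (M + 1)] with R hR k
    linarith [hM ⟨k, rfl⟩]
  filter_upwards [eventually_all.2 h1] with R hR k i using hR i k

/-! ### Moving loops with a far base point -/

section Eventually

variable {ι : Type*} [Fintype ι] {u v w : Config ι}

theorem eventually_far_path (p : Path u v) : ∀ᶠ R in atTop, ∀ t i, ‖(p t).1 i‖ + 1 ≤ R :=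
  eventually_far p.toContinuousMap

theorem moves_of_homotopic {p q : Path u v} (h : p.Homotopic q) :
    ∀ᶠ R in atTop, ∀ γ γ' : Path (basePt R) (basePt R), Moves p γ γ' → Moves q γ γ' := by
  obtain ⟨F⟩ := h
  filter_upwards [eventually_far F.toContinuousMap] with R hR γ γ' hγ
  have h1 : ∀ r i, 1 ≤ ‖basePt R - (F r).1 i‖ := fun r i => by
    have := norm_basePt_sub R ((F r).1 i)
    have := hR r i
    simp only [ContinuousMap.HomotopyWith.coe_toContinuousMap] at this
    change ‖(F r).1 i‖ + 1 ≤ R at this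
    linarith
  exact hγ.of_homotopy F h1 h1

/-- Every loop can be moved; near a string it moves in parallel with the string. -/
theorem exists_moves (p : Path u v) : ∃ ε > 0, ∀ R : ℝ, (∀ t i, ‖(p t).1 i‖ + 1 ≤ R) →
    ∀ γ : Path (basePt R) (basePt R), Off (range u.1) γ →
    ∃ H : C(I × I, ℂ), (∀ s, H (s, 0) = γ s) ∧ (∀ t, H (0, t) = basePt R ∧ H (1, t) = basePt R) ∧
      (∀ s t i, H (s, t) ≠ (p t).1 i) ∧
      ∀ s i, ‖γ s - u.1 i‖ ≤ ε → ∀ t, H (s, t) = γ s + ((p t).1 i - u.1 i) := by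
  obtain ⟨ε, hε, h⟩ := exists_carry (K := I)
    (p.toContinuousMap.comp ⟨Prod.snd, continuous_snd⟩)
  refine ⟨ε, hε, fun R hR γ hγ => ?_⟩
  have hfar : ∀ t i, 1 ≤ ‖basePt R - (p t).1 i‖ := fun t i => by
    have := norm_basePt_sub R ((p t).1 i)
    have := hR t i
    linarith
  obtain ⟨G, G0, G1, -, G3, G4⟩ := h γ.toContinuousMap fun k i h => by
    have : p 0 = u := p.source
    change γ k = (p 0).1 i at h
    rw [this] at h
    exact hγ k ⟨i, h.symm⟩
  refine ⟨G, G0, fun t => ⟨?_, ?_⟩, fun s t i => G1 s t i, fun s i hs t => ?_⟩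
  · refine (G3 0 (fun t i => ?_) t).trans γ.source
    change 1 ≤ ‖γ 0 - (p t).1 i‖
    rw [γ.source]; exact hfar t i
  · refine (G3 1 (fun t i => ?_) t).trans γ.target
    change 1 ≤ ‖γ 1 - (p t).1 i‖
    rw [γ.target]; exact hfar t i
  · have h0 : p 0 = u := p.source
    have := G4 s i (by change ‖γ s - (p 0).1 i‖ ≤ ε; rwa [h0]) t
    change _ = γ s + ((p t).1 i - (p 0).1 i) at this
    rwa [h0] at this

theorem eventually_exists_moves (p : Path u v) : ∀ᶠ R in atTop,
    ∀ γ : Path (basePt R) (basePt R), Off (range u.1) γ → ∃ γ', Moves p γ γ' := by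
  obtain ⟨ε, -, h⟩ := exists_moves p
  filter_upwards [eventually_far_path p] with R hR γ hγ
  obtain ⟨H, a, c, d, -⟩ := h R hR γ hγ
  exact ⟨⟨H.comp ⟨fun s => (s, 1), by fun_prop⟩, (c 1).1, (c 1).2⟩, H, a, fun _ => rfl, c, d⟩

/-- A homotopy in the complement of `u` is a motion along the constant path, and inserting a
constant path does not change the homotopy class of the motion. -/
theorem moves_congr_left (p : Path u v) : ∀ᶠ R in atTop,
    ∀ γ γ₁ γ' : Path (basePt R) (basePt R), HomOff (range u.1) γ γ₁ → Moves p γ₁ γ' →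
      Moves p γ γ' := by
  filter_upwards [moves_of_homotopic ⟨Path.Homotopy.reflTrans p⟩] with R hR γ γ₁ γ' h h'
  exact hR _ _ ((Moves.refl_iff.2 h).trans_strings h')

theorem moves_congr_right (p : Path u v) : ∀ᶠ R in atTop,
    ∀ γ γ₁ γ' : Path (basePt R) (basePt R), Moves p γ γ₁ → HomOff (range v.1) γ₁ γ' →
      Moves p γ γ' := by
  filter_upwards [moves_of_homotopic ⟨Path.Homotopy.transRefl p⟩] with R hR γ γ₁ γ' h h'
  exact hR _ _ (h.trans_strings (Moves.refl_iff.2 h'))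

/-- Going back along `p` and then forth moves `γ₁` to `γ₂`; this motion of the strings is homotopic
to the constant one. -/
theorem moves_unique (p : Path u v) : ∀ᶠ R in atTop,
    ∀ γ γ₁ γ₂ : Path (basePt R) (basePt R), Moves p γ γ₁ → Moves p γ γ₂ →
      HomOff (range v.1) γ₁ γ₂ := by
  filter_upwards [moves_of_homotopic ⟨(Path.Homotopy.reflSymmTrans p).symm⟩] with R hR γ γ₁ γ₂ h h'
  exact Moves.refl_iff.1 (hR _ _ (h.symm_strings.trans_strings h'))

end Eventually

/-! ### Homotopy classes in the complement of a set -/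

section Classes

variable {S : Set ℂ} {x y z : ℂ}

theorem Off.source {γ : Path x y} (h : Off S γ) : x ∈ Sᶜ := by simpa using h 0

theorem Off.target {γ : Path x y} (h : Off S γ) : y ∈ Sᶜ := by simpa using h 1

theorem Off.trans {γ : Path x y} {δ : Path y z} (h : Off S γ) (h' : Off S δ) :
    Off S (γ.trans δ) := by
  intro t
  rw [Path.trans_apply]
  split_ifs
  exacts [h _, h' _]

theorem Off.symm {γ : Path x y} (h : Off S γ) : Off S γ.symm := fun t => h (σ t)

theorem Off.refl (h : x ∉ S) : Off S (Path.refl x) := fun _ => h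

/-- A path in the complement of `S`. -/
def Off.lift {γ : Path x y} (h : Off S γ) :
    Path (⟨x, h.source⟩ : (Sᶜ : Set ℂ)) ⟨y, h.target⟩ where
  toFun t := ⟨γ t, h t⟩
  continuous_toFun := γ.continuous.subtype_mk _
  source' := Subtype.ext γ.source
  target' := Subtype.ext γ.target

theorem Off.lift_trans {γ : Path x y} {δ : Path y z} (h : Off S γ) (h' : Off S δ) :
    (h.trans h').lift = h.lift.trans h'.lift := by
  ext t
  simp only [Off.lift, Path.coe_mk_mk, Path.trans_apply]
  split_ifs <;> rfl

theorem homOff_iff {γ γ' : Path x y} (h : Off S γ) (h' : Off S γ') :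
    HomOff S γ γ' ↔ h.lift.Homotopic h'.lift := by
  constructor
  · rintro ⟨H, a, b, c, d⟩
    refine ⟨⟨⟨⟨fun q => ⟨H (q.2, q.1), d _ _⟩, by fun_prop⟩, fun s => ?_, fun s => ?_⟩,
      fun t s hs => ?_⟩⟩
    · exact Subtype.ext (a s)
    · exact Subtype.ext (b s)
    · rcases hs with rfl | hs
      · exact Subtype.ext ((c t).1.trans γ.source.symm)
      · rw [mem_singleton_iff.1 hs]
        exact Subtype.ext ((c t).2.trans γ.target.symm)
  · rintro ⟨F⟩
    refine ⟨⟨fun q => (F (q.2, q.1)).1, by fun_prop⟩, fun s => ?_, fun s => ?_, fun t => ⟨?_, ?_⟩,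
      fun s t => (F (t, s)).2⟩
    · exact congrArg Subtype.val (F.apply_zero s)
    · exact congrArg Subtype.val (F.apply_one s)
    · exact congrArg Subtype.val (F.source t)
    · exact congrArg Subtype.val (F.target t)

theorem HomOff.off_left {γ γ' : Path x y} (h : HomOff S γ γ') : Off S γ := by
  obtain ⟨H, a, b, c, d⟩ := h
  intro s; rw [← a]; exact d _ _

theorem HomOff.off_right {γ γ' : Path x y} (h : HomOff S γ γ') : Off S γ' := by
  obtain ⟨H, a, b, c, d⟩ := h
  intro s; rw [← b]; exact d _ _

theorem HomOff.mono {S' : Set ℂ} (hS : S' ⊆ S) {γ γ' : Path x y} (h : HomOff S γ γ') :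
    HomOff S' γ γ' := by
  obtain ⟨H, a, b, c, d⟩ := h
  exact ⟨H, a, b, c, fun s t hs => d s t (hS hs)⟩

end Classes

/-! ### Generation of the fundamental groupoid by the paths in the sets of an open cover -/

/-- A property of homotopy classes of paths that holds inside each set of an open cover and is
closed under concatenation holds for all classes. -/
theorem pathClass_induction {X κ : Type*} [TopologicalSpace X] {V : κ → Set X}
    (hV : ∀ i, IsOpen (V i)) (hcov : ∀ x, ∃ i, x ∈ V i)
    {P : ∀ x y : X, Path.Homotopic.Quotient x y → Prop}
    (hcell : ∀ i x y (γ : Path x y), (∀ t, γ t ∈ V i) → P x y (.mk γ))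
    (htrans : ∀ x y z c d, P x y c → P y z d → P x z (c.trans d)) :
    ∀ x y c, P x y c := by
  intro x y c
  obtain ⟨γ, rfl⟩ := Path.Homotopic.Quotient.mk_surjective c
  -- Lebesgue subdivision: each piece of the path stays in one set of the cover.
  obtain ⟨t, ht0, htm, ⟨n, hn⟩, ht⟩ := exists_monotone_Icc_subset_open_cover_unitInterval
    (c := fun i => γ ⁻¹' V i) (fun i => (hV i).preimage γ.continuous)
    (fun s _ => mem_iUnion.2 (hcov (γ s)))
  have h1 : ∀ m, P _ _ (.mk (γ.subpath (t 0) (t m))) := by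
    intro m
    induction m with
    | zero =>
      obtain ⟨i, hi⟩ := hcov (γ (t 0))
      exact hcell i _ _ _ fun s => by rw [Path.subpath_self]; exact hi
    | succ m ih =>
      obtain ⟨i, hi⟩ := ht m
      have h2 := hcell i _ _ (γ.subpath (t m) (t (m + 1))) fun s => by
        have : γ.subpath (t m) (t (m + 1)) s ∈ range (γ.subpath (t m) (t (m + 1))) := ⟨s, rfl⟩
        rw [Path.range_subpath_of_le _ _ _ (htm (Nat.le_succ m))] at this
        obtain ⟨r, hr, hr'⟩ := this
        rw [← hr']; exact hi hr
      have h3 := htrans _ _ _ _ _ ih h2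
      rwa [← Path.Homotopic.Quotient.mk_trans,
        Path.Homotopic.Quotient.eq.2 ⟨Path.Homotopy.subpathTransSubpath γ _ _ _⟩] at h3
  have h2 := h1 n
  rw [ht0, hn n le_rfl, Path.subpath_zero_one] at h2
  -- The subdivision yields a path whose end points are `γ 0` and `γ 1`, which equal `x` and `y`
  -- only propositionally.
  have h3 : ∀ x' y' (hx : x' = x) (hy : y' = y),
      P x' y' (.mk (γ.cast hx hy)) → P x y (.mk γ) := by
    rintro _ _ rfl rfl h; exact h
  exact h3 _ _ γ.source γ.target h2

/-- Homotopy classes of loops, with concatenation from left to right as product. -/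
abbrev LoopClass {X : Type*} [TopologicalSpace X] (b : X) : Type _ := Path.Homotopic.Quotient b b

instance LoopClass.group {X : Type*} [TopologicalSpace X] (b : X) : Group (LoopClass b) where
  mul := Path.Homotopic.Quotient.trans
  one := Path.Homotopic.Quotient.refl b
  inv := Path.Homotopic.Quotient.symm
  mul_assoc := Path.Homotopic.Quotient.trans_assoc
  one_mul := Path.Homotopic.Quotient.refl_trans
  mul_one := Path.Homotopic.Quotient.trans_refl
  inv_mul_cancel := Path.Homotopic.Quotient.symm_trans

theorem LoopClass.mul_trans {X : Type*} [TopologicalSpace X] {b y : X} (c d : LoopClass b)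
    (e : Path.Homotopic.Quotient b y) :
    Path.Homotopic.Quotient.trans (c * d) e =
      Path.Homotopic.Quotient.trans c (Path.Homotopic.Quotient.trans d e) :=
  Path.Homotopic.Quotient.trans_assoc c d e

theorem LoopClass.one_trans {X : Type*} [TopologicalSpace X] {b y : X}
    (e : Path.Homotopic.Quotient b y) :
    Path.Homotopic.Quotient.trans (1 : LoopClass b) e = e :=
  Path.Homotopic.Quotient.refl_trans e

/-- The class `c` is represented by a path in `V`. -/
def InSet {S : Set ℂ} (V : Set ℂ) {x y : (Sᶜ : Set ℂ)} (c : Path.Homotopic.Quotient x y) : Prop :=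
  ∃ γ : Path x y, (∀ t, (γ t : ℂ) ∈ V) ∧ .mk γ = c

namespace InSet

variable {S V : Set ℂ} {x y z : (Sᶜ : Set ℂ)}

theorem mono {V' : Set ℂ} (h : V ⊆ V') {c : Path.Homotopic.Quotient x y} (hc : InSet V c) :
    InSet V' c := by
  obtain ⟨γ, h1, h2⟩ := hc
  exact ⟨γ, fun t => h (h1 t), h2⟩

theorem trans {c : Path.Homotopic.Quotient x y} {d : Path.Homotopic.Quotient y z}
    (hc : InSet V c) (hd : InSet V d) : InSet V (c.trans d) := by
  obtain ⟨γ, h1, rfl⟩ := hc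
  obtain ⟨δ, h2, rfl⟩ := hd
  refine ⟨γ.trans δ, fun t => ?_, rfl⟩
  rw [Path.trans_apply]
  split_ifs
  exacts [h1 _, h2 _]

theorem exists_of_mem [PathConnectedSpace V] (hV : V ⊆ Sᶜ) (hx : (x : ℂ) ∈ V) (hy : (y : ℂ) ∈ V) :
    ∃ c : Path.Homotopic.Quotient x y, InSet V c := by
  let γ : Path (⟨x, hx⟩ : V) ⟨y, hy⟩ := PathConnectedSpace.somePath _ _
  exact ⟨_, γ.map (continuous_inclusion hV), fun t => (γ t).2, rfl⟩

theorem unique [SimplyConnectedSpace V] (hV : V ⊆ Sᶜ) {c d : Path.Homotopic.Quotient x y}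
    (hc : InSet V c) (hd : InSet V d) : c = d := by
  obtain ⟨γ, h1, rfl⟩ := hc
  obtain ⟨δ, h2, rfl⟩ := hd
  have hx : (x : ℂ) ∈ V := by have := h1 0; rwa [γ.source] at this
  have hy : (y : ℂ) ∈ V := by have := h1 1; rwa [γ.target] at this
  let γ' : Path (⟨x, hx⟩ : V) ⟨y, hy⟩ :=
    ⟨⟨fun t => ⟨γ t, h1 t⟩, by fun_prop⟩, Subtype.ext (by simp), Subtype.ext (by simp)⟩
  let δ' : Path (⟨x, hx⟩ : V) ⟨y, hy⟩ :=
    ⟨⟨fun t => ⟨δ t, h2 t⟩, by fun_prop⟩, Subtype.ext (by simp), Subtype.ext (by simp)⟩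
  have h := SimplyConnectedSpace.paths_homotopic γ' δ'
  exact Path.Homotopic.Quotient.eq.2 (h.map ⟨inclusion hV, continuous_inclusion hV⟩)

end InSet

/-! ### The slit plane and the strips -/

/-- The finite set `E` as a subset of the plane. -/
def punct (E : Finset ℕ) : Set ℂ := (fun k : ℕ => (k : ℂ)) '' E

/-- The plane without the vertical half lines that go down from the points of `E`. -/
def slit (E : Finset ℕ) : Set ℂ := {z | 0 < z.im ∨ ∀ k ∈ E, z.re ≠ k}

/-- The part of the vertical strip of width `2` about `k` in the lower half plane. -/
def strip (k : ℕ) : Set ℂ := {z | z.im < 0 ∧ |z.re - k| < 1}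

theorem mem_punct_iff {E : Finset ℕ} {z : ℂ} :
    z ∈ punct E ↔ ∃ k ∈ E, z.re = k ∧ z.im = 0 := by
  constructor
  · rintro ⟨k, hk, rfl⟩
    exact ⟨k, hk, by simp, by simp⟩
  · rintro ⟨k, hk, h1, h2⟩
    exact ⟨k, hk, by apply Complex.ext <;> simp [h1, h2]⟩

theorem slit_subset (E : Finset ℕ) : slit E ⊆ (punct E)ᶜ := by
  intro z hz hz'
  obtain ⟨k, hk, h1, h2⟩ := mem_punct_iff.1 hz'
  rcases hz with h | h
  · linarith
  · exact h k hk h1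

theorem strip_subset (E : Finset ℕ) (k : ℕ) : strip k ⊆ (punct E)ᶜ := by
  intro z hz hz'
  obtain ⟨k, hk, h1, h2⟩ := mem_punct_iff.1 hz'
  linarith [hz.1]

theorem isOpen_slit (E : Finset ℕ) : IsOpen (slit E) := by
  have : slit E = {z | 0 < z.im} ∪ ⋂ k ∈ E, {z : ℂ | z.re ≠ k} := by
    ext z; simp [slit]
  rw [this]
  refine (isOpen_lt continuous_const Complex.continuous_im).union
    (isOpen_biInter_finset fun k _ => ?_)
  exact isOpen_ne.preimage Complex.continuous_re

theorem isOpen_strip (k : ℕ) : IsOpen (strip k) :=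
  (isOpen_lt Complex.continuous_im continuous_const).inter
    (isOpen_lt (Complex.continuous_re.sub continuous_const).abs continuous_const)

theorem convex_strip (k : ℕ) : Convex ℝ (strip k) := by
  have : strip k = {z : ℂ | z.im < 0} ∩ ({z : ℂ | z.re < k + 1} ∩ {z : ℂ | (k : ℝ) - 1 < z.re}) := by
    ext z
    simp only [strip, mem_ofPred_eq, mem_inter_iff, abs_lt]
    constructor
    · rintro ⟨h1, h2, h3⟩; exact ⟨h1, by linarith, by linarith⟩
    · rintro ⟨h1, h2, h3⟩; exact ⟨h1, by linarith, by linarith⟩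
  rw [this]
  exact (convex_halfSpace_im_lt 0).inter ((convex_halfSpace_re_lt _).inter
    (convex_halfSpace_re_gt _))

/-- The point to the lower left of `k`. -/
def lowerLeft (k : ℕ) : ℂ := (k : ℂ) - 1 / 2 - Complex.I / 2

/-- The point to the lower right of `k`. -/
def lowerRight (k : ℕ) : ℂ := (k : ℂ) + 1 / 2 - Complex.I / 2

theorem lowerLeft_re (k : ℕ) : (lowerLeft k).re = k - 1 / 2 := by simp [lowerLeft]

theorem lowerLeft_im (k : ℕ) : (lowerLeft k).im = -1 / 2 := by simp [lowerLeft]; norm_num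

theorem lowerRight_re (k : ℕ) : (lowerRight k).re = k + 1 / 2 := by simp [lowerRight]

theorem lowerRight_im (k : ℕ) : (lowerRight k).im = -1 / 2 := by simp [lowerRight]; norm_num

theorem lowerLeft_mem_strip (k : ℕ) : lowerLeft k ∈ strip k := by
  refine ⟨by rw [lowerLeft_im]; norm_num, ?_⟩
  rw [lowerLeft_re, abs_lt]; constructor <;> linarith

theorem lowerRight_mem_strip (k : ℕ) : lowerRight k ∈ strip k := by
  refine ⟨by rw [lowerRight_im]; norm_num, ?_⟩
  rw [lowerRight_re, abs_lt]; constructor <;> linarith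

theorem natCast_ne_add_half (k j : ℕ) : (k : ℝ) + 1 / 2 ≠ j := by
  intro h
  have : ((2 * k + 1 : ℕ) : ℝ) = ((2 * j : ℕ) : ℝ) := by push_cast; linarith
  have := Nat.cast_injective (R := ℝ) this
  omega

theorem natCast_ne_sub_half (k j : ℕ) : (k : ℝ) - 1 / 2 ≠ j := by
  intro h
  exact natCast_ne_add_half j k (by linarith)

theorem lowerLeft_mem_slit (E : Finset ℕ) (k : ℕ) : lowerLeft k ∈ slit E :=
  .inr fun j _ => by rw [lowerLeft_re]; exact natCast_ne_sub_half k j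

theorem lowerRight_mem_slit (E : Finset ℕ) (k : ℕ) : lowerRight k ∈ slit E :=
  .inr fun j _ => by rw [lowerRight_re]; exact natCast_ne_add_half k j

instance strip_contractible (k : ℕ) : ContractibleSpace (strip k) :=
  (convex_strip k).contractibleSpace ⟨_, lowerLeft_mem_strip k⟩

/-- Moving straight up does not change the real part and so stays in the slit plane. Once every
point is in the upper half plane, a straight-line contraction to `Complex.I` finishes. -/
instance slit_contractible (E : Finset ℕ) : ContractibleSpace (slit E) := by
  rw [contractible_iff_id_nullhomotopic]
  let up : ℂ → ℂ := fun z => z + (|z.im| + 1 : ℝ) * Complex.I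
  have hup : Continuous up := by unfold up; fun_prop
  have hupim : ∀ z, 0 < (up z).im := fun z => by
    have := neg_abs_le z.im
    simp [up]; linarith
  let f : C(slit E, slit E) := ⟨fun z => ⟨up z, .inl (hupim z)⟩, by fun_prop⟩
  refine ⟨⟨Complex.I, .inl (by simp)⟩, ContinuousMap.Homotopic.trans (g := f) ⟨?_⟩ ⟨?_⟩⟩
  · have hmem : ∀ q : I × slit E,
        (q.2 + ((q.1 : ℝ) * (|(q.2 : ℂ).im| + 1) : ℝ) * Complex.I : ℂ) ∈ slit E := by
      intro q
      have h0 : 0 ≤ (q.1 : ℝ) * (|(q.2 : ℂ).im| + 1) := mul_nonneg q.1.2.1 (by positivity)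
      rcases q.2.2 with h | h
      · left; simp at h0 ⊢; linarith
      · right; simpa using h
    refine ⟨⟨fun q => ⟨_, hmem q⟩, Continuous.subtype_mk (by fun_prop) _⟩, fun z => ?_,
      fun z => ?_⟩
    · simp
    · apply Subtype.ext; simp [f, up]
  · have hmem : ∀ q : I × slit E,
        ((1 - (q.1 : ℝ) : ℝ) * up q.2 + (q.1 : ℝ) * Complex.I : ℂ) ∈ slit E := by
      intro q
      left
      have h0 := q.1.2.1
      have h1 := q.1.2.2
      have h2 := hupim q.2
      simp only [Complex.add_im, Complex.im_ofReal_mul, Complex.I_im]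
      rcases h0.eq_or_lt with h | h
      · rw [← h]; simpa using h2
      · have := mul_nonneg (sub_nonneg.2 h1) h2.le
        linarith
    refine ⟨⟨fun q => ⟨_, hmem q⟩, Continuous.subtype_mk (by fun_prop) _⟩, fun z => ?_,
      fun z => ?_⟩
    · apply Subtype.ext; simp [f]
    · apply Subtype.ext; simp

/-! ### The covering of the complement with the free group as fibre -/

/-- The open cover of the complement of `E` by the slit plane and the strips about `k ∈ E`. -/
def cell (E : Finset ℕ) : Option E → Set ℂ
  | none => slit E
  | some k => strip k

theorem isOpen_cell (E : Finset ℕ) (i : Option E) : IsOpen (cell E i) := by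
  cases i
  exacts [isOpen_slit E, isOpen_strip _]

theorem exists_mem_cell {E : Finset ℕ} {z : ℂ} (hz : z ∉ punct E) : ∃ i, z ∈ cell E i := by
  by_cases h : z ∈ slit E
  · exact ⟨none, h⟩
  · simp only [slit, mem_ofPred_eq, not_or, not_lt, not_forall, not_not] at h
    obtain ⟨h0, k, hk, h1⟩ := h
    refine ⟨some ⟨k, hk⟩, lt_of_le_of_ne h0 fun h2 => hz (mem_punct_iff.2 ⟨k, hk, h1, h2⟩), ?_⟩
    simp [h1]

/-- Free groups as discrete spaces. -/
instance (E : Finset ℕ) : TopologicalSpace (FreeOn E) := ⊥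

instance (E : Finset ℕ) : DiscreteTopology (FreeOn E) := ⟨rfl⟩

/-- The transition from the slit plane to a strip: the generator `δ_k` to the right of `k`. -/
def jump {E : Finset ℕ} : Option E → ℂ → FreeOn E
  | none, _ => 1
  | some k, z => if ((k : ℕ) : ℝ) < z.re then FreeGroup.of k else 1

/-- Transitions are locally constant. -/
theorem jump_eventually_eq {E : Finset ℕ} (i j : Option E) {z : ℂ} (hi : z ∈ cell E i)
    (hj : z ∈ cell E j) : ∀ᶠ w in 𝓝 z, jump i w * (jump j w)⁻¹ = jump i z * (jump j z)⁻¹ := by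
  by_cases hij : i = j
  · subst hij; simp
  have key : ∀ (k : E) (i : Option E), i ≠ some k → z ∈ cell E i → z ∈ cell E (some k) →
      ∀ᶠ w in 𝓝 z, jump (some k) w = jump (some k) z := by
    intro k i hik hz hk
    have hne : z.re ≠ (k : ℕ) := by
      rcases i with _ | l
      · rcases hz with h | h
        · have := hk.1; linarith
        · exact h k k.2
      · intro h
        have h1 := hz.2
        rw [h] at h1
        apply hik
        congr 1
        apply Subtype.ext
        rw [abs_lt] at h1
        have h2 : ((k : ℕ) : ℝ) < (l : ℕ) + 1 := by linarith
        have h3 : ((l : ℕ) : ℝ) < (k : ℕ) + 1 := by linarith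
        norm_cast at h2 h3
        omega
    rcases lt_or_gt_of_ne hne with h | h
    · filter_upwards [(isOpen_lt Complex.continuous_re continuous_const).mem_nhds h] with w hw
      rw [jump, jump, if_neg (not_lt.2 (le_of_lt hw)), if_neg (not_lt.2 h.le)]
    · filter_upwards [(isOpen_lt continuous_const Complex.continuous_re).mem_nhds h] with w hw
      rw [jump, jump, if_pos hw, if_pos h]
  have h1 : ∀ᶠ w in 𝓝 z, jump i w = jump i z := by
    rcases i with _ | k
    · simp [jump]
    · exact key k j (Ne.symm hij) hj hi
  have h2 : ∀ᶠ w in 𝓝 z, jump j w = jump j z := by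
    rcases j with _ | k
    · simp [jump]
    · exact key k i hij hi hj
  filter_upwards [h1, h2] with w hw hw₂
  rw [hw, hw₂]

/-- The covering of the complement of `E` with fibre the free group on `E`. -/
def coverCore (E : Finset ℕ) :
    FiberBundleCore (Option E) ((punct E)ᶜ : Set ℂ) (FreeOn E) where
  baseSet i := Subtype.val ⁻¹' cell E i
  isOpen_baseSet i := (isOpen_cell E i).preimage continuous_subtype_val
  indexAt z := (exists_mem_cell z.2).choose
  mem_baseSet_at z := (exists_mem_cell z.2).choose_spec
  coordChange i j z g := g * (jump i z * (jump j z)⁻¹)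
  coordChange_self i z _ v := by
    rw [mul_inv_cancel]
    exact mul_one v
  continuousOn_coordChange i j := by
    rintro ⟨z, g⟩ ⟨⟨hi, hj⟩, -⟩
    apply ContinuousAt.continuousWithinAt
    have h1 : ∀ᶠ p : ((punct E)ᶜ : Set ℂ) × FreeOn E in 𝓝 (z, g),
        p.2 * (jump i p.1 * (jump j p.1)⁻¹) =
          g * (jump i z * (jump j z)⁻¹) := by
      rw [nhds_prod_eq, nhds_discrete (FreeOn E)]
      have h2 := continuous_subtype_val.continuousAt.eventually (jump_eventually_eq i j hi hj)
      filter_upwards [h2.prod_mk (show ∀ᶠ g' in pure g, g' = g from rfl)] with p hp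
      rw [hp.1, hp.2]
    exact continuousAt_const.congr (h1.mono fun p hp => hp.symm)
  coordChange_comp i j k z _ v := by
        group

theorem isCoveringMap_coverCore (E : Finset ℕ) : IsCoveringMap (coverCore E).proj :=
  FiberBundle.isCoveringMap (F := FreeOn E) (E := (coverCore E).Fiber)

/-! ### The word of a path in the complement of `E` -/

section Monodromy

variable {E : Finset ℕ} {x y z : ((punct E)ᶜ : Set ℂ)}

/-- The point over `x` of the covering with coordinate `g` relative to the slit plane. -/
def liftPt (x : ((punct E)ᶜ : Set ℂ)) (g : FreeOn E) : (coverCore E).TotalSpace :=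
  ⟨x, (g * (jump ((coverCore E).indexAt x) x)⁻¹ : FreeOn E)⟩

/-- The coordinate of a point of the covering relative to the slit plane. -/
def slitCoord (e : (coverCore E).TotalSpace) : FreeOn E :=
  (show FreeOn E from e.2) * jump ((coverCore E).indexAt e.1) e.1

theorem slitCoord_liftPt (x : ((punct E)ᶜ : Set ℂ)) (g : FreeOn E) :
    slitCoord (liftPt x g) = g :=
  inv_mul_cancel_right g _

theorem eq_liftPt {e : (coverCore E).TotalSpace} (h : (coverCore E).proj e = x) :
    e = liftPt x (slitCoord e) := by
  obtain ⟨y, f⟩ := e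
  obtain rfl : y = x := h
  change (⟨y, f⟩ : (coverCore E).TotalSpace) = ⟨y, _⟩
  congr 1
  exact (mul_inv_cancel_right (G := FreeOn E) f _).symm

theorem continuous_liftPt (γ : Path x y) {i : Option E} (hi : ∀ t, (γ t : ℂ) ∈ cell E i)
    (c : FreeOn E) : Continuous fun t => liftPt (γ t) (c * jump i (γ t)) := by
  have h1 := ((coverCore E).localTriv i).continuousOn_invFun
  have h2 : Continuous fun t => ((γ t, c) : ((punct E)ᶜ : Set ℂ) × FreeOn E) := by fun_prop
  have h3 := h1.comp_continuous h2 fun t => by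
    rw [((coverCore E).localTriv i).target_eq]
    exact ⟨hi t, mem_univ _⟩
  refine h3.congr fun t => ?_
  change ((coverCore E).localTriv i).toOpenPartialHomeomorph.symm (γ t, c) = _
  rw [FiberBundleCore.localTriv_symm_apply]
  change (⟨γ t, _⟩ : (coverCore E).TotalSpace) = ⟨γ t, _⟩
  congr 1
  exact (mul_assoc (G := FreeOn E) c _ _).symm

/-- The monodromy of the covering in coordinates relative to the slit plane. -/
def mon (c : Path.Homotopic.Quotient x y) (g : FreeOn E) : FreeOn E :=
  slitCoord ((isCoveringMap_coverCore E).monodromy c ⟨liftPt x g, rfl⟩).1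

theorem mon_trans (c : Path.Homotopic.Quotient x y) (d : Path.Homotopic.Quotient y z)
    (g : FreeOn E) : mon (c.trans d) g = mon d (mon c g) := by
  unfold mon
  rw [IsCoveringMap.monodromy_trans_apply]
  congr 3
  exact Subtype.ext (eq_liftPt ((isCoveringMap_coverCore E).monodromy c _).2)

/-- Inside a cell the lift is constant in the coordinate of that cell. The constant is `c`, and the
factors `jump` convert it to the coordinate of the slit plane at both ends. -/
theorem mon_cell (γ : Path x y) {i : Option E} (hi : ∀ t, (γ t : ℂ) ∈ cell E i) (g : FreeOn E) :
    mon (.mk γ) g = g * ((jump i x)⁻¹ * jump i y) := by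
  let c := g * (jump i (x : ℂ))⁻¹
  let Γ : Path (liftPt x (c * jump i x)) (liftPt y (c * jump i y)) :=
    ⟨⟨_, continuous_liftPt γ hi c⟩, by simp, by simp⟩
  have h := (isCoveringMap_coverCore E).monodromy_map (.mk Γ)
  have hg : g = c * jump i x := (inv_mul_cancel_right g _).symm
  have h2 : mon (.mk γ) (c * jump i x) = slitCoord (liftPt y (c * jump i y)) :=
    congrArg (fun e : (coverCore E).proj ⁻¹' {y} => slitCoord e.1) h
  rw [slitCoord_liftPt] at h2
  rw [hg, h2]
  simp only [c]
  group

/-- The word of a homotopy class of paths in the complement of `E`. -/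
def classWord (c : Path.Homotopic.Quotient x y) : FreeOn E := mon c 1

/-- Transition functions multiply from the right. So monodromy inside a cell is right multiplication
by an element, and this persists under concatenation. -/
theorem mon_eq (c : Path.Homotopic.Quotient x y) : ∀ g, mon c g = g * classWord c := by
  refine pathClass_induction (V := fun i : Option E => Subtype.val ⁻¹' cell E i)
    (fun i => (isOpen_cell E i).preimage continuous_subtype_val) (fun x => exists_mem_cell x.2)
    (P := fun x y c => ∀ g, mon c g = g * classWord c) ?_ ?_ x y c
  · intro i x y γ hγ g
    rw [classWord, mon_cell γ hγ, mon_cell γ hγ, one_mul]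
  · intro x y z c d hc hd g
    rw [classWord, mon_trans, mon_trans, hc, hd, hc 1, hd (1 * _)]
    group

theorem classWord_trans (c : Path.Homotopic.Quotient x y) (d : Path.Homotopic.Quotient y z) :
    classWord (c.trans d) = classWord c * classWord d := by
  rw [classWord, mon_trans, mon_eq d]; rfl

theorem classWord_cell (γ : Path x y) {i : Option E} (hi : ∀ t, (γ t : ℂ) ∈ cell E i) :
    classWord (.mk γ) = (jump i (x : ℂ))⁻¹ * jump i y := by
  rw [classWord, mon_cell γ hi, one_mul]

theorem classWord_of_inSlit {c : Path.Homotopic.Quotient x y} (h : InSet (slit E) c) :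
    classWord c = 1 := by
  obtain ⟨γ, h1, rfl⟩ := h
  rw [classWord_cell γ (i := none) h1]; simp [jump]

theorem classWord_of_inStrip {c : Path.Homotopic.Quotient x y} (k : E) (h : InSet (strip k) c) :
    classWord c = (jump (some k) (x : ℂ))⁻¹ * jump (some k) (y : ℂ) := by
  obtain ⟨γ, h1, rfl⟩ := h
  exact classWord_cell γ (i := some k) h1

end Monodromy

/-! ### The word determines the homotopy class -/

section Generation

variable (E : Finset ℕ)

/-- A base point in the slit plane. -/
def slitBase : ((punct E)ᶜ : Set ℂ) := ⟨Complex.I, slit_subset E (.inl (by simp))⟩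

theorem slitBase_mem : (slitBase E : ℂ) ∈ slit E := .inl (by simp [slitBase])

/-- The point to the lower left of `k`, in the complement of `E`. -/
def offLeft (k : ℕ) : ((punct E)ᶜ : Set ℂ) := ⟨lowerLeft k, slit_subset E (lowerLeft_mem_slit E k)⟩

/-- The point to the lower right of `k`, in the complement of `E`. -/
def offRight (k : ℕ) : ((punct E)ᶜ : Set ℂ) :=
  ⟨lowerRight k, slit_subset E (lowerRight_mem_slit E k)⟩

variable {E}

theorem exists_inSlit {x y : ((punct E)ᶜ : Set ℂ)} (hx : (x : ℂ) ∈ slit E) (hy : (y : ℂ) ∈ slit E) :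
    ∃ c : Path.Homotopic.Quotient x y, InSet (slit E) c :=
  InSet.exists_of_mem (slit_subset E) hx hy

theorem exists_inStrip {x y : ((punct E)ᶜ : Set ℂ)} {k : ℕ} (hx : (x : ℂ) ∈ strip k)
    (hy : (y : ℂ) ∈ strip k) : ∃ c : Path.Homotopic.Quotient x y, InSet (strip k) c :=
  InSet.exists_of_mem (strip_subset E k) hx hy

/-- The left and the right half of a strip. -/
theorem inSet_slit_of_left {k : ℕ} {x y : ((punct E)ᶜ : Set ℂ)}
    (hx : (x : ℂ) ∈ strip k) (hy : (y : ℂ) ∈ strip k) (hx' : (x : ℂ).re < k)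
    (hy' : (y : ℂ).re < k) :
    ∃ c : Path.Homotopic.Quotient x y, InSet (slit E) c ∧ InSet (strip k) c := by
  let V : Set ℂ := strip k ∩ {z | z.re < k}
  have hV : Convex ℝ V := (convex_strip k).inter (convex_halfSpace_re_lt _)
  have : ContractibleSpace V := hV.contractibleSpace ⟨x, hx, hx'⟩
  have hVs : V ⊆ slit E := by
    rintro z ⟨⟨h1, h2⟩, h3⟩
    refine .inr fun j _ hj => ?_
    rw [abs_lt] at h2
    change z.re < k at h3
    have h4 : (j : ℝ) < k := by linarith
    have h5 : (k : ℝ) < j + 1 := by linarith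
    norm_cast at h4 h5
    omega
  obtain ⟨c, hc⟩ := InSet.exists_of_mem (hVs.trans (slit_subset E)) (x := x) (y := y)
    ⟨hx, hx'⟩ ⟨hy, hy'⟩
  exact ⟨c, hc.mono hVs, hc.mono inter_subset_left⟩

theorem inSet_slit_of_right {k : ℕ} {x y : ((punct E)ᶜ : Set ℂ)}
    (hx : (x : ℂ) ∈ strip k) (hy : (y : ℂ) ∈ strip k) (hx' : k < (x : ℂ).re)
    (hy' : k < (y : ℂ).re) :
    ∃ c : Path.Homotopic.Quotient x y, InSet (slit E) c ∧ InSet (strip k) c := by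
  let V : Set ℂ := strip k ∩ {z | k < z.re}
  have hV : Convex ℝ V := (convex_strip k).inter (convex_halfSpace_re_gt _)
  have : ContractibleSpace V := hV.contractibleSpace ⟨x, hx, hx'⟩
  have hVs : V ⊆ slit E := by
    rintro z ⟨⟨h1, h2⟩, h3⟩
    refine .inr fun j _ hj => ?_
    rw [abs_lt] at h2
    change (k : ℝ) < z.re at h3
    have h4 : (k : ℝ) < j := by linarith
    have h5 : (j : ℝ) < k + 1 := by linarith
    norm_cast at h4 h5
    omega
  obtain ⟨c, hc⟩ := InSet.exists_of_mem (hVs.trans (slit_subset E)) (x := x) (y := y)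
    ⟨hx, hx'⟩ ⟨hy, hy'⟩
  exact ⟨c, hc.mono hVs, hc.mono inter_subset_left⟩

/-- Classes of paths in the complement of `E` are determined by their words. -/
theorem classWord_injective {x y : ((punct E)ᶜ : Set ℂ)} {c d : Path.Homotopic.Quotient x y}
    (h : classWord c = classWord d) : c = d := by
  -- The generating loop at `k`: down to the left of `k` within the slit plane (`a`), below `k`
  -- within the strip (`b`), and back within the slit plane (`r`).
  choose a ha using fun k : ℕ =>
    exists_inSlit (E := E) (x := slitBase E) (y := offLeft E k) (slitBase_mem E)
      (lowerLeft_mem_slit E k)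
  choose b hb using fun k : ℕ =>
    exists_inStrip (E := E) (x := offLeft E k) (y := offRight E k) (lowerLeft_mem_strip k)
      (lowerRight_mem_strip k)
  choose r hr using fun k : ℕ =>
    exists_inSlit (E := E) (x := offRight E k) (y := slitBase E) (lowerRight_mem_slit E k)
      (slitBase_mem E)
  let Λ : FreeOn E →* LoopClass (slitBase E) :=
    FreeGroup.lift fun k : E => (a k).trans ((b k).trans (r k))
  have hΛof : ∀ k : E, Λ (FreeGroup.of k) = (a k).trans ((b k).trans (r k)) := fun k =>
    FreeGroup.lift_apply_of
  -- The word map is a left inverse of `Λ`. It remains to see that, up to reference paths, every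
  -- class comes from `Λ`.
  have hΛ : ∀ w, classWord (Λ w) = w := by
    let θ : LoopClass (slitBase E) →* FreeOn E :=
      MonoidHom.mk' (fun c => classWord c)
        fun c d => classWord_trans _ _
    have : θ.comp Λ = MonoidHom.id _ := by
      ext k
      change classWord (Λ (FreeGroup.of k)) = FreeGroup.of k
      rw [hΛof, classWord_trans, classWord_trans, classWord_of_inSlit (ha k), classWord_of_inSlit (hr k),
        classWord_of_inStrip k (hb k)]
      change 1 * ((jump (some k) (lowerLeft k))⁻¹ * jump (some k) (lowerRight k) * 1) = _
      rw [jump, jump, lowerLeft_re, lowerRight_re, if_neg (by linarith), if_pos (by linarith)]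
      simp
    exact fun w => DFunLike.congr_fun this w
  -- Reference paths `T` from the base point to every `z`. Reaching `z` through a strip instead
  -- changes the class by a factor from `Λ`: none to the left of `k`, and `δ_k` to the right. A
  -- point outside the slit plane lies in the strip of only one point of `E`, and `T` is taken
  -- through that strip.
  have hT : ∀ z : ((punct E)ᶜ : Set ℂ), ∃ T : Path.Homotopic.Quotient (slitBase E) z,
      ((z : ℂ) ∈ slit E → InSet (slit E) T) ∧
      ∀ k : E, (z : ℂ) ∈ strip k → ∀ s : Path.Homotopic.Quotient (offLeft E k) z, InSet (strip k) s →
        ∃ w, (a k).trans s = Path.Homotopic.Quotient.trans (Λ w) T := by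
    intro z
    by_cases hz : (z : ℂ) ∈ slit E
    · obtain ⟨T, hT⟩ := exists_inSlit (slitBase_mem E) hz
      refine ⟨T, fun _ => hT, fun k hk s hs => ?_⟩
      have hne : (z : ℂ).re ≠ (k : ℕ) := by
        rcases hz with h | h
        · have := hk.1; linarith
        · exact h k k.2
      rcases lt_or_gt_of_ne hne with hlt | hgt
      · obtain ⟨s', h1, h2⟩ := inSet_slit_of_left (E := E) (x := offLeft E k) (y := z)
          (lowerLeft_mem_strip k) hk (by change (lowerLeft k).re < _; rw [lowerLeft_re]; linarith) hlt
        obtain rfl := InSet.unique (strip_subset E k) h2 hs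
        refine ⟨1, ?_⟩
        rw [map_one, LoopClass.one_trans]
        exact InSet.unique (slit_subset E) ((ha k).trans h1) hT
      · obtain ⟨s', h1, h2⟩ := inSet_slit_of_right (E := E) (x := offRight E k) (y := z)
          (lowerRight_mem_strip k) hk
          (by change _ < (lowerRight k).re; rw [lowerRight_re]; linarith) hgt
        obtain rfl := InSet.unique (strip_subset E k) ((hb k).trans h2) hs
        refine ⟨FreeGroup.of k, ?_⟩
        rw [hΛof, Path.Homotopic.Quotient.trans_assoc, Path.Homotopic.Quotient.trans_assoc,
          InSet.unique (slit_subset E) h1 ((hr k).trans hT)]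
    · obtain ⟨i, hi⟩ := exists_mem_cell z.2
      rcases i with _ | k
      · exact (hz hi).elim
      obtain ⟨s, hs⟩ := exists_inStrip (E := E) (x := offLeft E k) (lowerLeft_mem_strip k) hi
      refine ⟨(a k).trans s, fun h => (hz h).elim, fun l hl s' hs' => ⟨1, ?_⟩⟩
      have hre : ∃ j ∈ E, (z : ℂ).re = (j : ℕ) := by
        simp only [slit, mem_ofPred_eq, not_or, not_lt, not_forall, not_not] at hz
        obtain ⟨-, j, hj, h⟩ := hz
        exact ⟨j, hj, h⟩
      obtain ⟨j, -, hj⟩ := hre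
      have huniq : ∀ l : E, (z : ℂ) ∈ strip l → (l : ℕ) = j := by
        intro l hl
        have h1 := hl.2
        rw [hj, abs_lt] at h1
        have h2 : ((j : ℕ) : ℝ) < (l : ℕ) + 1 := by linarith
        have h3 : ((l : ℕ) : ℝ) < j + 1 := by linarith
        norm_cast at h2 h3
        omega
      obtain rfl : k = l := Subtype.ext ((huniq k hi).trans (huniq l hl).symm)
      rw [map_one, LoopClass.one_trans, InSet.unique (strip_subset E k) hs hs']
  choose T hT1 hT2 using hT
  -- With respect to the reference paths every class, with arbitrary end points, is in the image of
  -- `Λ`. It suffices to check this inside the cells.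
  have hgen : ∀ x y (c : Path.Homotopic.Quotient x y), ∃ w,
      (T x).trans c = Path.Homotopic.Quotient.trans (Λ w) (T y) := by
    refine pathClass_induction (V := fun i : Option E => Subtype.val ⁻¹' cell E i)
      (fun i => (isOpen_cell E i).preimage continuous_subtype_val)
      (fun x => exists_mem_cell x.2) ?_ ?_
    · intro i x y γ hγ
      have hx : (x : ℂ) ∈ cell E i := by have := hγ 0; rwa [mem_preimage, γ.source] at this
      have hy : (y : ℂ) ∈ cell E i := by have := hγ 1; rwa [mem_preimage, γ.target] at this
      rcases i with _ | k
      · refine ⟨1, ?_⟩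
        rw [map_one, LoopClass.one_trans]
        exact InSet.unique (slit_subset E) ((hT1 x hx).trans ⟨γ, hγ, rfl⟩) (hT1 y hy)
      · obtain ⟨s, hs⟩ := exists_inStrip (E := E) (x := offLeft E k) (lowerLeft_mem_strip k) hx
        have hs' : InSet (strip k) (s.trans (.mk γ)) := hs.trans ⟨γ, hγ, rfl⟩
        obtain ⟨w, hw⟩ := hT2 x k hx s hs
        obtain ⟨w', hw'⟩ := hT2 y k hy _ hs'
        refine ⟨w⁻¹ * w', ?_⟩
        rw [map_mul, LoopClass.mul_trans, ← hw', ← Path.Homotopic.Quotient.trans_assoc (a k), hw,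
          Path.Homotopic.Quotient.trans_assoc, ← LoopClass.mul_trans, ← map_mul, inv_mul_cancel,
          map_one, LoopClass.one_trans]
    · rintro x y z c d ⟨w, hw⟩ ⟨w', hw'⟩
      refine ⟨w * w', ?_⟩
      rw [← Path.Homotopic.Quotient.trans_assoc, hw, Path.Homotopic.Quotient.trans_assoc, hw',
        map_mul, LoopClass.mul_trans]
  obtain ⟨w, hw⟩ := hgen x y c
  obtain ⟨w', hw'⟩ := hgen x y d
  -- Taking words recovers `w` and `w'`, which therefore agree; then the reference path to `x` is
  -- cancelled.
  have h1 := congrArg classWord hw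
  have h2 := congrArg classWord hw'
  rw [classWord_trans, classWord_trans, hΛ] at h1 h2
  rw [h, h2] at h1
  obtain rfl : w' = w := mul_right_cancel h1
  have h3 := hw.trans hw'.symm
  have h4 := congrArg (fun e => (T x).symm.trans e) h3
  simpa only [← Path.Homotopic.Quotient.trans_assoc, Path.Homotopic.Quotient.symm_trans,
    Path.Homotopic.Quotient.refl_trans] using h4

end Generation

/-! ### Words of paths in the plane -/

section Word

variable {E : Finset ℕ} {x y z : ℂ}

open Classical in
/-- The word of a path that avoids `E`. -/
def pathWord (E : Finset ℕ) (γ : Path x y) : FreeOn E :=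
  if h : Off (punct E) γ then classWord (.mk h.lift) else 1

theorem pathWord_eq {γ : Path x y} (h : Off (punct E) γ) :
    pathWord E γ = classWord (.mk h.lift) := dif_pos h

/-- By this equivalence, homotopies of explicit loops are replaced by computations in the free
group. -/
theorem homOff_iff_pathWord {γ γ' : Path x y} (h : Off (punct E) γ) (h' : Off (punct E) γ') :
    HomOff (punct E) γ γ' ↔ pathWord E γ = pathWord E γ' := by
  rw [homOff_iff h h', pathWord_eq h, pathWord_eq h', ← Path.Homotopic.Quotient.eq]
  exact ⟨fun h => by rw [h], classWord_injective⟩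

theorem HomOff.pathWord_eq {γ γ' : Path x y} (h : HomOff (punct E) γ γ') :
    pathWord E γ = pathWord E γ' :=
  (homOff_iff_pathWord h.off_left h.off_right).1 h

theorem pathWord_trans {γ : Path x y} {δ : Path y z} (h : Off (punct E) γ)
    (h' : Off (punct E) δ) : pathWord E (γ.trans δ) = pathWord E γ * pathWord E δ := by
  rw [pathWord_eq h, pathWord_eq h', pathWord_eq (h.trans h'), h.lift_trans h',
    Path.Homotopic.Quotient.mk_trans, classWord_trans]

theorem pathWord_of_slit {γ : Path x y} (h : ∀ t, γ t ∈ slit E) : pathWord E γ = 1 := by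
  have h' : Off (punct E) γ := fun t => slit_subset E (h t)
  rw [pathWord_eq h']
  exact classWord_of_inSlit ⟨_, h, rfl⟩

theorem pathWord_of_strip {γ : Path x y} (k : E) (h : ∀ t, γ t ∈ strip k) :
    pathWord E γ = (jump (some k) x)⁻¹ * jump (some k) y := by
  have h' : Off (punct E) γ := fun t => strip_subset E k (h t)
  rw [pathWord_eq h']
  exact classWord_of_inStrip (x := ⟨x, h'.source⟩) (y := ⟨y, h'.target⟩) k ⟨_, h, rfl⟩

theorem Off.homOff_trans_symm {S : Set ℂ} {γ : Path x y} (h : Off S γ) :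
    HomOff S (γ.trans γ.symm) (Path.refl x) := by
  rw [homOff_iff (h.trans h.symm) (Off.refl h.source), h.lift_trans h.symm]
  exact ⟨(Path.Homotopy.reflTransSymm h.lift).symm⟩

theorem pathWord_refl (h : x ∉ punct E) : pathWord E (Path.refl x) = 1 := by
  have h1 : Off (punct E) (Path.refl x) := Off.refl h
  -- The word of the constant path is idempotent, hence trivial.
  have := h1.homOff_trans_symm.pathWord_eq
  rw [pathWord_trans h1 h1.symm, Path.refl_symm] at this
  exact mul_eq_left.1 this

theorem pathWord_symm {γ : Path x y} (h : Off (punct E) γ) :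
    pathWord E γ.symm = (pathWord E γ)⁻¹ := by
  have := h.homOff_trans_symm.pathWord_eq
  rw [pathWord_trans h h.symm, pathWord_refl h.source] at this
  exact eq_inv_of_mul_eq_one_right this

/-- Paths in a convex set that avoids `S` are homotopic. -/
theorem homOff_of_convex {S V : Set ℂ} (hV : Convex ℝ V) (hVS : V ⊆ Sᶜ) {γ γ' : Path x y}
    (h : ∀ t, γ t ∈ V) (h' : ∀ t, γ' t ∈ V) : HomOff S γ γ' := by
  refine ⟨⟨fun q => (1 - (q.2 : ℝ) : ℝ) • γ q.1 + (q.2 : ℝ) • γ' q.1, by fun_prop⟩, fun s => ?_,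
    fun s => ?_, fun t => ⟨?_, ?_⟩, fun s t => ?_⟩
  · simp
  · simp
  · simp only [ContinuousMap.coe_mk, Path.source]
    rw [← add_smul]; simp
  · simp only [ContinuousMap.coe_mk, Path.target]
    rw [← add_smul]; simp
  · exact hVS (hV (h s) (h' s) (sub_nonneg.2 t.2.2) t.2.1 (by simp))

/-- The two ways around a square are homotopic. -/
theorem homOff_of_square {S : Set ℂ} {x' y' : ℂ} (T : C(I × I, ℂ)) (hT : ∀ q, T q ∉ S)
    {b : Path x y} {r : Path y y'} {l : Path x x'} {t : Path x' y'}
    (hb : ∀ s, T (s, 0) = b s) (hr : ∀ s, T (1, s) = r s) (hl : ∀ s, T (0, s) = l s)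
    (ht : ∀ s, T (s, 1) = t s) : HomOff S (b.trans r) (l.trans t) := by
  have : ContractibleSpace I := (convex_Icc (0 : ℝ) 1).contractibleSpace ⟨0, by simp⟩
  let b' : Path ((0, 0) : I × I) (1, 0) := ⟨⟨fun s => (s, 0), by fun_prop⟩, rfl, rfl⟩
  let r' : Path ((1, 0) : I × I) (1, 1) := ⟨⟨fun s => (1, s), by fun_prop⟩, rfl, rfl⟩
  let l' : Path ((0, 0) : I × I) (0, 1) := ⟨⟨fun s => (0, s), by fun_prop⟩, rfl, rfl⟩
  let t' : Path ((0, 1) : I × I) (1, 1) := ⟨⟨fun s => (s, 1), by fun_prop⟩, rfl, rfl⟩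
  obtain ⟨F⟩ := SimplyConnectedSpace.paths_homotopic (b'.trans r') (l'.trans t')
  refine ⟨⟨fun q => T (F (q.2, q.1)), by fun_prop⟩, fun s => ?_, fun s => ?_, fun s => ⟨?_, ?_⟩,
    fun _ _ => hT _⟩
  · change T (F (0, s)) = _
    rw [F.apply_zero]
    change T ((b'.trans r') s) = _
    rw [Path.trans_apply, Path.trans_apply]
    split_ifs
    exacts [hb _, hr _]
  · change T (F (1, s)) = _
    rw [F.apply_one]
    change T ((l'.trans t') s) = _
    rw [Path.trans_apply, Path.trans_apply]
    split_ifs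
    exacts [hl _, ht _]
  · change T (F (s, 0)) = _
    rw [F.source, hb, b.source]
  · change T (F (s, 1)) = _
    rw [F.target, hr, r.target]

end Word

/-! ### The standard loops -/

section Loops

theorem segment_apply_eq (a b : ℂ) (t : I) :
    Path.segment a b t = (1 - (t : ℝ) : ℝ) * a + (t : ℝ) * b := by
  simp [Path.segment_apply, AffineMap.lineMap_apply]; ring

theorem segment_re (a b : ℂ) (t : I) :
    (Path.segment a b t).re = (1 - (t : ℝ)) * a.re + t * b.re := by
  rw [segment_apply_eq, Complex.add_re, Complex.re_ofReal_mul, Complex.re_ofReal_mul]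

theorem segment_im (a b : ℂ) (t : I) :
    (Path.segment a b t).im = (1 - (t : ℝ)) * a.im + t * b.im := by
  rw [segment_apply_eq, Complex.add_im, Complex.im_ofReal_mul, Complex.im_ofReal_mul]

theorem segment_mem {V : Set ℂ} (hV : Convex ℝ V) {a b : ℂ} (ha : a ∈ V) (hb : b ∈ V) (t : I) :
    Path.segment a b t ∈ V := by
  rw [segment_apply_eq, ← Complex.real_smul, ← Complex.real_smul]
  exact hV ha hb (sub_nonneg.2 t.2.2) t.2.1 (by simp)

theorem basePt_re (R : ℝ) : (basePt R).re = 0 := by simp [basePt]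

theorem basePt_im (R : ℝ) : (basePt R).im = R := by simp [basePt]

theorem mem_slit_of_between {E : Finset ℕ} {z : ℂ} (j : ℤ) (h1 : j < z.re) (h2 : z.re < j + 1) :
    z ∈ slit E := by
  refine .inr fun k _ hk => ?_
  rw [hk] at h1 h2
  have h1' : j < (k : ℤ) := by exact_mod_cast h1
  have h2' : (k : ℤ) < j + 1 := by exact_mod_cast h2
  omega

/-- A segment from the base point down to a point between two vertical integer lines. -/
theorem segment_basePt_mem_slit {E : Finset ℕ} {R : ℝ} (hR : 0 < R) {q : ℂ} (hq : q.im ≤ 0)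
    (j : ℤ) (h1 : j < q.re - |q.re| * -q.im / R) (h2 : q.re + |q.re| * -q.im / R < j + 1) (t : I) :
    Path.segment (basePt R) q t ∈ slit E := by
  by_cases h : 0 < (Path.segment (basePt R) q t).im
  · exact .inl h
  rw [segment_im, basePt_im, not_lt] at h
  have ht0 := t.2.1
  have ht1 := t.2.2
  -- Once the segment has come down to the real axis, it has only the fraction `-q.im / (R - q.im)`
  -- of its way left, so its real part is within `|q.re| * -q.im / R` of `q.re`.
  have h3 : (1 - (t : ℝ)) ≤ -q.im / R := by
    rw [le_div_iff₀ hR]; nlinarith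
  have h4 : |(1 - (t : ℝ)) * q.re| ≤ |q.re| * -q.im / R := by
    rw [abs_mul, abs_of_nonneg (sub_nonneg.2 ht1), mul_comm, mul_div_assoc]
    exact mul_le_mul_of_nonneg_left h3 (abs_nonneg _)
  have h5 := abs_le.1 h4
  refine mem_slit_of_between j ?_ ?_ <;> rw [segment_re, basePt_re] <;> linarith [h5.1, h5.2]

/-- The base point is high enough for the loops around `k`. -/
def High (k : ℕ) (R : ℝ) : Prop := 2 * (k : ℝ) + 2 ≤ R

theorem High.pos {k : ℕ} {R : ℝ} (h : High k R) : 0 < R := by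
  unfold High at h
  have : (0 : ℝ) ≤ k := Nat.cast_nonneg k
  linarith

/-- A segment from the base point to a point close to `k`, to the lower left. -/
theorem segment_left_mem_slit (E : Finset ℕ) {k : ℕ} {R ε : ℝ} (hR : High k R) (hε : 0 < ε)
    (hε2 : ε ≤ 1 / 2) {q : ℂ} (h1 : q.re = k - ε) (h2 : q.im = -ε) (t : I) :
    Path.segment (basePt R) q t ∈ slit E := by
  have hk : (0 : ℝ) ≤ k := Nat.cast_nonneg k
  have h3 : |q.re| * -q.im / R < ε := by
    rw [h2, div_lt_iff₀ hR.pos, neg_neg, mul_comm]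
    have h : |q.re| < R := by
      rw [h1, abs_lt]; unfold High at hR; constructor <;> linarith
    exact mul_lt_mul_of_pos_left h hε
  refine segment_basePt_mem_slit hR.pos (by linarith) ((k : ℤ) - 1) ?_ ?_ t <;> push_cast <;>
    linarith

theorem segment_right_mem_slit (E : Finset ℕ) {k : ℕ} {R ε : ℝ} (hR : High k R) (hε : 0 < ε)
    (hε2 : ε ≤ 1 / 2) {q : ℂ} (h1 : q.re = k + ε) (h2 : q.im = -ε) (t : I) :
    Path.segment (basePt R) q t ∈ slit E := by
  have hk : (0 : ℝ) ≤ k := Nat.cast_nonneg k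
  have h3 : |q.re| * -q.im / R < ε := by
    rw [h2, div_lt_iff₀ hR.pos, neg_neg, mul_comm]
    have h : |q.re| < R := by
      rw [h1, abs_lt]; unfold High at hR; constructor <;> linarith
    exact mul_lt_mul_of_pos_left h hε
  refine segment_basePt_mem_slit hR.pos (by linarith) (k : ℤ) ?_ ?_ t <;> push_cast <;>
    linarith

theorem segment_lowerLeft_mem_slit (E : Finset ℕ) {k : ℕ} {R : ℝ} (hR : High k R) (t : I) :
    Path.segment (basePt R) (lowerLeft k) t ∈ slit E :=
  segment_left_mem_slit E hR (by norm_num) le_rfl (lowerLeft_re k)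
    (by rw [lowerLeft_im]; norm_num) t

theorem segment_lowerRight_mem_slit (E : Finset ℕ) {k : ℕ} {R : ℝ} (hR : High k R) (t : I) :
    Path.segment (lowerRight k) (basePt R) t ∈ slit E := by
  rw [← Path.segment_symm]
  exact segment_right_mem_slit E hR (by norm_num) le_rfl (lowerRight_re k)
    (by rw [lowerRight_im]; norm_num) _

/-- The letter `δ_k` if `k ∈ E`, and `1` otherwise. -/
def letter (E : Finset ℕ) (k : ℕ) : FreeOn E :=
  if h : k ∈ E then FreeGroup.of ⟨k, h⟩ else 1

theorem proj_of {E F : Finset ℕ} (k : E) : proj E F (FreeGroup.of k) = letter F k := by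
  simp [proj, letter]

theorem letter_coe {E : Finset ℕ} (k : E) : letter E k = FreeGroup.of k := by
  simp [letter]

theorem jump_some {E : Finset ℕ} (k : E) (z : ℂ) :
    jump (some k) z = if ((k : ℕ) : ℝ) < z.re then FreeGroup.of k else 1 := rfl

theorem off_segment_lower (E : Finset ℕ) {x y : ℂ} (hx : x.im < 0) (hy : y.im < 0) :
    Off (punct E) (Path.segment x y) := by
  intro t ht
  obtain ⟨k, -, -, h⟩ := mem_punct_iff.1 ht
  have : Path.segment x y t ∈ {z : ℂ | z.im < 0} := segment_mem (convex_halfSpace_im_lt 0) hx hy t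
  exact absurd h (ne_of_lt this)

theorem pathWord_cross_of_mem {E : Finset ℕ} (k : E) {x y : ℂ} (hx : x ∈ strip k)
    (hy : y ∈ strip k) (hx' : x.re ≤ (k : ℕ)) (hy' : (k : ℕ) < y.re) :
    pathWord E (Path.segment x y) = FreeGroup.of k := by
  rw [pathWord_of_strip k fun t => segment_mem (convex_strip k) hx hy t, jump_some, jump_some,
    if_neg (not_lt.2 hx'), if_pos hy']
  simp

theorem pathWord_bottom (E : Finset ℕ) (k : ℕ) :
    pathWord E (Path.segment (lowerLeft k) (lowerRight k)) = letter E k := by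
  unfold letter
  split_ifs with h
  · refine pathWord_cross_of_mem ⟨k, h⟩ (lowerLeft_mem_strip k) (lowerRight_mem_strip k) ?_ ?_
    · rw [lowerLeft_re]; simp
    · rw [lowerRight_re]; simp
  · refine pathWord_of_slit fun t => ?_
    have h1 : (Path.segment (lowerLeft k) (lowerRight k) t).re = k - 1 / 2 + t := by
      rw [segment_re, lowerLeft_re, lowerRight_re]; ring
    have ht0 := t.2.1
    have ht1 := t.2.2
    refine .inr fun j hj hj' => ?_
    rw [h1] at hj'
    have h2 : (j : ℝ) < k + 1 := by linarith
    have h3 : (k : ℝ) < j + 1 := by linarith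
    norm_cast at h2 h3
    obtain rfl : j = k := by omega
    exact h hj

theorem genLoop_eq (R : ℝ) (k : ℕ) : genLoop R k =
    ((Path.segment (basePt R) (lowerLeft k)).trans
      (Path.segment (lowerLeft k) (lowerRight k))).trans
      (Path.segment (lowerRight k) (basePt R)) := rfl

theorem off_genLoop (E : Finset ℕ) {k : ℕ} {R : ℝ} (hR : High k R) :
    Off (punct E) (genLoop R k) := by
  rw [genLoop_eq]
  refine Off.trans (Off.trans ?_ ?_) ?_
  · exact fun t => slit_subset E (segment_lowerLeft_mem_slit E hR t)
  · exact off_segment_lower E (by rw [lowerLeft_im]; norm_num) (by rw [lowerRight_im]; norm_num)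
  · exact fun t => slit_subset E (segment_lowerRight_mem_slit E hR t)

theorem pathWord_genLoop (E : Finset ℕ) {k : ℕ} {R : ℝ} (hR : High k R) :
    pathWord E (genLoop R k) = letter E k := by
  have h1 := segment_lowerLeft_mem_slit E hR
  have h3 := segment_lowerRight_mem_slit E hR
  have o1 : Off (punct E) _ := fun t => slit_subset E (h1 t)
  have o3 : Off (punct E) _ := fun t => slit_subset E (h3 t)
  have o2 := off_segment_lower E (x := lowerLeft k) (y := lowerRight k)
    (by rw [lowerLeft_im]; norm_num) (by rw [lowerRight_im]; norm_num)
  rw [genLoop_eq, pathWord_trans (o1.trans o2) o3, pathWord_trans o1 o2, pathWord_of_slit h1,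
    pathWord_of_slit h3, pathWord_bottom, one_mul, mul_one]

/-- The base point is high enough for the loops around the points of `E`. -/
def HighOn (E : Finset ℕ) (R : ℝ) : Prop := 0 < R ∧ ∀ k ∈ E, High k R

theorem eventually_highOn (E : Finset ℕ) : ∀ᶠ R in atTop, HighOn E R := by
  refine (eventually_gt_atTop 0).and ?_
  rw [eventually_all_finset]
  exact fun k _ => eventually_ge_atTop _

theorem basePt_notMem {R : ℝ} (hR : 0 < R) (E : Finset ℕ) : basePt R ∉ punct E := by
  intro h
  obtain ⟨k, -, -, h⟩ := mem_punct_iff.1 h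
  rw [basePt_im] at h
  exact hR.ne' h

/-- The loop of a word over `E` is read in the complement of an arbitrary finite set `F`. The case
`F = E` recovers the word, and `F ⊆ E` describes the effect of forgetting points. -/
theorem wordLoop_spec {E : Finset ℕ} {R : ℝ} (hR : HighOn E R) (F : Finset ℕ)
    (L : List (E × Bool)) : Off (punct F) (wordLoop R L) ∧
      pathWord F (wordLoop R L) = proj E F (FreeGroup.mk L) := by
  induction L with
  | nil =>
    refine ⟨Off.refl (basePt_notMem hR.1 F), ?_⟩
    rw [wordLoop, pathWord_refl (basePt_notMem hR.1 F)]
    exact (map_one _).symm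
  | cons a L ih =>
    obtain ⟨k, b⟩ := a
    have hk := hR.2 k k.2
    have h0 : FreeGroup.mk ((k, b) :: L) = FreeGroup.mk [(k, b)] * FreeGroup.mk L := by
      rw [FreeGroup.mul_mk]; rfl
    cases b
    · refine ⟨(off_genLoop F hk).symm.trans ih.1, ?_⟩
      have h1 : FreeGroup.mk [(k, false)] = (FreeGroup.of k)⁻¹ := rfl
      rw [wordLoop, pathWord_trans (off_genLoop F hk).symm ih.1, pathWord_symm (off_genLoop F hk),
        pathWord_genLoop F hk, ih.2, h0, map_mul, h1, map_inv, proj_of]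
    · refine ⟨(off_genLoop F hk).trans ih.1, ?_⟩
      have h1 : FreeGroup.mk [(k, true)] = FreeGroup.of k := rfl
      rw [wordLoop, pathWord_trans (off_genLoop F hk) ih.1,
        pathWord_genLoop F hk, ih.2, h0, map_mul, h1, proj_of]

theorem off_loopOf {E : Finset ℕ} {R : ℝ} (hR : HighOn E R) (F : Finset ℕ) (w : FreeOn E) :
    Off (punct F) (loopOf R w) := (wordLoop_spec hR F _).1

theorem pathWord_loopOf {E : Finset ℕ} {R : ℝ} (hR : HighOn E R) (F : Finset ℕ) (w : FreeOn E) :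
    pathWord F (loopOf R w) = proj E F w := by
  rw [loopOf, (wordLoop_spec hR F _).2, FreeGroup.mk_toWord]

theorem proj_self (E : Finset ℕ) : proj E E = MonoidHom.id _ := by
  ext k
  rw [proj_of, letter_coe]; rfl

theorem pathWord_loopOf_self {E : Finset ℕ} {R : ℝ} (hR : HighOn E R) (w : FreeOn E) :
    pathWord E (loopOf R w) = w := by
  rw [pathWord_loopOf hR, proj_self]; rfl

/-- Every loop in the complement of `E` is homotopic to the loop of its word. -/
theorem homOff_loopOf {E : Finset ℕ} {R : ℝ} (hR : HighOn E R) {γ : Path (basePt R) (basePt R)}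
    (h : Off (punct E) γ) : HomOff (punct E) γ (loopOf R (pathWord E γ)) := by
  rw [homOff_iff_pathWord h (off_loopOf hR E _), pathWord_loopOf_self hR]

theorem punct_mono {E F : Finset ℕ} (h : E ⊆ F) : punct E ⊆ punct F :=
  image_mono (Finset.coe_subset.2 h)

theorem Off.mono {S S' : Set ℂ} {x y : ℂ} {γ : Path x y} (hS : S' ⊆ S) (h : Off S γ) : Off S' γ :=
  fun t ht => h t (hS ht)

/-- Words and forgetting points. -/
theorem pathWord_of_subset {E F : Finset ℕ} (hEF : E ⊆ F) {R : ℝ} (hR : HighOn F R)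
    {γ : Path (basePt R) (basePt R)} (h : Off (punct F) γ) :
    pathWord E γ = proj F E (pathWord F γ) := by
  rw [((homOff_loopOf hR h).mono (punct_mono hEF)).pathWord_eq, pathWord_loopOf hR]

end Loops

/-! ### The loop around all points -/

section OrderedProd

/-- Letters outside `E` are `1`, so the product may run over a full initial segment of `ℕ`. This
avoids the sorted enumeration of `E` and permits induction on `n`. -/
theorem orderedProd_eq {E : Finset ℕ} {n : ℕ} (h : E ⊆ Finset.range n) :
    orderedProd E = ((List.range n).map (letter E)).prod := by
  have h1 : ((Finset.univ : Finset E).sort (· ≤ ·)).map Subtype.val =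
      (List.range n).filter (· ∈ E) := by
    refine List.Perm.eq_of_pairwise' (r := (· ≤ ·)) ?_ ?_ ?_
    · rw [List.pairwise_map]
      exact (Finset.pairwise_sort _ _).imp fun h => h
    · exact (List.pairwise_le_range).filter _
    · rw [List.perm_ext_iff_of_nodup]
      · intro a
        simp only [List.mem_map, Finset.mem_sort, Finset.mem_univ, true_and, List.mem_filter,
          List.mem_range, decide_eq_true_eq]
        constructor
        · rintro ⟨b, rfl⟩; exact ⟨Finset.mem_range.1 (h b.2), b.2⟩
        · rintro ⟨-, ha⟩; exact ⟨⟨a, ha⟩, rfl⟩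
      · exact (Finset.sort_nodup _ _).map Subtype.val_injective
      · exact List.nodup_range.filter _
  have h2 : orderedProd E = ((((Finset.univ : Finset E).sort (· ≤ ·)).map Subtype.val).map
      (letter E)).prod := by
    rw [orderedProd, List.map_map]
    congr 1
    refine List.map_congr_left fun k _ => ?_
    exact (letter_coe k).symm
  rw [h2, h1]
  induction List.range n with
  | nil => rfl
  | cons a l ih =>
    rw [List.map_cons, List.prod_cons, ← ih]
    by_cases ha : a ∈ E
    · rw [List.filter_cons_of_pos (by simpa using ha), List.map_cons, List.prod_cons]
    · rw [List.filter_cons_of_neg (by simpa using ha)]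
      simp [letter, ha]

theorem proj_letter {E F : Finset ℕ} (h : E ⊆ F) (k : ℕ) : proj F E (letter F k) = letter E k := by
  by_cases hk : k ∈ F
  · have := letter_coe (⟨k, hk⟩ : F)
    change letter F k = _ at this
    rw [this, proj_of]
  · have hk' : k ∉ E := fun h' => hk (h h')
    simp [letter, hk, hk']

theorem pathWord_lower (E : Finset ℕ) (n : ℕ) :
    pathWord E (Path.segment (lowerLeft 0) (lowerLeft n)) =
      ((List.range n).map (letter E)).prod := by
  have him : ∀ k, (lowerLeft k).im < 0 := fun k => by rw [lowerLeft_im]; norm_num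
  have hV := convex_halfSpace_im_lt 0
  have hVS : {z : ℂ | z.im < 0} ⊆ (punct E)ᶜ := by
    intro z hz h
    obtain ⟨k, -, -, h⟩ := mem_punct_iff.1 h
    exact (ne_of_lt hz) h
  induction n with
  | zero =>
    rw [Path.segment_same]
    exact pathWord_refl (slit_subset E (lowerLeft_mem_slit E 0))
  | succ n ih =>
    have hnext : lowerRight n = lowerLeft (n + 1) := by
      apply Complex.ext
      · rw [lowerRight_re, lowerLeft_re]; push_cast; ring
      · rw [lowerRight_im, lowerLeft_im]
    have o1 := off_segment_lower E (him 0) (him n)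
    have o2 := off_segment_lower E (him n) (him (n + 1))
    have hb := pathWord_bottom E n
    rw [hnext] at hb
    have h1 : HomOff (punct E) (Path.segment (lowerLeft 0) (lowerLeft (n + 1)))
        ((Path.segment (lowerLeft 0) (lowerLeft n)).trans
          (Path.segment (lowerLeft n) (lowerLeft (n + 1)))) := by
      refine homOff_of_convex hV hVS (segment_mem hV (him _) (him _)) fun t => ?_
      rw [Path.trans_apply]
      split_ifs
      · exact segment_mem hV (him _) (him _) _
      · exact segment_mem hV (him _) (him _) _
    rw [h1.pathWord_eq, pathWord_trans o1 o2, ih, hb, List.range_succ, List.map_append,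
      List.prod_append]
    simp

/-- A large triangle with top `R i`. -/
def bigLoop (R : ℝ) : Path (basePt R) (basePt R) :=
  ((Path.segment (basePt R) (⟨-R, -R⟩ : ℂ)).trans (Path.segment (⟨-R, -R⟩ : ℂ) ⟨R, -R⟩)).trans
    (Path.segment (⟨R, -R⟩ : ℂ) (basePt R))

theorem norm_ge_of_re {z : ℂ} {r : ℝ} (h : r ≤ |z.re|) : r ≤ ‖z‖ := h.trans (Complex.abs_re_le_norm z)

theorem norm_ge_of_im {z : ℂ} {r : ℝ} (h : r ≤ |z.im|) : r ≤ ‖z‖ := h.trans (Complex.abs_im_le_norm z)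

theorem le_norm_bigLoop {R : ℝ} (hR : 0 ≤ R) (t : I) : R / 4 ≤ ‖bigLoop R t‖ := by
  have key : ∀ (a b : ℂ), a = basePt R → |b.re| = R → b.im = -R → ∀ t : I,
      R / 4 ≤ ‖Path.segment a b t‖ := by
    rintro a b rfl hb hb' t
    -- Along such a side the real part has absolute value `t * R`, while the height is `(1 - 2 * t)
    -- * R`. The first is at least `R / 4` for `t ≥ 1 / 4`, the second for smaller `t`.
    by_cases h : (1 : ℝ) / 4 ≤ t
    · refine norm_ge_of_re ?_
      rw [segment_re, basePt_re, mul_zero, zero_add, abs_mul, hb, abs_of_nonneg t.2.1]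
      nlinarith
    · refine norm_ge_of_im ?_
      rw [segment_im, basePt_im, hb']
      refine le_trans ?_ (le_abs_self _)
      nlinarith
  rw [bigLoop, Path.trans_apply]
  split_ifs
  · rw [Path.trans_apply]
    split_ifs
    · exact key _ _ rfl (by simp [abs_of_nonneg hR]) rfl _
    · refine norm_ge_of_im ?_
      rw [segment_im]
      refine le_trans ?_ (neg_le_abs _)
      simp only
      nlinarith
  · rw [← Path.segment_symm]
    exact key _ _ rfl (by simp [abs_of_nonneg hR]) rfl _

/-- The two upper sides lie in the slit plane and contribute nothing. The bottom side is deformed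
within the lower half plane to pass through the points `lowerLeft 0` and `lowerLeft n`; between
these it picks up the letters in increasing order. -/
theorem pathWord_bigLoop {E : Finset ℕ} {R : ℝ} (hR : HighOn E R) :
    Off (punct E) (bigLoop R) ∧ pathWord E (bigLoop R) = orderedProd E := by
  set A : ℂ := ⟨-R, -R⟩
  set B : ℂ := ⟨R, -R⟩
  have hR0 := hR.1
  have hA : A.im < 0 := by simpa [A] using hR0
  have hB : B.im < 0 := by simpa [B] using hR0
  have hV := convex_halfSpace_im_lt 0
  have hVS : {z : ℂ | z.im < 0} ⊆ (punct E)ᶜ := by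
    intro z hz h
    obtain ⟨k, -, -, h⟩ := mem_punct_iff.1 h
    exact (ne_of_lt hz) h
  have s1 : ∀ t, Path.segment (basePt R) A t ∈ slit E := by
    intro t
    by_cases h : (t : ℝ) = 0
    · left
      rw [segment_im, h, basePt_im]; simpa using hR0
    · right
      intro k _ hk
      rw [segment_re, basePt_re] at hk
      have : 0 < (t : ℝ) := lt_of_le_of_ne t.2.1 (Ne.symm h)
      have h2 : (0 : ℝ) ≤ k := Nat.cast_nonneg k
      have h3 : A.re = -R := rfl
      rw [h3] at hk
      nlinarith
  have s3 : ∀ t, Path.segment B (basePt R) t ∈ slit E := by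
    intro t
    rw [← Path.segment_symm, Path.symm_apply, Function.comp_apply]
    generalize σ t = t
    by_cases h : 0 < (Path.segment (basePt R) B t).im
    · exact .inl h
    right
    intro k hk hk'
    have hB1 : B.re = R := rfl
    have hB2 : B.im = -R := rfl
    rw [segment_im, basePt_im, hB2] at h
    rw [segment_re, basePt_re, hB1] at hk'
    have h1 := hR.2 k hk
    unfold High at h1
    nlinarith
  have o1 : Off (punct E) _ := fun t => slit_subset E (s1 t)
  have o3 : Off (punct E) _ := fun t => slit_subset E (s3 t)
  have o2 := off_segment_lower E hA hB
  refine ⟨(o1.trans o2).trans o3, ?_⟩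
  rw [bigLoop, pathWord_trans (o1.trans o2) o3, pathWord_trans o1 o2, pathWord_of_slit s1,
    pathWord_of_slit s3, one_mul, mul_one]
  let n := E.sup id + 1
  have hn : E ⊆ Finset.range n := fun i hi =>
    Finset.mem_range.2 (Nat.lt_succ_of_le (Finset.le_sup (f := id) hi))
  have him : ∀ k, (lowerLeft k).im < 0 := fun k => by rw [lowerLeft_im]; norm_num
  have t1 : ∀ t, Path.segment A (lowerLeft 0) t ∈ slit E := fun t => by
    right
    intro k _ hk
    rw [segment_re, lowerLeft_re] at hk
    have h2 : (0 : ℝ) ≤ k := Nat.cast_nonneg k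
    have h3 : A.re = -R := rfl
    have := t.2.1
    have := t.2.2
    rw [h3] at hk
    push_cast at hk
    rcases le_total (t : ℝ) (1 / 2) with h | h <;> nlinarith
  have t3 : ∀ t, Path.segment (lowerLeft n) B t ∈ slit E := fun t => by
    right
    intro k hk hk'
    rw [segment_re, lowerLeft_re] at hk'
    have h3 : B.re = R := rfl
    have h0 := t.2.1
    have h1 := t.2.2
    rw [h3] at hk'
    have h4 : ((k : ℕ) : ℝ) + 1 ≤ n := by exact_mod_cast Finset.mem_range.1 (hn hk)
    have h5 := hR.2 k hk
    have h6 : (0 : ℝ) ≤ k := Nat.cast_nonneg k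
    unfold High at h5
    nlinarith
  have q1 := off_segment_lower E hA (him 0)
  have q2 := off_segment_lower E (him 0) (him n)
  have q3 := off_segment_lower E (him n) hB
  have h1 : HomOff (punct E) (Path.segment A B)
      (((Path.segment A (lowerLeft 0)).trans (Path.segment (lowerLeft 0) (lowerLeft n))).trans
        (Path.segment (lowerLeft n) B)) := by
    refine homOff_of_convex hV hVS (segment_mem hV hA hB) fun t => ?_
    rw [Path.trans_apply]
    split_ifs
    · rw [Path.trans_apply]
      split_ifs
      · exact segment_mem hV hA (him _) _
      · exact segment_mem hV (him _) (him _) _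
    · exact segment_mem hV (him _) hB _
  rw [h1.pathWord_eq, pathWord_trans (q1.trans q2) q3, pathWord_trans q1 q2, pathWord_of_slit t1,
    pathWord_of_slit t3, pathWord_lower, one_mul, mul_one, orderedProd_eq hn]

end OrderedProd

/-! ### The action of moving configurations on free groups -/

section Action

variable {ι : Type*} {u v w : Config ι} {E E' E'' : Finset ℕ}

/-- The strings of `p` carry the loop of each element `g` of the free group on `E` to the loop of
`e g`, provided the base point is far enough away. -/
def Act (p : Path u v) (e : FreeOn E →* FreeOn E') : Prop :=
  ∀ᶠ R in atTop, ∀ g, Moves p (loopOf R g) (loopOf R (e g))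

/-- The base point is far enough away for the strings of `p`. -/
structure FarBase (p : Path u v) (E E' : Finset ℕ) (R : ℝ) : Prop where
  far : ∀ t i, ‖(p t).1 i‖ + 1 ≤ R
  high : HighOn E R
  high' : HighOn E' R
  congr : ∀ {γ γ' γ₁ γ₁' : Path (basePt R) (basePt R)}, Moves p γ γ' → HomOff (punct E) γ₁ γ →
    HomOff (punct E') γ' γ₁' → Moves p γ₁ γ₁'
  unique : ∀ {γ γ₁ γ₂ : Path (basePt R) (basePt R)}, Moves p γ γ₁ → Moves p γ γ₂ →
    HomOff (punct E') γ₁ γ₂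
  exists_moves : ∀ {γ : Path (basePt R) (basePt R)}, Off (punct E) γ → ∃ γ', Moves p γ γ'

theorem eventually_farBase [Fintype ι] (p : Path u v) (hu : range u.1 = punct E)
    (hv : range v.1 = punct E') : ∀ᶠ R in atTop, FarBase p E E' R := by
  filter_upwards [eventually_far_path p, eventually_highOn E, eventually_highOn E',
    moves_congr_left p, moves_congr_right p, moves_unique p, eventually_exists_moves p]
    with R h1 h2 h3 h4 h5 h6 h7
  rw [hu] at h4 h7
  rw [hv] at h5 h6
  exact ⟨h1, h2, h3, fun a b c => h5 _ _ _ (h4 _ _ _ b a) c, fun a b => h6 _ _ _ a b,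
    fun a => h7 _ a⟩

namespace FarBase

variable {p : Path u v} {R : ℝ}

theorem congr_word (h : FarBase p E E' R) {γ γ' γ₁ γ₁' : Path (basePt R) (basePt R)}
    (hu : range u.1 = punct E) (hv : range v.1 = punct E')
    (hm : Moves p γ γ') (ho : Off (punct E) γ₁) (hw : pathWord E γ₁ = pathWord E γ)
    (ho' : Off (punct E') γ₁') (hw' : pathWord E' γ' = pathWord E' γ₁') : Moves p γ₁ γ₁' :=
  h.congr hm ((homOff_iff_pathWord ho (hu ▸ hm.off_left)).2 hw)
    ((homOff_iff_pathWord (hv ▸ hm.off_right) ho').2 hw')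

theorem moves_loopOf (h : FarBase p E E' R) (hu : range u.1 = punct E)
    (hv : range v.1 = punct E') {γ γ' : Path (basePt R) (basePt R)} (hm : Moves p γ γ') :
    Moves p (loopOf R (pathWord E γ)) (loopOf R (pathWord E' γ')) :=
  h.congr_word hu hv hm (off_loopOf h.high E _) (pathWord_loopOf_self h.high _)
    (off_loopOf h.high' E' _) (pathWord_loopOf_self h.high' _).symm

theorem moves_iff (h : FarBase p E E' R) (hv : range v.1 = punct E')
    {γ γ' γ₁' : Path (basePt R) (basePt R)} (hm : Moves p γ γ') (hm₂ : Moves p γ γ₁') :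
    pathWord E' γ' = pathWord E' γ₁' :=
  (homOff_iff_pathWord (hv ▸ hm.off_right) (hv ▸ hm₂.off_right)).1 (h.unique hm hm₂)

/-- Words correspond if paths do. -/
theorem word_eq (h : FarBase p E E' R) (hu : range u.1 = punct E) (hv : range v.1 = punct E')
    {e : FreeOn E → FreeOn E'} (he : ∀ g, Moves p (loopOf R g) (loopOf R (e g)))
    {γ γ' : Path (basePt R) (basePt R)} (hm : Moves p γ γ') :
    pathWord E' γ' = e (pathWord E γ) := by
  have := h.moves_iff hv (h.moves_loopOf hu hv hm) (he _)
  rwa [pathWord_loopOf_self h.high', pathWord_loopOf_self h.high'] at this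

/-- Loops of words can be moved if the loops of the generators can. -/
theorem moves_of_gen (h : FarBase p E E' R) (hu : range u.1 = punct E) (hv : range v.1 = punct E')
    {e : FreeOn E →* FreeOn E'}
    (he : ∀ k : E, Moves p (genLoop R k) (loopOf R (e (FreeGroup.of k)))) (g : FreeOn E) :
    Moves p (loopOf R g) (loopOf R (e g)) := by
  have hmul : ∀ a b, Moves p (loopOf R a) (loopOf R (e a)) → Moves p (loopOf R b) (loopOf R (e b)) →
      Moves p (loopOf R (a * b)) (loopOf R (e (a * b))) := by
    intro a b ha hb
    refine h.congr_word hu hv (ha.trans_paths hb) (off_loopOf h.high E _) ?_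
      (off_loopOf h.high' E' _) ?_
    · rw [pathWord_trans (off_loopOf h.high E _) (off_loopOf h.high E _),
        pathWord_loopOf_self h.high, pathWord_loopOf_self h.high, pathWord_loopOf_self h.high]
    · rw [pathWord_trans (off_loopOf h.high' E' _) (off_loopOf h.high' E' _),
        pathWord_loopOf_self h.high', pathWord_loopOf_self h.high', pathWord_loopOf_self h.high',
        map_mul]
  have hof : ∀ k : E, Moves p (loopOf R (FreeGroup.of k)) (loopOf R (e (FreeGroup.of k))) := by
    intro k
    have h1 := h.moves_loopOf hu hv (he k)
    rwa [pathWord_genLoop E (h.high.2 k k.2), letter_coe, pathWord_loopOf_self h.high'] at h1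
  induction g using FreeGroup.induction_on with
  | C1 =>
    rw [map_one]
    have h1 : ∀ F : Finset ℕ, loopOf R (1 : FreeOn F) = Path.refl _ := fun F => by
      rw [loopOf, FreeGroup.toWord_one]; rfl
    rw [h1, h1]
    refine Moves.of_forall_ne fun s t i => ?_
    intro h2
    have h3 := h.far t i
    rw [← h2] at h3
    simp only [Path.refl_apply] at h3
    have h4 : R ≤ ‖basePt R‖ := by
      have := norm_basePt_sub R 0
      simpa using this
    linarith
  | of k => exact hof k
  | inv_of k _ =>
    refine h.congr_word hu hv (hof k).symm_paths (off_loopOf h.high E _) ?_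
      (off_loopOf h.high' E' _) ?_
    · rw [pathWord_symm (off_loopOf h.high E _), pathWord_loopOf_self h.high,
        pathWord_loopOf_self h.high]
    · rw [pathWord_symm (off_loopOf h.high' E' _), pathWord_loopOf_self h.high',
        pathWord_loopOf_self h.high', map_inv]
  | mul a b ha hb => exact hmul a b ha hb

end FarBase

theorem act_of_gen [Fintype ι] {p : Path u v} (hu : range u.1 = punct E)
    (hv : range v.1 = punct E') {e : FreeOn E →* FreeOn E'}
    (he : ∀ᶠ R in atTop, ∀ k : E, Moves p (genLoop R k) (loopOf R (e (FreeGroup.of k)))) :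
    Act p e := by
  filter_upwards [eventually_farBase p hu hv, he] with R hR he' g
  exact hR.moves_of_gen hu hv he' g

theorem Act.gen {p : Path u v} [Fintype ι] (hu : range u.1 = punct E) (hv : range v.1 = punct E')
    {e : FreeOn E →* FreeOn E'} (h : Act p e) :
    ∀ᶠ R in atTop, ∀ k : E, Moves p (genLoop R k) (loopOf R (e (FreeGroup.of k))) := by
  filter_upwards [eventually_farBase p hu hv, h] with R hR h k
  refine hR.congr_word hu hv (h (FreeGroup.of k)) (off_genLoop E (hR.high.2 k k.2)) ?_
    (off_loopOf hR.high' E' _) rfl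
  rw [pathWord_genLoop E (hR.high.2 k k.2), letter_coe, pathWord_loopOf_self hR.high]

/-- The action can be computed with a single base point. -/
theorem act_of_moves_at [Fintype ι] {p : Path u v} (hu : range u.1 = punct E)
    (hv : range v.1 = punct E') {e : FreeOn E →* FreeOn E'} {R₀ : ℝ} (h₀ : FarBase p E E' R₀)
    (he : ∀ g, Moves p (loopOf R₀ g) (loopOf R₀ (e g))) : Act p e := by
  filter_upwards [eventually_farBase p hu hv, eventually_ge_atTop R₀] with R hR hRR g
  -- The vertical segment between the two base points stays above all strings and in the slit plane,
  -- so it does not move and has trivial word. Conjugation by it changes the base point.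
  let S := Path.segment (basePt R) (basePt R₀)
  have hSim : ∀ t, R₀ ≤ (S t).im := by
    intro t
    rw [segment_im, basePt_im, basePt_im]
    have := t.2.1
    have := t.2.2
    nlinarith
  have hS : ∀ F : Finset ℕ, ∀ t, S t ∈ slit F := fun F t => .inl (h₀.high.1.trans_le (hSim t))
  have hSo : ∀ F : Finset ℕ, Off (punct F) S := fun F t => slit_subset F (hS F t)
  have hSm : Moves p S S := by
    refine Moves.of_forall_ne fun s t i h => ?_
    have h1 := h₀.far t i
    rw [← h] at h1
    have h2 := norm_ge_of_im ((hSim s).trans (le_abs_self _))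
    linarith
  have hword : ∀ (F : Finset ℕ) (hF : HighOn F R₀) (g : FreeOn F),
      pathWord F ((S.trans (loopOf R₀ g)).trans S.symm) = g := by
    intro F hF g
    rw [pathWord_trans ((hSo F).trans (off_loopOf hF F g)) (hSo F).symm,
      pathWord_trans (hSo F) (off_loopOf hF F g), pathWord_symm (hSo F), pathWord_of_slit (hS F),
      pathWord_loopOf_self hF]
    simp
  refine hR.congr_word hu hv ((hSm.trans_paths (he g)).trans_paths hSm.symm_paths)
    (off_loopOf hR.high E g) ?_ (off_loopOf hR.high' E' _) ?_
  · rw [pathWord_loopOf_self hR.high, hword E h₀.high]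
  · rw [pathWord_loopOf_self hR.high', hword E' h₀.high']

theorem Act.unique [Fintype ι] {p : Path u v} (hu : range u.1 = punct E)
    (hv : range v.1 = punct E') {e e' : FreeOn E →* FreeOn E'} (h : Act p e) (h' : Act p e') :
    e = e' := by
  obtain ⟨R, hR, h, h'⟩ := ((eventually_farBase p hu hv).and (Eventually.and h h')).exists
  ext k
  have := hR.moves_iff hv (h (FreeGroup.of k)) (h' (FreeGroup.of k))
  rwa [pathWord_loopOf_self hR.high', pathWord_loopOf_self hR.high'] at this

/-- The image of `g` is the word of any loop to which the loop of `g` can be moved. It does not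
depend on the choice by uniqueness of motions, and it is multiplicative because motions can be
concatenated. -/
theorem exists_act [Fintype ι] (p : Path u v) (hu : range u.1 = punct E)
    (hv : range v.1 = punct E') : ∃ e : FreeOn E →* FreeOn E', Act p e := by
  obtain ⟨R, hR⟩ := (eventually_farBase p hu hv).exists
  choose Γ hΓ using fun g : FreeOn E => hR.exists_moves (off_loopOf hR.high E g)
  have hoff : ∀ g, Off (punct E') (Γ g) := fun g => hv ▸ (hΓ g).off_right
  let e : FreeOn E →* FreeOn E' := MonoidHom.mk' (fun g => pathWord E' (Γ g)) fun a b => by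
    have h1 : Moves p (loopOf R (a * b)) ((Γ a).trans (Γ b)) := by
      refine hR.congr_word hu hv ((hΓ a).trans_paths (hΓ b)) (off_loopOf hR.high E _) ?_
        ((hoff a).trans (hoff b)) rfl
      rw [pathWord_trans (off_loopOf hR.high E _) (off_loopOf hR.high E _),
        pathWord_loopOf_self hR.high, pathWord_loopOf_self hR.high, pathWord_loopOf_self hR.high]
    rw [hR.moves_iff hv (hΓ (a * b)) h1, pathWord_trans (hoff a) (hoff b)]
  refine ⟨e, act_of_moves_at hu hv hR fun g => ?_⟩
  have := hR.moves_loopOf hu hv (hΓ g)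
  rwa [pathWord_loopOf_self hR.high] at this

theorem Act.trans {p : Path u v} {q : Path v w} {e : FreeOn E →* FreeOn E'}
    {f : FreeOn E' →* FreeOn E''} (h : Act p e) (h' : Act q f) :
    Act (p.trans q) (f.comp e) := by
  filter_upwards [h, h'] with R h h' g
  exact (h g).trans_strings (h' _)

theorem Act.of_homotopic [Fintype ι] {p q : Path u v} {e : FreeOn E →* FreeOn E'} (h : Act p e)
    (hpq : p.Homotopic q) : Act q e := by
  filter_upwards [h, moves_of_homotopic hpq] with R h h' g
  exact h' _ _ (h g)

theorem act_refl (hu : range u.1 = punct E) : Act (Path.refl u) (MonoidHom.id (FreeOn E)) := by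
  filter_upwards [eventually_highOn E] with R hR g
  rw [Moves.refl_iff, hu]
  exact (homOff_iff_pathWord (off_loopOf hR E _) (off_loopOf hR E _)).2 rfl

theorem exists_act_equiv [Fintype ι] (p : Path u v) (hu : range u.1 = punct E)
    (hv : range v.1 = punct E') : ∃ e : FreeOn E ≃* FreeOn E',
      Act p e.toMonoidHom ∧ Act p.symm e.symm.toMonoidHom := by
  obtain ⟨e, he⟩ := exists_act p hu hv
  obtain ⟨f, hf⟩ := exists_act p.symm hv hu
  have h1 : f.comp e = MonoidHom.id _ :=
    ((he.trans hf).of_homotopic ⟨(Path.Homotopy.reflTransSymm p).symm⟩).unique hu hu (act_refl hu)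
  have h2 : e.comp f = MonoidHom.id _ :=
    ((hf.trans he).of_homotopic ⟨(Path.Homotopy.reflSymmTrans p).symm⟩).unique hv hv (act_refl hv)
  exact ⟨MonoidHom.toMulEquiv e f h1 h2, he, hf⟩

theorem Act.symm [Fintype ι] {p : Path u v} (hu : range u.1 = punct E)
    (hv : range v.1 = punct E') {e : FreeOn E ≃* FreeOn E'} (h : Act p e.toMonoidHom) :
    Act p.symm e.symm.toMonoidHom := by
  obtain ⟨f, hf, hf₂⟩ := exists_act_equiv p hu hv
  have h1 := h.unique hu hv hf
  obtain rfl : e = f := MulEquiv.ext fun g => DFunLike.congr_fun h1 g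
  exact hf₂

/-- Forgetting strings corresponds to projecting free groups. -/
theorem Act.restrict {κ : Type*} [Fintype κ] {p : Path u v} {u' v' : Config κ}
    {p' : Path u' v'} {F F' : Finset ℕ}
    (hu' : range u'.1 = punct F) (hv' : range v'.1 = punct F') (r : κ → ι)
    (hr : ∀ t i, (p' t).1 i = (p t).1 (r i)) {e : FreeOn E →* FreeOn E'}
    {f : FreeOn F →* FreeOn F'} (h : Act p e) (h' : Act p' f) :
    (proj E' F').comp e = f.comp (proj E F) := by
  obtain ⟨R, ⟨⟨hR, hE⟩, hE'⟩, h, h'⟩ :=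
    ((((eventually_farBase p' hu' hv').and (eventually_highOn E)).and (eventually_highOn E')).and
      (Eventually.and h h')).exists
  ext k
  have h1 := (h (FreeGroup.of k)).map_strings r hr
  have h2 := hR.word_eq hu' hv' h' h1
  rwa [pathWord_loopOf hE', pathWord_loopOf hE] at h2

/-- A sufficiently large triangle encloses the strings at all times, so it moves to itself. Its word
is the ordered product before and after. -/
theorem Act.orderedProd [Fintype ι] {p : Path u v} (hu : range u.1 = punct E)
    (hv : range v.1 = punct E') {e : FreeOn E →* FreeOn E'} (h : Act p e) :
    e (orderedProd E) = orderedProd E' := by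
  obtain ⟨M, hM⟩ := (eventually_far_path p).exists
  obtain ⟨R, ⟨hR, h⟩, hRM⟩ := (((eventually_farBase p hu hv).and h).and
    (eventually_gt_atTop (4 * M))).exists
  have h1 : Moves p (bigLoop R) (bigLoop R) := by
    refine Moves.of_forall_ne fun s t i hs => ?_
    have h2 := hM t i
    rw [← hs] at h2
    have h3 := le_norm_bigLoop hR.high.1.le s
    linarith
  have h2 := hR.word_eq hu hv h h1
  rw [(pathWord_bigLoop hR.high).2, (pathWord_bigLoop hR.high').2] at h2
  exact h2.symm

end Action

/-! ### Small loops -/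

section Small

/-- The offset of the starting point of a small loop. -/
def offset (ε : ℝ) : ℂ := ⟨-ε, -ε⟩

/-- A small triangle around `c`. -/
def smallLoop (c : ℂ) (ε : ℝ) : Path (c + offset ε) (c + offset ε) :=
  ((Path.segment (c + offset ε) (c + ⟨ε, -ε⟩)).trans
    (Path.segment (c + ⟨ε, -ε⟩) (c + ⟨0, ε⟩))).trans (Path.segment (c + ⟨0, ε⟩) (c + offset ε))

theorem segment_add_apply (c d a b : ℂ) (t : I) :
    Path.segment (c + a) (c + b) t = Path.segment (d + a) (d + b) t + (c - d) := by
  simp only [segment_apply_eq]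
  push_cast
  ring

theorem smallLoop_translate (c d : ℂ) (ε : ℝ) (t : I) :
    smallLoop c ε t = smallLoop d ε t + (c - d) := by
  simp only [smallLoop, Path.trans_apply]
  split_ifs <;> exact segment_add_apply _ _ _ _ _

theorem norm_smallLoop_sub_le (c : ℂ) {ε : ℝ} (hε : 0 ≤ ε) (t : I) :
    ‖smallLoop c ε t - c‖ ≤ 2 * ε := by
  have hV : Convex ℝ (Metric.closedBall c (2 * ε)) := convex_closedBall _ _
  have hmem : ∀ a : ℂ, |a.re| ≤ ε → |a.im| ≤ ε → c + a ∈ Metric.closedBall c (2 * ε) := by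
    intro a h1 h2
    rw [mem_closedBall_iff_norm, add_sub_cancel_left]
    exact (Complex.norm_le_abs_re_add_abs_im a).trans (by linarith)
  have h1 := hmem (offset ε) (by simp [offset, abs_of_nonneg hε]) (by simp [offset, abs_of_nonneg hε])
  have h2 := hmem ⟨ε, -ε⟩ (by simp [abs_of_nonneg hε]) (by simp [abs_of_nonneg hε])
  have h3 := hmem ⟨0, ε⟩ (by simpa using hε) (by simp [abs_of_nonneg hε])
  rw [← mem_closedBall_iff_norm, smallLoop, Path.trans_apply]
  split_ifs
  · rw [Path.trans_apply]
    split_ifs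
    · exact segment_mem hV h1 h2 _
    · exact segment_mem hV h2 h3 _
  · exact segment_mem hV h3 h1 _

theorem smallLoop_spec (E : Finset ℕ) {k : ℕ} {ε : ℝ} (hε : 0 < ε) (hε2 : ε ≤ 1 / 2) :
    Off (punct E) (smallLoop k ε) ∧
      ∀ hk : k ∈ E, pathWord E (smallLoop k ε) = FreeGroup.of ⟨k, hk⟩ := by
  set A : ℂ := (k : ℂ) + offset ε
  set B : ℂ := (k : ℂ) + ⟨ε, -ε⟩
  set M : ℂ := (k : ℂ) + ⟨0, ε⟩
  have hA : A.re = k - ε ∧ A.im = -ε := by constructor <;> simp [A, offset]; ring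
  have hB : B.re = k + ε ∧ B.im = -ε := by constructor <;> simp [B]
  have hM : M.re = k ∧ M.im = ε := by constructor <;> simp [M]
  have hAs : A ∈ strip k := ⟨by rw [hA.2]; linarith, by rw [hA.1, abs_lt]; constructor <;> linarith⟩
  have hBs : B ∈ strip k := ⟨by rw [hB.2]; linarith, by rw [hB.1, abs_lt]; constructor <;> linarith⟩
  have s2 : ∀ t, Path.segment B M t ∈ slit E := by
    intro t
    by_cases h : 0 < (Path.segment B M t).im
    · exact .inl h
    rw [segment_im, hB.2, hM.2] at h
    have ht := t.2.1
    have h' : (t : ℝ) ≤ 1 / 2 := by nlinarith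
    refine mem_slit_of_between k ?_ ?_ <;> rw [segment_re, hB.1, hM.1] <;> push_cast <;> nlinarith
  have s3 : ∀ t, Path.segment M A t ∈ slit E := by
    intro t
    by_cases h : 0 < (Path.segment M A t).im
    · exact .inl h
    rw [segment_im, hA.2, hM.2] at h
    have ht := t.2.2
    have h' : 1 / 2 ≤ (t : ℝ) := by nlinarith
    refine mem_slit_of_between (k - 1) ?_ ?_ <;> rw [segment_re, hA.1, hM.1] <;> push_cast <;>
      nlinarith
  have o1 := off_segment_lower E (x := A) (y := B) hAs.1 hBs.1
  have o2 : Off (punct E) _ := fun t => slit_subset E (s2 t)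
  have o3 : Off (punct E) _ := fun t => slit_subset E (s3 t)
  refine ⟨(o1.trans o2).trans o3, fun hk => ?_⟩
  rw [smallLoop, pathWord_trans (o1.trans o2) o3, pathWord_trans o1 o2, pathWord_of_slit s2,
    pathWord_of_slit s3, mul_one, mul_one]
  exact pathWord_cross_of_mem ⟨k, hk⟩ hAs hBs (by rw [hA.1]; simp [hε.le]) (by rw [hB.1]; simp [hε])

/-- The segment from the base point to the starting point of a small loop. -/
def tail (R : ℝ) (c : ℂ) (ε : ℝ) : Path (basePt R) (c + offset ε) :=
  Path.segment (basePt R) (c + offset ε)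

theorem tail_mem_slit (E : Finset ℕ) {k : ℕ} {R ε : ℝ} (hR : High k R) (hε : 0 < ε)
    (hε2 : ε ≤ 1 / 2) (t : I) : tail R k ε t ∈ slit E :=
  segment_left_mem_slit E hR hε hε2 (by simp [offset]; ring) (by simp [offset]) t

/-- A small loop at the end of a tail. -/
def lasso {x a : ℂ} (τ : Path x a) (c : Path a a) : Path x x := (τ.trans c).trans τ.symm

theorem pathWord_lasso {E : Finset ℕ} {x a : ℂ} {τ : Path x a} {c : Path a a}
    (hτ : Off (punct E) τ) (hc : Off (punct E) c) :
    pathWord E (lasso τ c) = pathWord E τ * pathWord E c * (pathWord E τ)⁻¹ := by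
  rw [lasso, pathWord_trans (hτ.trans hc) hτ.symm, pathWord_trans hτ hc, pathWord_symm hτ]

/-- A moving string carries a small loop around it, and drags its tail. -/
theorem exists_drag {ι : Type*} [Fintype ι] {u v : Config ι} (p : Path u v) (i : ι) {k l : ℕ}
    (hk : u.1 i = k) (hl : v.1 i = l) {E : Finset ℕ} (hu : range u.1 = punct E) :
    ∃ ε > 0, ε ≤ 1 / 2 ∧
      (∀ (r t : I) (j : ι), j ≠ i → (p t).1 i + (r : ℝ) * offset ε ≠ (p t).1 j) ∧
      ∀ᶠ R in atTop, ∃ (T : C(I × I, ℂ)) (τ : Path (basePt R) (l + offset ε)),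
      (∀ s, T (s, 0) = tail R k ε s) ∧ (∀ s, T (s, 1) = τ s) ∧ (∀ t, T (0, t) = basePt R) ∧
      (∀ t, T (1, t) = (p t).1 i + offset ε) ∧ (∀ s t j, T (s, t) ≠ (p t).1 j) ∧
      Moves p (lasso (tail R k ε) (smallLoop k ε)) (lasso τ (smallLoop l ε)) := by
  obtain ⟨ε₀, hε₀, hc⟩ := exists_carry (K := I) (p.toContinuousMap.comp ⟨Prod.snd, continuous_snd⟩)
  -- The small triangle stays within `2 * ε` of its centre. Half of `ε₀` keeps it where points move
  -- in parallel with the string.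
  let ε := min (ε₀ / 2) (1 / 2)
  have hε : 0 < ε := lt_min (by positivity) (by norm_num)
  have hε2 : ε ≤ 1 / 2 := min_le_right _ _
  have hεε : 2 * ε ≤ ε₀ := by
    have : ε ≤ ε₀ / 2 := min_le_left _ _
    linarith
  have hp0 : p 0 = u := p.source
  have hp1 : p 1 = v := p.target
  have hav : ∀ {x y : ℂ} {γ : Path x y}, Off (punct E) γ → ∀ s j, γ s ≠ (p 0).1 j := by
    intro x y γ hγ s j h
    rw [hp0] at h
    exact hγ s (hu ▸ ⟨j, h.symm⟩)
  have hnear : ‖offset ε‖ ≤ ε₀ := by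
    have h1 := (norm_smallLoop_sub_le k hε.le 0).trans hεε
    rwa [Path.source, add_sub_cancel_left] at h1
  refine ⟨ε, hε, hε2, fun r t j hj => ?_, ?_⟩
  · by_cases hr : (r : ℝ) = 0
    · rw [hr]
      intro h
      exact hj ((p t).2 (by simpa using h.symm))
    · have hr0 : 0 < (r : ℝ) := lt_of_le_of_ne r.2.1 (Ne.symm hr)
      -- A single point at `k + r * offset ε` is carried in parallel with string `i` and meets no
      -- string on its way.
      obtain ⟨G, -, G1, -, -, G4⟩ := hc (Path.refl ((k : ℂ) + (r : ℝ) * offset ε)).toContinuousMap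
        (hav (Off.refl fun h => by
          obtain ⟨_, -, -, h⟩ := mem_punct_iff.1 h
          simp [offset] at h
          rcases h with h | h
          · exact hr (by simp [h])
          · exact hε.ne' h))
      have h := G4 0 i ?_ t
      · change _ = (k : ℂ) + (r : ℝ) * offset ε + ((p t).1 i - (p 0).1 i) at h
        rw [hp0, hk] at h
        intro h'
        apply G1 0 t j
        change G (0, t) = (p t).1 j
        rw [h, ← h']; ring
      · change ‖(k : ℂ) + (r : ℝ) * offset ε - (p 0).1 i‖ ≤ ε₀
        rw [hp0, hk, add_sub_cancel_left, norm_mul, Complex.norm_real, Real.norm_eq_abs,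
          abs_of_pos hr0]
        have := r.2.2
        have := norm_nonneg (offset ε)
        nlinarith
  filter_upwards [eventually_far_path p, eventually_ge_atTop (2 * (k : ℝ) + 2)] with R hfar hR
  have hR : High k R := hR
  obtain ⟨T, T0, T1, -, T3, T4⟩ := hc (tail R k ε).toContinuousMap
    (hav fun t => slit_subset E (tail_mem_slit E hR hε hε2 t))
  obtain ⟨C, C0, C1, -, -, C4⟩ := hc (smallLoop k ε).toContinuousMap
    (hav (smallLoop_spec E hε hε2).1)
  have hT0 : ∀ t, T (0, t) = basePt R := by
    intro t
    refine (T3 0 (fun t j => ?_) t).trans (tail R k ε).source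
    change 1 ≤ ‖tail R k ε 0 - (p t).1 j‖
    rw [Path.source]
    have := norm_basePt_sub R ((p t).1 j)
    have := hfar t j
    linarith
  have hCe : ∀ s t, C (s, t) = smallLoop k ε s + ((p t).1 i - k) := by
    intro s t
    have h := C4 s i ?_ t
    · change _ = smallLoop k ε s + ((p t).1 i - (p 0).1 i) at h
      rwa [hp0, hk] at h
    · change ‖smallLoop k ε s - (p 0).1 i‖ ≤ ε₀
      rw [hp0, hk]
      exact (norm_smallLoop_sub_le k hε.le s).trans hεε
  have hT1 : ∀ t, T (1, t) = (p t).1 i + offset ε := by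
    intro t
    have h := T4 1 i ?_ t
    · change _ = tail R k ε 1 + ((p t).1 i - (p 0).1 i) at h
      rw [hp0, hk, Path.target] at h
      rw [h]; ring
    · change ‖tail R k ε 1 - (p 0).1 i‖ ≤ ε₀
      rwa [hp0, hk, Path.target, add_sub_cancel_left]
  let τ : Path (basePt R) (l + offset ε) :=
    ⟨T.comp ⟨fun s => (s, 1), by fun_prop⟩, hT0 1, by
      change T (1, 1) = _
      rw [hT1, hp1, hl]⟩
  refine ⟨T, τ, T0, fun _ => rfl, hT0, hT1, T1, ?_⟩
  -- The lasso moves in three pieces that fit at all times: the dragged tail, the small loop in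
  -- rigid motion with string `i`, and the tail run backwards.
  obtain ⟨H₁, hH₁⟩ := exists_hconcat T C fun t => by
    rw [hT1, hCe, Path.source]; ring
  have hC1 : ∀ t, C (1, t) = (p t).1 i + offset ε := fun t => by
    rw [hCe, Path.target]; ring
  obtain ⟨H, hH⟩ := exists_hconcat H₁ (T.comp ⟨fun q => (σ q.1, q.2), by fun_prop⟩) fun t => by
    rw [hH₁, dif_neg (by norm_num)]
    change C _ = T (σ 0, t)
    rw [unitInterval.symm_zero, hT1, ← hC1]
    congr 2
    ext; simp; norm_num
  refine ⟨H, fun s => ?_, fun s => ?_, fun t => ⟨?_, ?_⟩, fun s t j => ?_⟩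
  · rw [hH, lasso, Path.trans_apply]
    split_ifs
    · rw [hH₁, Path.trans_apply]
      split_ifs
      · exact T0 _
      · exact C0 _
    · exact T0 _
  · rw [hH, lasso, Path.trans_apply]
    split_ifs
    · rw [hH₁, Path.trans_apply]
      split_ifs
      · rfl
      · rw [hCe, hp1, hl]
        exact (smallLoop_translate _ _ _ _).symm
    · rfl
  · rw [hH, dif_pos (by simp), hH₁, dif_pos (by simp), ← hT0 t]
    congr 2
    ext; simp
  · rw [hH, dif_neg (by norm_num)]
    change T (σ _, t) = _
    rw [← hT0 t]
    congr 2
    ext; simp; norm_num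
  · rw [hH]
    split_ifs
    · rw [hH₁]
      split_ifs
      · exact T1 _ _ _
      · exact C1 _ _ _
    · exact T1 _ _ _

/-- Generators are carried to conjugates of generators. -/
theorem Act.conj {ι : Type*} [Fintype ι] {u v : Config ι} {E E' : Finset ℕ} {p : Path u v}
    (hu : range u.1 = punct E) (hv : range v.1 = punct E') {e : FreeOn E →* FreeOn E'}
    (h : Act p e) (i : ι) {k : E} {l : E'} (hk : u.1 i = (k : ℕ)) (hl : v.1 i = (l : ℕ)) :
    ∃ V : FreeOn E', e (FreeGroup.of k) = V⁻¹ * FreeGroup.of l * V := by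
  obtain ⟨ε, hε, hε2, -, hd⟩ := exists_drag p i hk hl hu
  obtain ⟨R, ⟨hR, h⟩, T, τ, T0, T1, -, -, T4, hm⟩ :=
    (((eventually_farBase p hu hv).and h).and hd).exists
  have h1 := hR.word_eq hu hv h hm
  have ho : Off (punct E) (tail R k ε) := fun t =>
    slit_subset E (tail_mem_slit E (hR.high.2 k k.2) hε hε2 t)
  have ho' : Off (punct E') τ := by
    rw [← hv]
    rintro s ⟨j, hj⟩
    have := T4 s 1 j
    rw [T1, p.target] at this
    exact this hj.symm
  rw [pathWord_lasso ho (smallLoop_spec E hε hε2).1,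
    pathWord_of_slit (tail_mem_slit E (hR.high.2 k k.2) hε hε2),
    (smallLoop_spec E hε hε2).2 k.2, pathWord_lasso ho' (smallLoop_spec E' hε hε2).1,
    (smallLoop_spec E' hε hε2).2 l.2] at h1
  refine ⟨(pathWord E' τ)⁻¹, ?_⟩
  rw [inv_inv]
  simpa using h1.symm

end Small

/-! ### Adding and forgetting strings -/

/-- The subfamily of a configuration that is indexed by `r`. -/
def Config.sub {κ ι : Type*} (r : κ ↪ ι) (u : Config ι) : Config κ :=
  ⟨u.1 ∘ r, u.2.comp r.injective⟩

theorem Config.continuous_sub {κ ι : Type*} (r : κ ↪ ι) : Continuous (Config.sub r) := by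
  have h : Continuous fun u : Config ι => u.1 ∘ r :=
    continuous_pi fun i => (continuous_apply (r i)).comp continuous_subtype_val
  exact h.subtype_mk _

/-- All points but the last one. -/
def Config.init {n : ℕ} (u : Config (Fin (n + 1))) : Config (Fin n) := u.sub Fin.castSuccEmb

theorem Config.continuous_init {n : ℕ} : Continuous (Config.init (n := n)) :=
  Config.continuous_sub _

theorem Config.init_apply {n : ℕ} (u : Config (Fin (n + 1))) (i : Fin n) :
    u.init.1 i = u.1 i.castSucc := rfl

theorem Config.ext_init {n : ℕ} {u v : Config (Fin (n + 1))} (h : u.init = v.init)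
    (h' : u.1 (Fin.last n) = v.1 (Fin.last n)) : u = v := by
  apply Subtype.ext
  funext i
  induction i using Fin.lastCases with
  | last => exact h'
  | cast i => exact congrFun (congrArg Subtype.val h) i

theorem exists_snoc {X : Type*} [TopologicalSpace X] {n : ℕ} (u : C(X, Config (Fin n)))
    (z : C(X, ℂ)) (h : ∀ x i, z x ≠ (u x).1 i) :
    ∃ w : C(X, Config (Fin (n + 1))), ∀ x, (w x).init = u x ∧ (w x).1 (Fin.last n) = z x := by
  have hinj : ∀ x, Function.Injective (Fin.snoc (α := fun _ => ℂ) (u x).1 (z x)) := by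
    intro x i j hij
    induction i using Fin.lastCases with
    | last =>
      induction j using Fin.lastCases with
      | last => rfl
      | cast j => simp [h x j] at hij
    | cast i =>
      induction j using Fin.lastCases with
      | last => simp [Ne.symm (h x i)] at hij
      | cast j =>
        simp only [Fin.snoc_castSucc] at hij
        rw [(u x).2 hij]
  have hc : Continuous fun x => Fin.snoc (α := fun _ => ℂ) (u x).1 (z x) :=
    Continuous.finSnoc (continuous_subtype_val.comp u.continuous) z.continuous
  refine ⟨⟨fun x => ⟨_, hinj x⟩, hc.subtype_mk _⟩, fun x => ⟨?_, ?_⟩⟩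
  · apply Subtype.ext
    funext i
    rw [Config.init_apply]
    exact Fin.snoc_castSucc (α := fun _ => ℂ) _ _ _
  · exact Fin.snoc_last (α := fun _ => ℂ) _ _

theorem homotopic_of_map {X : Type*} [TopologicalSpace X] {x y : X} {p q : Path x y}
    (H : C(I × I, X)) (h0 : ∀ t, H (0, t) = p t) (h1 : ∀ t, H (1, t) = q t)
    (hs : ∀ s, H (s, 0) = x ∧ H (s, 1) = y) : p.Homotopic q := by
  refine ⟨⟨⟨H, h0, h1⟩, ?_⟩⟩
  rintro s t (rfl | rfl)
  · exact (hs s).1.trans p.source.symm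
  · exact (hs s).2.trans p.target.symm

/-- A homotopy of the first strings of `p` extends to a homotopy of `p`. -/
theorem exists_carry_last {n : ℕ} {u v : Config (Fin (n + 1))} (p : Path u v)
    (H : C(I × I, Config (Fin n))) (h0 : ∀ t, H (0, t) = (p t).init)
    (hs : ∀ s, H (s, 0) = u.init ∧ H (s, 1) = v.init) :
    ∃ (G : C(I × I, ℂ)) (p' : Path u v), (∀ t, G (t, 0) = (p t).1 (Fin.last n)) ∧
      (∀ s, G (0, s) = u.1 (Fin.last n) ∧ G (1, s) = v.1 (Fin.last n)) ∧
      (∀ t s i, G (t, s) ≠ (H (s, t)).1 i) ∧ (∀ t, (p' t).init = H (1, t)) ∧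
      (∀ t, (p' t).1 (Fin.last n) = G (t, 1)) ∧ p.Homotopic p' := by
  obtain ⟨_, -, hc⟩ := exists_carry (K := I) (H.comp ⟨fun q : I × I => (q.2, q.1), by fun_prop⟩)
  obtain ⟨G, G0, G1, G2, -, -⟩ := hc
    ⟨fun t => (p t).1 (Fin.last n), (continuous_apply _).comp (by fun_prop)⟩ fun t i => by
      change (p t).1 (Fin.last n) ≠ (H (0, t)).1 i
      rw [h0, Config.init_apply]
      intro h
      exact (Fin.castSucc_lt_last i).ne' ((p t).2 h)
  have Gs : ∀ s, G (0, s) = u.1 (Fin.last n) ∧ G (1, s) = v.1 (Fin.last n) := by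
    intro s
    constructor
    · refine (G2 0 (fun t => ?_) s).trans ?_
      · exact (hs t).1.trans (hs 0).1.symm
      · change (p 0).1 _ = _
        rw [p.source]
    · refine (G2 1 (fun t => ?_) s).trans ?_
      · exact (hs t).2.trans (hs 0).2.symm
      · change (p 1).1 _ = _
        rw [p.target]
  obtain ⟨W, hW⟩ := exists_snoc H (G.comp ⟨fun q : I × I => (q.2, q.1), by fun_prop⟩)
    fun q i => G1 q.2 q.1 i
  have hW1 : ∀ s t, (W (s, t)).init = H (s, t) := fun s t => (hW _).1
  have hW2 : ∀ s t, (W (s, t)).1 (Fin.last n) = G (t, s) := fun s t => (hW _).2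
  have We : ∀ s, W (s, 0) = u ∧ W (s, 1) = v := fun s =>
    ⟨Config.ext_init ((hW1 _ _).trans (hs s).1) ((hW2 _ _).trans (Gs s).1),
      Config.ext_init ((hW1 _ _).trans (hs s).2) ((hW2 _ _).trans (Gs s).2)⟩
  refine ⟨G, ⟨W.comp ⟨fun t => (1, t), by fun_prop⟩, (We 1).1, (We 1).2⟩, G0, Gs, G1,
    fun t => hW1 _ _, fun t => hW2 _ _, homotopic_of_map W (fun t => ?_) (fun t => rfl) We⟩
  exact Config.ext_init ((hW1 _ _).trans (h0 t)) ((hW2 _ _).trans (G0 t))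

/-! ### Strings that act trivially -/

/-- An element that commutes with a generator becomes trivial if that generator is killed. -/
theorem proj_eq_one_of_commute {E : Finset ℕ} {F : Finset ℕ} (k : F) (hk : (k : ℕ) ∉ E)
    {V : FreeOn F} (hV : Commute V (FreeGroup.of k)) : proj F E V = 1 := by
  -- The free group on `F` acts on two copies of the free group on `E`: generators in `E` multiply
  -- both copies from the left, all others exchange the two copies of `1` and fix the rest. On first
  -- components this is multiplication by the projection. If `proj F E V` were not `1`, then `V`
  -- would take `(1, true)` to a point fixed by `δ_k`; as `V` commutes with `δ_k`, it would take
  -- `(1, true)` and `(1, false)` to the same point.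
  let ρ : FreeOn F →* Equiv.Perm (FreeOn E × Bool) := FreeGroup.lift fun i =>
    if h : (i : ℕ) ∈ E then Equiv.prodCongr (Equiv.mulLeft (FreeGroup.of ⟨i, h⟩)) (Equiv.refl Bool)
    else Equiv.swap (1, true) (1, false)
  have hρk : ρ (FreeGroup.of k) = Equiv.swap (1, true) (1, false) := by
    simp [ρ, hk]
  have hgen : ∀ (i : F) (x : FreeOn E × Bool),
      (ρ (FreeGroup.of i) x).1 = proj F E (FreeGroup.of i) * x.1 := by
    intro i x
    by_cases h : (i : ℕ) ∈ E
    · simp [ρ, proj, h]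
    · simp only [ρ, proj, FreeGroup.lift_apply_of, h, dite_false, one_mul]
      rw [Equiv.swap_apply_def]
      split_ifs with h1 h2
      · rw [h1]
      · rw [h2]
      · rfl
  have hfst : ∀ (g : FreeOn F) (x : FreeOn E × Bool), (ρ g x).1 = proj F E g * x.1 := by
    intro g
    induction g using FreeGroup.induction_on with
    | C1 => simp
    | of i => exact hgen i
    | inv_of i _ =>
      intro x
      have h := hgen i (ρ (FreeGroup.of i)⁻¹ x)
      rw [← Equiv.Perm.mul_apply, ← map_mul, mul_inv_cancel, map_one, Equiv.Perm.one_apply] at h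
      rw [h, map_inv (proj F E), inv_mul_cancel_left]
    | mul a b ha hb =>
      intro x
      rw [map_mul, Equiv.Perm.mul_apply, ha, hb, map_mul, mul_assoc]
  by_contra hne
  have h1 := congrArg (fun g => ρ g (1, true)) hV.eq
  simp only [map_mul, Equiv.Perm.mul_apply, hρk] at h1
  rw [Equiv.swap_apply_left, Equiv.swap_apply_of_ne_of_ne] at h1
  · simpa using (ρ V).injective h1
  · intro h
    have := hfst V (1, true)
    rw [h] at this
    exact hne (by simpa using this.symm)
  · intro h
    have := hfst V (1, true)
    rw [h] at this
    exact hne (by simpa using this.symm)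

/-- The configuration `0, …, n - 1`. -/
def base (n : ℕ) : Config (Fin n) :=
  ⟨fun i => ((i : ℕ) : ℂ), fun _ _ h => Fin.ext (Nat.cast_injective h)⟩

theorem range_base (n : ℕ) : range (base n).1 = punct (Finset.range n) := by
  ext z
  simp only [punct, mem_range, mem_image, Finset.coe_range, mem_Iio, base]
  exact ⟨fun ⟨i, h⟩ => ⟨i, i.2, h⟩, fun ⟨i, h, h'⟩ => ⟨⟨i, h⟩, h'⟩⟩

theorem base_last (n : ℕ) : (base (n + 1)).1 (Fin.last n) = (n : ℂ) := rfl

/-- If only the last string moves, and the action is trivial, then it moves in a contractible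
loop. -/
theorem homOff_refl_of_act {n : ℕ} {q : Path (base (n + 1)) (base (n + 1))}
    (hq : Act q (MonoidHom.id (FreeOn (Finset.range (n + 1)))))
    (hinit : ∀ t, (q t).init = base n) {γ : Path (n : ℂ) n}
    (hγ : ∀ t, (q t).1 (Fin.last n) = γ t) :
    HomOff (punct (Finset.range n)) γ (Path.refl (n : ℂ)) := by
  set E := Finset.range (n + 1)
  set E₀ := Finset.range n
  have hu := range_base (n + 1)
  have hmem : n ∈ E := Finset.self_mem_range_succ n
  have hsub : E₀ ⊆ E := Finset.range_mono n.le_succ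
  obtain ⟨ε, hε, hε2, hav, hd⟩ :=
    exists_drag q (Fin.last n) (base_last n) (base_last n) hu
  obtain ⟨R, ⟨hR, hq⟩, T, τ, T0, T1, T2, T3, T4, hm⟩ :=
    (((eventually_farBase q hu hu).and hq).and hd).exists
  have hstr : ∀ t z, z ∈ punct E₀ → ∃ i : Fin n, (q t).1 i.castSucc = z := by
    intro t z hz
    rw [← range_base] at hz
    obtain ⟨i, hi⟩ := hz
    refine ⟨i, ?_⟩
    rw [← hi, ← hinit t]
    rfl
  have hTE : ∀ p, T p ∉ punct E₀ := by
    rintro ⟨s, t⟩ h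
    obtain ⟨i, hi⟩ := hstr t _ h
    exact T4 s t _ hi.symm
  have hQE : ∀ r t : I, γ t + (r : ℝ) * offset ε ∉ punct E₀ := by
    intro r t h
    obtain ⟨i, hi⟩ := hstr t _ h
    rw [← hγ] at hi
    exact hav r t i.castSucc (Fin.castSucc_lt_last i).ne hi.symm
  have hoγ : Off (punct E₀) γ := fun t h => hQE 0 t (by simpa using h)
  have hτ : Off (punct E) τ := by
    intro s h
    rw [← hu] at h
    obtain ⟨j, hj⟩ := h
    have h' := T4 s 1 j
    rw [T1, q.target] at h'
    exact h' hj.symm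
  have hts := tail_mem_slit E (hR.high.2 n hmem) hε hε2
  have hts₀ := tail_mem_slit E₀ (hR.high.2 n hmem) hε hε2
  have hto : Off (punct E) (tail R n ε) := fun t => slit_subset E (hts t)
  have hto₀ : Off (punct E₀) (tail R n ε) := fun t => slit_subset E₀ (hts₀ t)
  have hτ₀ : Off (punct E₀) τ := hτ.mono (punct_mono hsub)
  -- The lasso around the last string has word `δ_n` before the motion and `V * δ_n * V⁻¹` after it,
  -- where `V` is the word of the dragged tail. The trivial action makes them equal.
  have hV : Commute (pathWord E τ) (FreeGroup.of ⟨n, hmem⟩) := by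
    have h1 := hR.word_eq hu hu hq hm
    rw [pathWord_lasso hto (smallLoop_spec E hε hε2).1, pathWord_of_slit hts,
      (smallLoop_spec E hε hε2).2 hmem, pathWord_lasso hτ (smallLoop_spec E hε hε2).1,
      (smallLoop_spec E hε hε2).2 hmem] at h1
    simp only [MonoidHom.id_apply, one_mul, inv_one, mul_one] at h1
    exact mul_inv_eq_iff_eq_mul.1 h1
  have hV1 : proj E E₀ (pathWord E τ) = 1 :=
    proj_eq_one_of_commute ⟨n, hmem⟩ (by simp [E₀]) hV
  -- Closing the dragged tail by the original one gives a loop, to which forgetting the last point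
  -- applies.
  have hwτ : pathWord E₀ τ = 1 := by
    have h1 := pathWord_of_subset hsub hR.high (hτ.trans hto.symm)
    rw [pathWord_trans hτ₀ hto₀.symm, pathWord_trans hτ hto.symm, pathWord_symm hto,
      pathWord_symm hto₀, pathWord_of_slit hts, pathWord_of_slit hts₀, inv_one, mul_one,
      inv_one, mul_one, hV1] at h1
    exact h1
  let γ' : Path ((n : ℂ) + offset ε) (n + offset ε) :=
    ⟨⟨fun t => γ t + offset ε, by fun_prop⟩, by simp, by simp⟩
  have hoγ' : Off (punct E₀) γ' := fun t => by simpa [γ'] using hQE 1 t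
  have hbase : basePt R ∉ punct E₀ := basePt_notMem hR.high.1 E₀
  -- The moving tail sweeps out a square that avoids the other points. Its sides are the two tails,
  -- the constant path at the base point, and the track `γ'` of the end of the tail.
  have hwγ' : pathWord E₀ γ' = 1 := by
    have h1 := (homOff_of_square T hTE (b := tail R n ε) (r := γ') (l := Path.refl _) (t := τ) T0
      (fun s => by rw [T3, hγ]; rfl) T2 T1).pathWord_eq
    rw [pathWord_trans hto₀ hoγ', pathWord_trans (Off.refl hbase) hτ₀, pathWord_of_slit hts₀,
      pathWord_refl hbase, hwτ, one_mul, one_mul] at h1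
    exact h1
  -- A second square shifts `γ'` back by the offset to `γ`, so the two words are conjugate.
  let Q : C(I × I, ℂ) := ⟨fun p => γ p.2 + ((p.1 : ℝ) : ℂ) * offset ε, by fun_prop⟩
  let d : Path (n : ℂ) (n + offset ε) :=
    ⟨⟨fun s => n + ((s : ℝ) : ℂ) * offset ε, by fun_prop⟩, by simp, by simp⟩
  have hod : Off (punct E₀) d := fun s => by simpa [d] using hQE s 0
  have h1 := (homOff_of_square Q (fun p => hQE p.1 p.2) (b := d) (r := γ') (l := γ) (t := d)
    (fun s => by simp [Q, d]) (fun s => by simp [Q, γ']) (fun s => by simp [Q])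
    (fun s => by simp [Q, d])).pathWord_eq
  rw [pathWord_trans hod hoγ', pathWord_trans hoγ hod, hwγ', mul_one, right_eq_mul] at h1
  refine (homOff_iff_pathWord hoγ (Off.refl ?_)).2 ?_
  · simpa using hoγ 0
  · rw [h1, pathWord_refl]
    simpa using hoγ 0

/-! ### Null-homotopies, one string at a time -/

/-- A null-homotopy of the first `n` strings, for the whole time. -/
structure IsNull {n : ℕ} (p : Path (base n) (base n)) (H : C(I × I, Config (Fin n))) : Prop where
  zero : ∀ t, H (0, t) = p t
  one : ∀ t, H (1, t) = base n
  ends : ∀ s, H (s, 0) = base n ∧ H (s, 1) = base n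

/-- A null-homotopy of the first strings extends to a null-homotopy of strings that act
trivially. -/
theorem exists_lift_isNull {n : ℕ} {p : Path (base (n + 1)) (base (n + 1))}
    (hp : Act p (MonoidHom.id (FreeOn (Finset.range (n + 1)))))
    {p₀ : Path (base n) (base n)} (hp₀ : ∀ t, p₀ t = (p t).init)
    {H : C(I × I, Config (Fin n))} (hH : IsNull p₀ H) :
    ∃ H' : C(I × I, Config (Fin (n + 1))), IsNull p H' ∧ ∀ q, (H' q).init = H q := by
  obtain ⟨G, q, G0, Gs, G1, q1, q2, hpq⟩ :=
    exists_carry_last p H (fun t => (hH.zero t).trans (hp₀ t)) hH.ends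
  let γ : Path (n : ℂ) n := ⟨⟨fun t => G (t, 1), by fun_prop⟩, (Gs 1).1, (Gs 1).2⟩
  obtain ⟨N, N0, N1, Ns, Nav⟩ := homOff_refl_of_act (hp.of_homotopic hpq)
    (fun t => (q1 t).trans (hH.one t)) (γ := γ) q2
  -- The last string first follows the null-homotopy `H` of the others and is then contracted while
  -- they rest. Together this is a homotopy over `H` at double speed followed by a pause.
  obtain ⟨M, hM⟩ := exists_vconcat G N fun t => (N0 t).symm
  -- Deformation of the time scale `min (2 * s) 1` to `s`. Carrying `M` along it restores the
  -- original speed, so that the result restricts exactly to `H`.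
  let φ : C((I × I) × I, ℝ) :=
    ⟨fun x => (1 - (x.2 : ℝ)) * min (2 * (x.1.2 : ℝ)) 1 + x.2 * x.1.2, by fun_prop⟩
  let Φ : C((I × I) × I, I) := ⟨fun x => ⟨φ x, by
    obtain ⟨⟨t, s⟩, r⟩ := x
    have h1 := s.2.1
    have h2 := s.2.2
    have h3 := r.2.1
    have h4 := r.2.2
    have h5 : 0 ≤ min (2 * (s : ℝ)) 1 := by positivity
    have h6 : min (2 * (s : ℝ)) 1 ≤ 1 := min_le_right _ _
    constructor
    · change 0 ≤ (1 - (r : ℝ)) * min (2 * (s : ℝ)) 1 + r * s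
      have : 0 ≤ 1 - (r : ℝ) := by linarith
      positivity
    · change (1 - (r : ℝ)) * min (2 * (s : ℝ)) 1 + r * s ≤ 1
      nlinarith⟩, by fun_prop⟩
  obtain ⟨_, -, hc⟩ := exists_carry (K := I × I) (H.comp ⟨fun x => (Φ x, x.1.1), by fun_prop⟩)
  have hΦ0 : ∀ (t s : I) (h : (s : ℝ) ≤ 1 / 2), Φ ((t, s), 0) =
      ⟨2 * s, (unitInterval.mul_pos_mem_iff zero_lt_two).2 ⟨s.2.1, h⟩⟩ := by
    intro t s h
    ext
    simp only [Φ, φ, ContinuousMap.coe_mk]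
    rw [min_eq_left (by linarith)]
    simp
  have hΦ0' : ∀ t s : I, ¬ (s : ℝ) ≤ 1 / 2 → Φ ((t, s), 0) = 1 := by
    intro t s h
    ext
    simp only [Φ, φ, ContinuousMap.coe_mk]
    rw [min_eq_right (by linarith)]
    simp
  obtain ⟨W, W0, W1, W2, -, -⟩ := hc M fun x i => by
    obtain ⟨t, s⟩ := x
    change M (t, s) ≠ (H (Φ ((t, s), 0), t)).1 i
    rw [hM]
    split_ifs with h
    · rw [hΦ0 t s h]
      exact G1 _ _ _
    · rw [hΦ0' t s h, hH.one]
      intro h'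
      have h1 : (base n).1 i ∈ punct (Finset.range n) := range_base n ▸ mem_range_self i
      rw [← h'] at h1
      exact Nav _ _ h1
  have hΦs0 : ∀ t r, Φ ((t, 0), r) = 0 := fun t r => by ext; simp [Φ, φ]
  have hΦs1 : ∀ t r, Φ ((t, 1), r) = 1 := fun t r => by ext; simp [Φ, φ]
  have hΦ1 : ∀ t s, Φ ((t, s), 1) = s := fun t s => by ext; simp [Φ, φ]
  have M0 : ∀ t, M (t, 0) = (p t).1 (Fin.last n) := by
    intro t
    rw [hM, dif_pos (by simp), ← G0]
    congr 2
    ext; simp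
  have M1 : ∀ t, M (t, 1) = n := by
    intro t
    rw [hM, dif_neg (by norm_num)]
    refine Eq.trans ?_ (N1 t)
    congr 2
    ext; norm_num
  have Ms : ∀ s, M (0, s) = n ∧ M (1, s) = n := by
    intro s
    constructor <;> rw [hM] <;> split_ifs
    · exact (Gs _).1
    · exact (Ns _).1
    · exact (Gs _).2
    · exact (Ns _).2
  obtain ⟨H', hH'⟩ := exists_snoc H (W.comp ⟨fun x : I × I => ((x.2, x.1), 1), by fun_prop⟩)
    fun x i => by
      have := W1 (x.2, x.1) 1 i
      change _ ≠ (H (Φ ((x.2, x.1), 1), x.2)).1 i at this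
      rwa [hΦ1] at this
  have hH'1 : ∀ s t, (H' (s, t)).init = H (s, t) := fun s t => (hH' _).1
  have hH'2 : ∀ s t, (H' (s, t)).1 (Fin.last n) = W ((t, s), 1) := fun s t => (hH' _).2
  refine ⟨H', ⟨fun t => ?_, fun t => ?_, fun s => ⟨?_, ?_⟩⟩, fun q => (hH' q).1⟩
  · refine Config.ext_init ((hH'1 _ _).trans ((hH.zero t).trans (hp₀ t))) ?_
    rw [hH'2, W2 (t, 0), M0]
    intro r
    change H (Φ ((t, 0), r), t) = H (Φ ((t, 0), 0), t)
    rw [hΦs0, hΦs0]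
  · refine Config.ext_init ((hH'1 _ _).trans (hH.one t)) ?_
    rw [hH'2, W2 (t, 1), M1, base_last]
    intro r
    change H (Φ ((t, 1), r), t) = H (Φ ((t, 1), 0), t)
    rw [hΦs1, hΦs1]
  · refine Config.ext_init ((hH'1 _ _).trans (hH.ends s).1) ?_
    rw [hH'2, W2 (0, s), (Ms s).1, base_last]
    intro r
    exact (hH.ends _).1.trans (hH.ends _).1.symm
  · refine Config.ext_init ((hH'1 _ _).trans (hH.ends s).2) ?_
    rw [hH'2, W2 (1, s), (Ms s).2, base_last]
    intro r
    exact (hH.ends _).2.trans (hH.ends _).2.symm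

/-- Forgetting the last string. -/
def initPath {n : ℕ} {u v : Config (Fin (n + 1))} (p : Path u v) : Path u.init v.init :=
  p.map Config.continuous_init

theorem proj_surjective {E F : Finset ℕ} (h : E ⊆ F) : Function.Surjective (proj F E) := by
  intro g
  refine ⟨proj E F g, ?_⟩
  rw [← MonoidHom.comp_apply, proj_comp_proj h, proj_self]
  rfl

theorem Act.init {n : ℕ} {u v : Config (Fin (n + 1))} {p : Path u v} {E E' F F' : Finset ℕ}
    (hu' : range u.init.1 = punct F) (hv' : range v.init.1 = punct F')
    (hF : F ⊆ E) {e : FreeOn E →* FreeOn E'} (he : Act p e)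
    {f : FreeOn F →* FreeOn F'} (hf : (proj E' F').comp e = f.comp (proj E F)) :
    Act (initPath p) f := by
  obtain ⟨f', hf'⟩ := exists_act (initPath p) hu' hv'
  have h := Act.restrict hu' hv' Fin.castSucc (fun t i => rfl) he hf'
  rw [hf] at h
  rwa [(MonoidHom.cancel_right (proj_surjective hF)).1 h]

/-- Finitely many strings that act trivially are null-homotopic. -/
theorem exists_isNull {n : ℕ} {p : Path (base n) (base n)}
    (hp : Act p (MonoidHom.id (FreeOn (Finset.range n)))) : ∃ H, IsNull p H := by
  induction n with
  | zero =>
    have : Subsingleton (Config (Fin 0)) := ⟨fun u v => Subtype.ext (funext fun i => i.elim0)⟩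
    exact ⟨.const _ (base 0), fun t => Subsingleton.elim _ _, fun _ => rfl, fun _ => ⟨rfl, rfl⟩⟩
  | succ n ih =>
    have h : Act (initPath p) (MonoidHom.id (FreeOn (Finset.range n))) :=
      Act.init (u := base (n + 1)) (v := base (n + 1)) (range_base n) (range_base n)
        (Finset.range_mono n.le_succ) hp rfl
    obtain ⟨H, hH⟩ := ih h
    obtain ⟨H', hH₂, -⟩ := exists_lift_isNull hp (p₀ := initPath p) (fun t => rfl) hH
    exact ⟨H', hH₂⟩

/-- Paths of finite configurations with the same action are homotopic. -/
theorem homotopic_of_act {n : ℕ} {v : Config (Fin n)} {E : Finset ℕ} (hv : range v.1 = punct E)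
    {p q : Path (base n) v} {e : FreeOn (Finset.range n) ≃* FreeOn E}
    (hp : Act p e.toMonoidHom) (hq : Act q e.toMonoidHom) : p.Homotopic q := by
  -- The closed motion `p` followed by `q` backwards acts trivially, so it is null-homotopic.
  have h := hp.trans (hq.symm (range_base n) hv)
  have he : e.symm.toMonoidHom.comp e.toMonoidHom = MonoidHom.id _ := by ext; simp
  rw [he] at h
  obtain ⟨H, hH⟩ := exists_isNull h
  have h1 : (p.trans q.symm).Homotopic (Path.refl _) :=
    homotopic_of_map H hH.zero hH.one hH.ends
  have h2 : ((p.trans q.symm).trans q).Homotopic ((Path.refl _).trans q) := h1.hcomp (.refl q)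
  refine Path.Homotopic.trans ?_ (h2.trans ⟨Path.Homotopy.reflTrans q⟩)
  refine Path.Homotopic.trans ?_ (Path.Homotopic.symm ⟨Path.Homotopy.transAssoc p q.symm q⟩)
  refine Path.Homotopic.trans ⟨(Path.Homotopy.transRefl p).symm⟩ ?_
  exact (Path.Homotopic.refl p).hcomp ⟨Path.Homotopy.reflSymmTrans q⟩

/-! ### Passage to infinitely many strings -/

/-- The first `n` points of a sequence. -/
def Config.first (n : ℕ) (u : Config ℕ) : Config (Fin n) := u.sub Fin.valEmbedding

theorem Config.continuous_first (n : ℕ) : Continuous (Config.first n) := Config.continuous_sub _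

/-- The first `n` strings. -/
def firstPath (n : ℕ) {u v : Config ℕ} (p : Path u v) : Path (u.first n) (v.first n) :=
  p.map (Config.continuous_first n)

/-- A coherent family of maps to configuration spaces defines a map to sequences. -/
theorem exists_of_coherent {X : Type*} [TopologicalSpace X] (H : ∀ n, C(X, Config (Fin n)))
    (h : ∀ n x, (H (n + 1) x).init = H n x) :
    ∃ F : C(X, Config ℕ), ∀ n x, (F x).first n = H n x := by
  have hco : ∀ x i d, (H (i + 1 + d) x).1 ⟨i, by omega⟩ = (H (i + 1) x).1 (Fin.last i) := by
    intro x i d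
    induction d with
    | zero => rfl
    | succ d ih =>
      rw [← ih, ← h (i + 1 + d) x]
      rfl
  have hco' : ∀ x i n (hi : i < n), (H (i + 1) x).1 (Fin.last i) = (H n x).1 ⟨i, hi⟩ := by
    intro x i n hi
    obtain ⟨d, rfl⟩ := Nat.exists_eq_add_of_le hi
    exact (hco x i d).symm
  have hinj : ∀ x, Function.Injective fun i => (H (i + 1) x).1 (Fin.last i) := by
    intro x i j hij
    dsimp only at hij
    rw [hco' x i (max i j + 1) (by omega), hco' x j (max i j + 1) (by omega)] at hij
    exact congrArg Fin.val ((H _ x).2 hij)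
  have hc : Continuous fun x (i : ℕ) => (H (i + 1) x).1 (Fin.last i) :=
    continuous_pi fun i => (continuous_apply _).comp
      (continuous_subtype_val.comp (H (i + 1)).continuous)
  refine ⟨⟨fun x => ⟨_, hinj x⟩, hc.subtype_mk _⟩, fun n x => ?_⟩
  apply Subtype.ext
  funext i
  exact hco' x i n i.2

theorem Config.ext_first {u v : Config ℕ} (h : ∀ n, u.first n = v.first n) : u = v := by
  apply Subtype.ext
  funext i
  exact congrFun (congrArg Subtype.val (h (i + 1))) (Fin.last i)

/-- A sequence of strings that acts trivially is null-homotopic. -/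
theorem homotopic_refl_of_act {p : Path omega omega}
    (hp : ∀ n, Act (firstPath n p) (MonoidHom.id (FreeOn (Finset.range n)))) :
    p.Homotopic (Path.refl omega) := by
  -- Each null-homotopy is chosen as a strict extension of the previous one. Only then do they
  -- define a homotopy of sequences.
  let N : ℕ → Type := fun n => {H : C(I × I, Config (Fin n)) // IsNull (firstPath n p) H}
  have hstep : ∀ n (H : N n), ∃ H' : N (n + 1), ∀ x, (H'.1 x).init = H.1 x := by
    intro n H
    obtain ⟨H', h1, h2⟩ := exists_lift_isNull (hp (n + 1)) (p₀ := firstPath n p) (fun t => rfl) H.2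
    exact ⟨⟨H', h1⟩, h2⟩
  choose next hnext using hstep
  obtain ⟨H₀, hH₀⟩ := exists_isNull (hp 0)
  let S : ∀ n, N n := fun n => Nat.rec ⟨H₀, hH₀⟩ (fun n H => next n H) n
  obtain ⟨F, hF⟩ := exists_of_coherent (fun n => (S n).1) fun n x => hnext n (S n) x
  refine homotopic_of_map F (fun t => ?_) (fun t => ?_) fun s => ⟨?_, ?_⟩ <;>
    refine Config.ext_first fun n => ?_ <;> rw [hF]
  · exact (S n).2.zero t
  · exact (S n).2.one t
  · exact ((S n).2.ends s).1
  · exact ((S n).2.ends s).2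

/-! ### Hurwitz moves -/

/-! ### Cancellation in reduced words -/

section Words

open FreeGroup

variable {α : Type*} [DecidableEq α]

theorem isReduced_invRev {L : List (α × Bool)} : IsReduced (invRev L) ↔ IsReduced L := by
  rw [isReduced_iff_reduce_eq, isReduced_iff_reduce_eq, reduce_invRev]
  exact invRev_injective.eq_iff

/-- The letter `a` does not cancel against the beginning of `g`. -/
def Joins (a : α × Bool) (g : FreeGroup α) : Prop := IsReduced (a :: g.toWord)

/-- If `a` cancels, then the reduced word of `g` begins with the inverse letter, and `d` is what
remains. The last clause records that this splitting of `g` is itself without cancellation. -/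
theorem joins_or (a : α × Bool) (g : FreeGroup α) :
    Joins a g ∨ ∃ d, g = mk [(a.1, !a.2)] * d ∧ norm g = norm d + 1 ∧ Joins (a.1, !a.2) d := by
  unfold Joins
  rcases hg : g.toWord with - | ⟨c, L⟩
  · exact .inl IsReduced.singleton
  · have hred : IsReduced (c :: L) := hg ▸ isReduced_toWord
    by_cases hc : a.1 = c.1 → a.2 = c.2
    · exact .inl (isReduced_cons_cons.2 ⟨hc, hred⟩)
    · right
      have hc' : c = (a.1, !a.2) := by
        push Not at hc
        refine Prod.ext hc.1.symm ?_
        exact Bool.eq_not.2 hc.2.symm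
      have hL : (mk L).toWord = L := by
        rw [toWord_mk]
        exact (hred.infix (List.infix_cons List.infix_rfl)).reduce_eq
      refine ⟨mk L, ?_, ?_, ?_⟩
      · rw [← mk_toWord (x := g), hg, mul_mk, hc']
        rfl
      · rw [FreeGroup.norm, FreeGroup.norm, hg, hL]
        rfl
      · rw [hL, ← hc']
        exact hred

theorem isReduced_append_of_joins_inv {a : α × Bool} {g : FreeGroup α}
    (h : Joins (a.1, !a.2) g⁻¹) : IsReduced (g.toWord ++ [a]) := by
  rw [← isReduced_invRev]
  rw [Joins, toWord_inv] at h
  simpa [invRev] using h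

theorem toWord_mul_mk_mul {a : α × Bool} {g d : FreeGroup α} (h : IsReduced (g.toWord ++ [a]))
    (h' : Joins a d) : (g * mk [a] * d).toWord = g.toWord ++ a :: d.toWord := by
  have hred : IsReduced (g.toWord ++ a :: d.toWord) := List.isChain_split.2 ⟨h, h'⟩
  rw [← hred.reduce_eq, ← toWord_mk]
  congr 1
  nth_rw 1 [← mk_toWord (x := g), ← mk_toWord (x := d)]
  simp [mul_mk]

theorem norm_inv_mul_mk_mul {x : α} {b : Bool} {d g : FreeGroup α} (hd : Joins (x, !b) d)
    (hg : Joins (x, b) g) : norm (d⁻¹ * mk [(x, b)] * g) = norm d + 1 + norm g := by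
  rw [FreeGroup.norm, toWord_mul_mk_mul (isReduced_append_of_joins_inv (by simpa using hd)) hg,
    List.length_append, List.length_cons, ← FreeGroup.norm, ← FreeGroup.norm,
    norm_inv_eq]
  ring

theorem toWord_prod_of (L : List α) : ((L.map of).prod).toWord = L.map fun x => (x, true) := by
  have h1 : (L.map of).prod = mk (L.map fun x => (x, true)) := by
    induction L with
    | nil => rfl
    | cons x L ih =>
      rw [List.map_cons, List.prod_cons, ih, List.map_cons]
      rfl
  rw [h1, toWord_mk]
  refine IsReduced.reduce_eq (List.Pairwise.isChain ?_)
  rw [List.pairwise_map]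
  exact List.pairwise_of_forall fun _ _ _ => rfl

end Words

section Hurwitz

open FreeGroup

variable {G : Type*} [Group G]

/-- The elementary transformation `(y_i, y_{i+1}) ↦ (y_i y_{i+1} y_i⁻¹, y_i)`. -/
def hurwitz (i : ℕ) (y : ℕ → G) : ℕ → G :=
  fun j => if j = i then y i * y (i + 1) * (y i)⁻¹ else if j = i + 1 then y i else y j

/-- The elementary transformation `(y_i, y_{i+1}) ↦ (y_{i+1}, y_{i+1}⁻¹ y_i y_{i+1})`. -/
def hurwitzInv (i : ℕ) (y : ℕ → G) : ℕ → G :=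
  fun j => if j = i then y (i + 1) else if j = i + 1 then (y (i + 1))⁻¹ * y i * y (i + 1) else y j

theorem hurwitzInv_hurwitz (i : ℕ) (y : ℕ → G) : hurwitzInv i (hurwitz i y) = y := by
  funext j
  by_cases h1 : j = i
  · simp [hurwitzInv, hurwitz, h1]
  by_cases h2 : j = i + 1
  · simp [hurwitzInv, hurwitz, h2, mul_assoc]
  · simp [hurwitzInv, hurwitz, h1, h2]

theorem hurwitz_hurwitzInv (i : ℕ) (y : ℕ → G) : hurwitz i (hurwitzInv i y) = y := by
  funext j
  by_cases h1 : j = i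
  · simp [hurwitzInv, hurwitz, h1, mul_assoc]
  by_cases h2 : j = i + 1
  · simp [hurwitzInv, hurwitz, h2]
  · simp [hurwitzInv, hurwitz, h1, h2]

theorem prod_range_congr {y z : ℕ → G} {n i : ℕ} (hi : i + 1 < n)
    (hj : ∀ j, j ≠ i → j ≠ i + 1 → z j = y j) (h : z i * z (i + 1) = y i * y (i + 1)) :
    ((List.range n).map z).prod = ((List.range n).map y).prod := by
  induction n with
  | zero => omega
  | succ m ih =>
    rw [List.range_succ, List.map_append, List.map_append, List.prod_append, List.prod_append]
    by_cases hm : i + 1 < m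
    · rw [ih hm]
      simp [hj m (by omega) (by omega)]
    · obtain rfl : m = i + 1 := by omega
      have hlt : (List.range i).map z = (List.range i).map y := by
        refine List.map_congr_left fun j hj' => ?_
        rw [List.mem_range] at hj'
        exact hj j (by omega) (by omega)
      rw [List.range_succ, List.map_append, List.map_append, List.prod_append, List.prod_append,
        hlt]
      simp [mul_assoc, h]

theorem sum_range_lt {f g : ℕ → ℕ} {n i : ℕ} (hi : i + 1 < n)
    (hj : ∀ j, j ≠ i → j ≠ i + 1 → g j = f j) (h : g i + g (i + 1) < f i + f (i + 1)) :
    ∑ j ∈ Finset.range n, g j < ∑ j ∈ Finset.range n, f j := by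
  have h1 : i ∈ Finset.range n := Finset.mem_range.2 (by omega)
  have h2 : i + 1 ∈ (Finset.range n).erase i := by simp; omega
  rw [← Finset.add_sum_erase _ _ h1, ← Finset.add_sum_erase _ _ h1, ← Finset.add_sum_erase _ _ h2,
    ← Finset.add_sum_erase _ _ h2]
  have h3 : ∑ j ∈ ((Finset.range n).erase i).erase (i + 1), g j =
      ∑ j ∈ ((Finset.range n).erase i).erase (i + 1), f j := by
    refine Finset.sum_congr rfl fun j hj' => ?_
    simp only [Finset.mem_erase] at hj'
    exact hj j hj'.2.1 hj'.1
  omega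

theorem conj_mk_mul {α : Type*} (x : α) (b : Bool) (d : FreeGroup α) :
    (mk [(x, b)] * d)⁻¹ * of x * (mk [(x, b)] * d) = d⁻¹ * of x * d := by
  have h1 : (mk [(x, true)] : FreeGroup α) = of x := rfl
  have h2 : (mk [(x, false)] : FreeGroup α) = (of x)⁻¹ := rfl
  cases b
  · rw [h2]; group
  · rw [h1]; group

/-- Conjugates of generators whose product is reduced as it stands are generators. -/
theorem eq_one_of_joins {E : Finset ℕ} {W : ℕ → FreeOn E} {ν : ℕ → E}
    (hn : ((List.range E.card).map fun i => (W i)⁻¹ * of (ν i) * W i).prod = orderedProd E)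
    (hW : W E.card = 1) (h0 : ∀ i < E.card, ∀ b, Joins (ν i, b) (W i))
    (h1 : ∀ i, i + 1 < E.card → Joins (ν i, true) (W i * (W (i + 1))⁻¹))
    (h2 : ∀ i, i + 1 < E.card → Joins (ν (i + 1), false) (W i * (W (i + 1))⁻¹)⁻¹) :
    ∀ i ≤ E.card, W i = 1 := by
  set n := E.card with hcard
  -- The product reads `(W 0)⁻¹ ν_0 C_0 ν_1 C_1 ⋯`, and `T k` is the word of its beginning. The
  -- convention `W n = 1` makes the last `C` equal to the last conjugator.
  let C : ℕ → FreeOn E := fun i => W i * (W (i + 1))⁻¹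
  let T : ℕ → List (E × Bool) := fun k => Nat.rec ((W 0)⁻¹).toWord
    (fun k L => L ++ (ν k, true) :: (C k).toWord) k
  have T0 : T 0 = ((W 0)⁻¹).toWord := rfl
  have Ts : ∀ k, T (k + 1) = T k ++ (ν k, true) :: (C k).toWord := fun k => rfl
  have hmk : ∀ k, mk (T k) = ((List.range k).map fun i => (W i)⁻¹ * of (ν i) * W i).prod *
      (W k)⁻¹ := by
    intro k
    induction k with
    | zero => rw [T0, mk_toWord]; simp
    | succ k ih =>
      rw [Ts, ← mul_mk, ih, List.range_succ, List.map_append, List.prod_append]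
      have h : (mk ((ν k, true) :: (C k).toWord) : FreeOn E) = of (ν k) * C k := by
        conv_rhs => rw [← mk_toWord (x := C k)]
        rfl
      rw [h]
      simp [C, mul_assoc]
  have hlen : ∀ k, k + (norm (W 0)⁻¹ + ∑ i ∈ Finset.range k, norm (C i)) = (T k).length := by
    intro k
    induction k with
    | zero => rw [T0]; simp [FreeGroup.norm]
    | succ k ih =>
      rw [Ts, List.length_append, ← ih, List.length_cons, Finset.sum_range_succ]
      simp only [FreeGroup.norm]
      ring
  have hC : ∀ k < n, Joins (ν k, true) (C k) := by
    intro k hk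
    by_cases hk' : k + 1 < n
    · exact h1 k hk'
    · have : k + 1 = n := by omega
      simp only [C, this, hW, inv_one, mul_one]
      exact h0 k hk true
  have hred : ∀ k < n, IsReduced (T k ++ [(ν k, true)]) := by
    intro k
    induction k with
    | zero =>
      intro hk
      rw [T0]
      refine isReduced_append_of_joins_inv ?_
      rw [inv_inv]
      exact h0 0 hk _
    | succ k ih =>
      intro hk
      rw [Ts, List.append_assoc]
      refine List.isChain_split.2 ⟨ih (by omega), ?_⟩
      -- With nothing in between, the neighbours `ν k` and `ν (k + 1)` are both positive letters and
      -- cannot cancel.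
      by_cases hc : (C k).toWord = []
      · rw [hc]
        simp
      · have h3 : IsReduced ((C k).toWord ++ [(ν (k + 1), true)]) :=
          isReduced_append_of_joins_inv (h2 k hk)
        have h4 : IsReduced ([(ν k, true)] ++ (C k).toWord) := hC k (by omega)
        exact h4.append_overlap h3 hc
  have hTn : IsReduced (T n) := by
    rcases hn0 : n with - | m
    · rw [T0]; exact isReduced_toWord
    · rw [Ts]
      exact List.isChain_split.2 ⟨hred m (by omega), hC m (by omega)⟩
  have hword : T n = (orderedProd E).toWord := by
    have := hmk n
    rw [hn, hW, inv_one, mul_one] at this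
    rw [← this, toWord_mk, hTn.reduce_eq]
  -- The reduced word has length `n` plus the lengths of `(W 0)⁻¹` and of all `C i`, but
  -- `orderedProd E` has length `n`. So all of these are trivial.
  have hl := hlen n
  rw [hword, orderedProd, toWord_prod_of, List.length_map, Finset.length_sort, Finset.card_univ,
    Fintype.card_coe, ← hcard] at hl
  have hW0 : W 0 = 1 := by
    have : norm (W 0)⁻¹ = 0 := by omega
    simpa using this
  have hC0 : ∀ i < n, C i = 1 := by
    intro i hi
    have h5 : ∑ i ∈ Finset.range n, norm (C i) = 0 := by omega
    rw [Finset.sum_eq_zero_iff] at h5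
    exact norm_eq_zero.1 (h5 i (Finset.mem_range.2 hi))
  intro i
  induction i with
  | zero => exact fun _ => hW0
  | succ i ih =>
    intro hi
    have := hC0 i hi
    simp only [C, ih (by omega), one_mul, inv_eq_one] at this
    exact this

/-- Systems of conjugates of generators with the right product are obtained from increasing
systems of generators by elementary transformations. -/
theorem hurwitz_induction {E : Finset ℕ} {P : (ℕ → FreeOn E) → Prop}
    (hbase : ∀ (y : ℕ → FreeOn E) (ν : ℕ → E), (∀ i j, i < j → j < E.card → ν i < ν j) →
      (∀ i < E.card, y i = of (ν i)) → P y)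
    (h1 : ∀ y i, i + 1 < E.card → P y → P (hurwitz i y))
    (h2 : ∀ y i, i + 1 < E.card → P y → P (hurwitzInv i y))
    (y W : ℕ → FreeOn E) (ν : ℕ → E) (hW : W E.card = 1)
    (hy : ∀ i < E.card, y i = (W i)⁻¹ * of (ν i) * W i)
    (hprod : ((List.range E.card).map y).prod = orderedProd E) : P y := by
  -- Induction on the total length of the conjugators.
  obtain ⟨N, hN⟩ : ∃ N, ∑ i ∈ Finset.range E.card, norm (W i) = N := ⟨_, rfl⟩
  induction N using Nat.strong_induction_on generalizing y W ν with
  | _ N ih =>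
  subst hN
  -- A conjugator that begins with a power of its own generator can be shortened without changing
  -- `y`.
  by_cases c1 : ∃ i < E.card, ∃ b, ¬ Joins (ν i, b) (W i)
  · obtain ⟨i, hi, b, hb⟩ := c1
    obtain ⟨d, hd, hd', -⟩ := (joins_or _ _).resolve_left hb
    refine ih _ ?_ y (Function.update W i d) ν ?_ (fun j hj => ?_) hprod rfl
    · refine Finset.sum_lt_sum (fun j _ => ?_) ⟨i, Finset.mem_range.2 hi, ?_⟩
      · by_cases h : j = i
        · subst h; simp [hd']
        · simp [h]
      · simp [hd']
    · rw [Function.update_of_ne (by omega)]; exact hW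
    · by_cases h : j = i
      · subst h
        rw [hy j hj, hd, Function.update_self]
        exact conj_mk_mul _ _ _
      · rw [Function.update_of_ne h]; exact hy j hj
  push Not at c1
  -- If `ν i` cancels against the next conjugators, then `W (i + 1)` is the longer one and equals
  -- `d⁻¹ * ν_i * W i` without cancellation. After `hurwitz i` the two conjugators are `d⁻¹ * W i`
  -- and `W i`, which are shorter in total.
  by_cases c2 : ∃ i, i + 1 < E.card ∧ ¬ Joins (ν i, true) (W i * (W (i + 1))⁻¹)
  · obtain ⟨i, hi, hb⟩ := c2
    obtain ⟨d, hd, -, hjd⟩ := (joins_or _ _).resolve_left hb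
    have hW1 : W (i + 1) = d⁻¹ * mk [(ν i, true)] * W i := by
      have : (mk [(ν i, true)] : FreeOn E) = (mk [(ν i, false)])⁻¹ := by simp [inv_mk, invRev]
      rw [this, ← mul_inv_rev]
      simp only [Bool.not_true] at hd
      rw [← hd]
      group
    have hnorm : norm (W (i + 1)) = norm d + 1 + norm (W i) := by
      rw [hW1]
      exact norm_inv_mul_mk_mul hjd (c1 i (by omega) true)
    rw [← hurwitzInv_hurwitz i y]
    refine h2 _ i hi (ih _ ?_ _
      (fun j => if j = i then d⁻¹ * W i else if j = i + 1 then W i else W j)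
      (fun j => if j = i then ν (i + 1) else if j = i + 1 then ν i else ν j) ?_ (fun j hj => ?_)
      ?_ rfl)
    · refine sum_range_lt hi (fun j h h' => by simp [h, h']) ?_
      have := norm_mul_le d⁻¹ (W i)
      rw [norm_inv_eq] at this
      simp
      omega
    · rw [if_neg (by omega), if_neg (by omega)]; exact hW
    · by_cases h : j = i
      · subst h
        have : (mk [(ν j, true)] : FreeOn E) = of (ν j) := rfl
        rw [hurwitz, if_pos rfl, hy j hj, hy (j + 1) hi, hW1, this]
        simp only [if_true]
        group
      · by_cases h' : j = i + 1
        · subst h'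
          simp [hurwitz, hy i (by omega)]
        · simp [hurwitz, h, h', hy j hj]
    · rw [← hprod]
      exact prod_range_congr hi (fun j h h' => by simp [hurwitz, h, h']) (by simp [hurwitz])
  push Not at c2
  -- The mirror image of the previous case: now `W i` is the longer one, and `hurwitzInv i`
  -- shortens.
  by_cases c3 : ∃ i, i + 1 < E.card ∧ ¬ Joins (ν (i + 1), false) (W i * (W (i + 1))⁻¹)⁻¹
  · obtain ⟨i, hi, hb⟩ := c3
    obtain ⟨d, hd, -, hjd⟩ := (joins_or _ _).resolve_left hb
    have hW1 : W i = d⁻¹ * mk [(ν (i + 1), false)] * W (i + 1) := by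
      have : (mk [(ν (i + 1), false)] : FreeOn E) = (mk [(ν (i + 1), true)])⁻¹ := by
        simp [inv_mk, invRev]
      rw [this, ← mul_inv_rev]
      simp only [Bool.not_false] at hd
      rw [← hd]
      group
    have hnorm : norm (W i) = norm d + 1 + norm (W (i + 1)) := by
      rw [hW1]
      exact norm_inv_mul_mk_mul hjd (c1 (i + 1) hi false)
    rw [← hurwitz_hurwitzInv i y]
    refine h1 _ i hi (ih _ ?_ _
      (fun j => if j = i then W (i + 1) else if j = i + 1 then d⁻¹ * W (i + 1) else W j)
      (fun j => if j = i then ν (i + 1) else if j = i + 1 then ν i else ν j) ?_ (fun j hj => ?_)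
      ?_ rfl)
    · refine sum_range_lt hi (fun j h h' => by simp [h, h']) ?_
      have := norm_mul_le d⁻¹ (W (i + 1))
      rw [norm_inv_eq] at this
      simp
      omega
    · rw [if_neg (by omega), if_neg (by omega)]; exact hW
    · by_cases h : j = i
      · subst h
        simp [hurwitzInv, hy (j + 1) hi]
      · by_cases h' : j = i + 1
        · subst h'
          have : (mk [(ν (i + 1), false)] : FreeOn E) = (of (ν (i + 1)))⁻¹ := rfl
          rw [hurwitzInv, if_neg (by omega), if_pos rfl, hy i (by omega), hy (i + 1) hi, hW1, this]
          simp only [if_true, if_neg h]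
          group
        · simp [hurwitzInv, h, h', hy j hj]
    · rw [← hprod]
      exact prod_range_congr hi (fun j h h' => by simp [hurwitzInv, h, h'])
        (by simp [hurwitzInv, mul_assoc])
  push Not at c3
  have hmap : (List.range E.card).map y =
      (List.range E.card).map fun i => (W i)⁻¹ * of (ν i) * W i :=
    List.map_congr_left fun i hi => hy i (List.mem_range.1 hi)
  have hW1 := eq_one_of_joins (hmap ▸ hprod) hW c1 c2 c3
  have hy1 : ∀ i < E.card, y i = of (ν i) := by
    intro i hi
    rw [hy i hi, hW1 i hi.le]
    group
  refine hbase y ν ?_ hy1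
  -- With trivial conjugators both sides are positive words. Equal words have equal letters, so `ν`
  -- enumerates `E` in increasing order.
  have hlist : (List.range E.card).map ν = (Finset.univ : Finset E).sort (· ≤ ·) := by
    have h3 : (List.range E.card).map y = ((List.range E.card).map ν).map of := by
      rw [List.map_map]
      exact List.map_congr_left fun i hi => hy1 i (List.mem_range.1 hi)
    rw [h3, orderedProd] at hprod
    have h4 := congrArg toWord hprod
    rw [toWord_prod_of, toWord_prod_of] at h4
    exact List.map_injective_iff.2 (fun a b h => (Prod.ext_iff.1 h).1) h4
  have hs := Finset.sortedLT_sort (Finset.univ : Finset E)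
  rw [← hlist] at hs
  intro i j hij hj
  have := List.pairwise_iff_getElem.1 hs.pairwise i j (by simp; omega) (by simpa using hj) hij
  simpa using this

end Hurwitz

/-! ### Elementary motions of finite configurations -/

section Motions

/-- The triangles between two generating loops. -/
theorem slide_spec {R M : ℝ} (hR : 13 * (M + 1) ≤ R) {k m : ℕ} (hk : k ≤ M) (hm : m ≤ M)
    (s t : I) {z : ℂ} (hz : z = (1 - (t : ℝ) : ℝ) * genLoop R k s + (t : ℝ) * genLoop R m s)
    {x : ℝ} (hx : x = (1 - (t : ℝ)) * k + t * m) (him : z.im ≤ 1) :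
    (z.im = -1 / 2 ∧ |z.re - x| ≤ 1 / 2) ∨
      (-1 / 2 ≤ z.im ∧ 3 / 8 < |z.re - x| ∧ |z.re - x| < 5 / 8) := by
  have ht0 := t.2.1
  have ht1 := t.2.2
  have hx0 : 0 ≤ x := by
    rw [hx]
    have : 0 ≤ 1 - (t : ℝ) := by linarith
    positivity
  have hxM : x ≤ M := by rw [hx]; nlinarith
  have hzre : z.re = (1 - (t : ℝ)) * (genLoop R k s).re + t * (genLoop R m s).re := by
    rw [hz]; simp
  have hzim : z.im = (1 - (t : ℝ)) * (genLoop R k s).im + t * (genLoop R m s).im := by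
    rw [hz]; simp
  -- a point on one of the two upper sides
  have side : ∀ l ε : ℝ, 0 ≤ l → l ≤ 1 → |ε| = 1 / 2 → z.re = l * (x + ε) →
      z.im = (1 - l) * R - l / 2 →
      (-1 / 2 ≤ z.im ∧ 3 / 8 < |z.re - x| ∧ |z.re - x| < 5 / 8) := by
    intro l ε hl0 hl1 hε hre him'
    -- Height at most `1` bounds the remaining fraction `1 - l` of the side. With the factor `13`
    -- the horizontal deviation is at most `3 / 26 < 1 / 8`, hence the bounds `3 / 8` and `5 / 8`
    -- around `1 / 2`.
    have h1 : (1 - l) * (R + 1 / 2) ≤ 3 / 2 := by linarith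
    have h2 : (1 - l) * (13 * (M + 1)) ≤ (1 - l) * R :=
      mul_le_mul_of_nonneg_left hR (by linarith)
    have h3 : (1 - l) * (M + 1) ≤ 3 / 26 := by linarith
    have hε' : ε ≤ 1 / 2 ∧ -(1 / 2) ≤ ε := ⟨hε ▸ le_abs_self _, by rw [← hε]; exact neg_abs_le _⟩
    have h4 : (1 - l) * (x + ε) ≤ 3 / 26 :=
      (mul_le_mul_of_nonneg_left (by linarith) (by linarith)).trans h3
    have h5 : -(3 / 26) ≤ (1 - l) * (x + ε) := by
      have : (1 - l) * (-(M + 1)) ≤ (1 - l) * (x + ε) :=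
        mul_le_mul_of_nonneg_left (by linarith) (by linarith)
      linarith
    have h6 : z.re - x = ε - (1 - l) * (x + ε) := by rw [hre]; ring
    refine ⟨?_, ?_⟩
    · rw [him']
      have : 0 ≤ (1 - l) * R := mul_nonneg (by linarith) (by linarith)
      linarith
    · rw [h6]
      rcases abs_eq (by norm_num) |>.1 hε with h | h
      · rw [abs_of_pos (by linarith)]
        constructor <;> linarith
      · rw [abs_of_neg (by linarith)]
        constructor <;> linarith
  rw [genLoop_eq, genLoop_eq, Path.trans_apply, Path.trans_apply] at hzre hzim
  split_ifs at hzre hzim with h1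
  · rw [Path.trans_apply, Path.trans_apply] at hzre hzim
    split_ifs at hzre hzim with h2
    · right
      rw [segment_re, segment_re, basePt_re, lowerLeft_re, lowerLeft_re] at hzre
      rw [segment_im, segment_im, basePt_im, lowerLeft_im, lowerLeft_im] at hzim
      refine side (2 * (2 * (s : ℝ))) (-1 / 2) ?_ ?_ (by rw [abs_of_neg] <;> norm_num)
        (hzre.trans ?_) (hzim.trans ?_)
      · have := s.2.1
        linarith
      · change 2 * (s : ℝ) ≤ 1 / 2 at h2
        linarith
      · rw [hx]; ring
      · ring
    · left
      rw [segment_re, segment_re, lowerLeft_re, lowerLeft_re, lowerRight_re, lowerRight_re] at hzre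
      rw [segment_im, segment_im, lowerLeft_im, lowerLeft_im, lowerRight_im, lowerRight_im] at hzim
      constructor
      · rw [hzim]; ring
      · rw [abs_le, hzre, hx]
        simp only
        constructor <;> linarith
  · right
    rw [segment_re, segment_re, basePt_re, lowerRight_re, lowerRight_re] at hzre
    rw [segment_im, segment_im, basePt_im, lowerRight_im, lowerRight_im] at hzim
    refine side (1 - (2 * (s : ℝ) - 1)) (1 / 2) ?_ ?_ (by rw [abs_of_pos]; norm_num)
      (hzre.trans ?_) (hzim.trans ?_)
    · have := s.2.2
      linarith
    · linarith
    · rw [hx]; ring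
    · ring

theorem exists_path {ι : Type*} {u v : Config ι} (F : I → ι → ℂ)
    (hc : ∀ i, Continuous fun t => F t i) (hinj : ∀ t, Function.Injective (F t))
    (h0 : ∀ i, F 0 i = u.1 i) (h1 : ∀ i, F 1 i = v.1 i) :
    ∃ p : Path u v, ∀ t i, (p t).1 i = F t i :=
  ⟨⟨⟨fun t => ⟨F t, hinj t⟩, (continuous_pi hc).subtype_mk _⟩, Subtype.ext (funext h0),
    Subtype.ext (funext h1)⟩, fun _ _ => rfl⟩

theorem Act.comp_strings {ι κ : Type*} {u v : Config ι} {p : Path u v} {u' v' : Config κ}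
    {p' : Path u' v'} {E E' : Finset ℕ} {e : FreeOn E →* FreeOn E'} (h : Act p e) (r : κ → ι)
    (hr : ∀ t i, (p' t).1 i = (p t).1 (r i)) : Act p' e := by
  filter_upwards [h] with R h g
  exact (h g).map_strings r hr

theorem Act.apply_of {ι : Type*} [Fintype ι] {u v : Config ι} {p : Path u v} {E E' : Finset ℕ}
    (hu : range u.1 = punct E) (hv : range v.1 = punct E') {e : FreeOn E →* FreeOn E'}
    (h : Act p e) (k : E) (m : E')
    (hm : ∀ᶠ R in atTop, Moves p (genLoop R k) (genLoop R m)) :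
    e (FreeGroup.of k) = FreeGroup.of m := by
  obtain ⟨R, ⟨hR, h⟩, hm⟩ := (((eventually_farBase p hu hv).and h).and hm).exists
  have h1 := hR.word_eq hu hv h hm
  rw [pathWord_genLoop E (hR.high.2 k k.2), pathWord_genLoop E' (hR.high'.2 m m.2), letter_coe,
    letter_coe] at h1
  exact h1.symm

/-- A generating loop slides to another one if the triangles in between avoid the strings. -/
theorem moves_slide {ι : Type*} {u v : Config ι} {p : Path u v} {R : ℝ} {k m : ℕ}
    (h : ∀ (s t : I) i, (1 - (t : ℝ) : ℝ) * genLoop R k s + (t : ℝ) * genLoop R m s ≠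
      (p t).1 i) : Moves p (genLoop R k) (genLoop R m) := by
  refine ⟨⟨fun q => (1 - (q.2 : ℝ) : ℝ) * genLoop R k q.1 + (q.2 : ℝ) * genLoop R m q.1,
    by fun_prop⟩, fun s => by simp, fun s => by simp, fun t => ⟨?_, ?_⟩, h⟩
  · simp; ring
  · simp; ring

/-- The increasing motion of `0, …, n - 1` to a finite set. -/
theorem exists_increasing {n : ℕ} {E : Finset ℕ} (ν : ℕ → E)
    (hν : ∀ i j, i < j → j < n → ν i < ν j) (hE : E.card = n) :
    ∃ (v : Config (Fin n)) (p : Path (base n) v) (e : FreeOn (Finset.range n) →* FreeOn E),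
      range v.1 = punct E ∧ Act p e ∧ ∀ i : Finset.range n, e (FreeGroup.of i) =
        FreeGroup.of (ν i) := by
  have hgap : ∀ i j, i < j → j < n → ((ν i : ℕ) : ℝ) + 1 ≤ (ν j : ℕ) := by
    intro i j hij hj
    exact_mod_cast Nat.succ_le_of_lt (hν i j hij hj)
  let X : I → ℕ → ℝ := fun t i => (1 - (t : ℝ)) * i + t * ((ν i : ℕ) : ℝ)
  -- Linear interpolation between increasing integer sequences keeps neighbours at least `1` apart.
  have hX : ∀ t i j, i < j → j < n → X t i + 1 ≤ X t j := by
    intro t i j hij hj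
    have h1 := hgap i j hij hj
    have h2 : (i : ℝ) + 1 ≤ j := by exact_mod_cast hij
    have := t.2.1
    have := t.2.2
    simp only [X]
    nlinarith
  have hX' : ∀ t (i j : Fin n), i ≠ j → 1 ≤ |X t i - X t j| := by
    intro t i j hij
    rcases lt_or_gt_of_ne hij with h | h
    · rw [abs_sub_comm]
      exact le_trans (by linarith [hX t i j h j.2]) (le_abs_self _)
    · exact le_trans (by linarith [hX t j i h i.2]) (le_abs_self _)
  have hinj : ∀ t, Function.Injective fun i : Fin n => (X t i : ℂ) := by
    intro t i j hij
    by_contra hne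
    have h1 := hX' t i j hne
    have h2 : X t i = X t j := by simpa using hij
    rw [h2, sub_self, abs_zero] at h1
    linarith
  let v : Config (Fin n) := ⟨fun i => (X 1 i : ℂ), hinj 1⟩
  have hv1 : ∀ i : Fin n, v.1 i = ((ν i : ℕ) : ℂ) := fun i => by simp [v, X]
  have hv : range v.1 = punct E := by
    have hsub : Finset.univ.image (fun i : Fin n => (ν i : ℕ)) = E := by
      refine Finset.eq_of_subset_of_card_le ?_ ?_
      · intro k hk
        obtain ⟨i, -, rfl⟩ := Finset.mem_image.1 hk
        exact (ν i).2
      · rw [Finset.card_image_of_injective, Finset.card_univ, Fintype.card_fin, hE]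
        intro i j hij
        refine v.2 ?_
        rw [hv1, hv1]
        exact congrArg _ hij
    ext z
    rw [← hsub]
    simp only [punct, mem_range, mem_image, Finset.coe_image, Finset.coe_univ, image_univ, hv1,
      exists_exists_eq_and]
  obtain ⟨p, hp⟩ := exists_path (u := base n) (v := v) (fun t i => (X t i : ℂ))
    (fun i => by fun_prop) hinj (fun i => by simp [X, base]) (fun i => rfl)
  obtain ⟨e, he⟩ := exists_act p (range_base n) hv
  refine ⟨v, p, e, hv, he, fun i => he.apply_of (range_base n) hv i (ν i) ?_⟩
  filter_upwards [eventually_ge_atTop (13 * (max (i : ℝ) (ν i : ℕ) + 1))] with R hR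
  refine moves_slide fun s t j => ?_
  rw [hp]
  intro h
  have hj := slide_spec hR (le_max_left _ _) (le_max_right _ _) s t h.symm (x := X t i) rfl
    (by simp)
  -- The strings are real, so none lies on the bottom side. The other sides are at horizontal
  -- distance strictly between `0` and `1` from string `i`, where there is no string.
  rcases hj with hj | hj
  · rw [Complex.ofReal_im] at hj
    linarith [hj.1]
  · rw [Complex.ofReal_re] at hj
    by_cases hij : (j : ℕ) = i
    · rw [hij] at hj
      simp at hj
      linarith
    · have := hX' t j ⟨i, Finset.mem_range.1 i.2⟩ fun h => hij (congrArg Fin.val h)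
      have h2 := hj.2.2
      dsimp only at this
      linarith

/-! ### Exchanges of neighbours and realization of systems of conjugates -/

theorem map_hurwitz {G G' : Type*} [Group G] [Group G'] (f : G →* G') (i : ℕ) (y : ℕ → G)
    (j : ℕ) : f (hurwitz i y j) = hurwitz i (fun j => f (y j)) j := by
  unfold hurwitz
  split_ifs <;> simp

theorem map_hurwitzInv {G G' : Type*} [Group G] [Group G'] (f : G →* G') (i : ℕ) (y : ℕ → G)
    (j : ℕ) : f (hurwitzInv i y j) = hurwitzInv i (fun j => f (y j)) j := by
  unfold hurwitzInv
  split_ifs <;> simp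

/-- An action fixes the ordered product, so the image of one generator follows from the images of
the others and needs no geometric argument. -/
theorem eq_of_prod_range_eq {G : Type*} [Group G] {y z : ℕ → G} {n k : ℕ} (hk : k < n)
    (h : ∀ j, j ≠ k → z j = y j)
    (hp : ((List.range n).map z).prod = ((List.range n).map y).prod) : z k = y k := by
  induction n with
  | zero => omega
  | succ m ih =>
    rw [List.range_succ, List.map_append, List.map_append, List.prod_append, List.prod_append]
      at hp
    by_cases hm : m = k
    · subst hm
      have hlt : (List.range m).map z = (List.range m).map y := by
        refine List.map_congr_left fun j hj => h j ?_
        rw [List.mem_range] at hj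
        omega
      rw [hlt] at hp
      simpa using hp
    · refine ih (by omega) ?_
      simpa [h m hm] using hp

theorem letter_of_notMem {E : Finset ℕ} {k : ℕ} (h : k ∉ E) : letter E k = 1 := dif_neg h

theorem letter_of_mem {E : Finset ℕ} {k : ℕ} (h : k ∈ E) : letter E k = FreeGroup.of ⟨k, h⟩ :=
  dif_pos h

theorem Config.range_perm {ι : Type*} (τ : Equiv.Perm ι) (u : Config ι) :
    range (u.perm τ).1 = range u.1 := τ.surjective.range_comp u.1

theorem Config.perm_perm_swap {ι : Type*} [DecidableEq ι] (i j : ι) (u : Config ι) :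
    u = (u.perm (Equiv.swap i j)).perm (Equiv.swap i j) := by
  apply Subtype.ext
  funext k
  simp [Config.perm]

/-- The exchange of two neighbouring points, where the left one passes above the right one. -/
theorem exists_twist {n i : ℕ} (hi : i + 1 < n) :
    ∃ (p : Path (base n) ((base n).perm (Equiv.swap ⟨i, Nat.lt_of_succ_lt hi⟩ ⟨i + 1, hi⟩)))
      (e : FreeOn (Finset.range n) ≃* FreeOn (Finset.range n)), Act p e.toMonoidHom ∧
      ∀ j, e (letter _ j) = hurwitzInv i (letter (Finset.range n)) j := by
  set E := Finset.range n
  set τ : Equiv.Perm (Fin n) := Equiv.swap ⟨i, Nat.lt_of_succ_lt hi⟩ ⟨i + 1, hi⟩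
  -- The two points exchange places along arcs of parabolas of height and depth `1`. This is low
  -- enough for `slide_spec`, and deep enough to pass below the generating loops, whose bottom is at
  -- height `-1 / 2`.
  let A : I → ℂ := fun t => ⟨i + t, 4 * t * (1 - t)⟩
  let B : I → ℂ := fun t => ⟨i + 1 - t, -(4 * t * (1 - t))⟩
  have hA : Continuous A :=
    Complex.equivRealProdCLM.symm.continuous.comp (f := fun t : I =>
      ((i + t, 4 * t * (1 - t)) : ℝ × ℝ)) (by fun_prop)
  have hB : Continuous B :=
    Complex.equivRealProdCLM.symm.continuous.comp (f := fun t : I =>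
      ((i + 1 - t, -(4 * t * (1 - t))) : ℝ × ℝ)) (by fun_prop)
  let F : I → Fin n → ℂ := fun t j =>
    if (j : ℕ) = i then A t else if (j : ℕ) = i + 1 then B t else ((j : ℕ) : ℂ)
  have hAB : ∀ t, A t ≠ B t := by
    intro t h
    have h1 : (i : ℝ) + t = i + 1 - t := congrArg Complex.re h
    have h2 : 4 * (t : ℝ) * (1 - t) = -(4 * t * (1 - t)) := congrArg Complex.im h
    have h3 : (t : ℝ) = 1 / 2 := by linarith
    rw [h3] at h2
    norm_num at h2
  have hoff : ∀ (j : ℕ), j ≠ i → j ≠ i + 1 → (j : ℝ) + 1 ≤ i ∨ (i : ℝ) + 2 ≤ j := by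
    intro j h1 h2
    rcases Nat.lt_or_ge j i with h | h
    · left; exact_mod_cast h
    · right
      have : i + 2 ≤ j := by omega
      exact_mod_cast this
  have hre : ∀ (j : ℕ) (x : ℝ), j ≠ i → j ≠ i + 1 → (i : ℝ) ≤ x → x ≤ i + 1 → x ≠ j := by
    intro j x h1 h2 h3 h4 h5
    rcases hoff j h1 h2 with h | h <;> linarith
  have hAj : ∀ t (j : ℕ), j ≠ i → j ≠ i + 1 → A t ≠ j := by
    intro t j h1 h2 h
    refine hre j (A t).re h1 h2 ?_ ?_ (by rw [h]; simp)
    · change (i : ℝ) ≤ i + t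
      linarith [t.2.1]
    · change (i : ℝ) + t ≤ i + 1
      linarith [t.2.2]
  have hBj : ∀ t (j : ℕ), j ≠ i → j ≠ i + 1 → B t ≠ j := by
    intro t j h1 h2 h
    refine hre j (B t).re h1 h2 ?_ ?_ (by rw [h]; simp)
    · change (i : ℝ) ≤ i + 1 - t
      linarith [t.2.2]
    · change (i : ℝ) + 1 - t ≤ i + 1
      linarith [t.2.1]
  have hinj : ∀ t, Function.Injective (F t) := by
    intro t j k hjk
    by_contra hne
    have hne' : (j : ℕ) ≠ k := fun h => hne (Fin.ext h)
    simp only [F] at hjk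
    split_ifs at hjk with h1 h2 h3 h4 h5 h6 h7 h8
    · omega
    · exact hAB t hjk
    · exact hAj t k h2 h3 hjk
    · exact hAB t hjk.symm
    · omega
    · exact hBj t k h5 h6 hjk
    · exact hAj t j h1 h4 hjk.symm
    · exact hBj t j h1 h4 hjk.symm
    · exact hne' (by exact_mod_cast hjk)
  obtain ⟨p, hp⟩ := exists_path (u := base n) (v := (base n).perm τ) F (fun j => by
      simp only [F]
      split_ifs
      · exact hA
      · exact hB
      · exact continuous_const) hinj
    (fun j => by
      simp only [F, base]
      split_ifs with h1 h2
      · apply Complex.ext <;> simp [A, h1]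
      · apply Complex.ext <;> simp [B, h2]
      · rfl)
    (fun j => by
      simp only [F, base, Config.perm, Function.comp, τ]
      split_ifs with h1 h2
      · obtain rfl : j = ⟨i, Nat.lt_of_succ_lt hi⟩ := Fin.ext h1
        rw [Equiv.swap_apply_left]
        apply Complex.ext <;> simp [A]
      · obtain rfl : j = ⟨i + 1, hi⟩ := Fin.ext h2
        rw [Equiv.swap_apply_right]
        apply Complex.ext <;> simp [B]
      · rw [Equiv.swap_apply_of_ne_of_ne]
        · exact fun h => h1 (congrArg Fin.val h)
        · exact fun h => h2 (congrArg Fin.val h))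
  have hu := range_base n
  have hv : range ((base n).perm τ).1 = punct E := (Config.range_perm τ _).trans hu
  obtain ⟨e, he, -⟩ := exists_act_equiv p hu hv
  refine ⟨p, e, he, ?_⟩
  have hfix : ∀ j : E, (j : ℕ) ≠ i → (j : ℕ) ≠ i + 1 → e (FreeGroup.of j) = FreeGroup.of j := by
    intro j h1 h2
    refine he.apply_of hu hv j j ?_
    filter_upwards [eventually_ge_atTop (13 * (((j : ℕ) : ℝ) + 1))] with R hR
    refine moves_slide fun s t k => ?_
    rw [hp]
    intro h
    have key := slide_spec hR le_rfl le_rfl s t h.symm (x := ((j : ℕ) : ℝ)) (by ring)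
    have ht0 := t.2.1
    have ht1 := t.2.2
    have hj := hoff j h1 h2
    simp only [F] at key
    split_ifs at key with h3 h4
    · simp only [A] at key
      have h5 : 3 / 8 < |(i : ℝ) + t - (j : ℕ)| → 5 / 8 ≤ |(i : ℝ) + t - (j : ℕ)| := by
        intro _
        rcases hj with hj | hj
        · exact le_trans (by linarith) (le_abs_self _)
        · exact le_trans (by linarith) (neg_le_abs _)
      rcases key (by nlinarith [sq_nonneg (2 * (t : ℝ) - 1)]) with hk | hk
      · nlinarith [hk.1]
      · linarith [h5 hk.2.1, hk.2.2]
    · simp only [B] at key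
      have h5 : 1 ≤ |(i : ℝ) + 1 - t - (j : ℕ)| := by
        rcases hj with hj | hj
        · exact le_trans (by linarith) (le_abs_self _)
        · exact le_trans (by linarith) (neg_le_abs _)
      rcases key (by nlinarith) with hk | hk
      · linarith [hk.2]
      · linarith [hk.2.2]
    · rcases key (by simp) with hk | hk
      · rw [Complex.natCast_im] at hk
        linarith [hk.1]
      · rw [Complex.natCast_re] at hk
        have h5 : 3 / 8 < |(((k : ℕ) : ℤ) - ((j : ℕ) : ℤ) : ℝ)| := by exact_mod_cast hk.2.1
        have h6 : |(((k : ℕ) : ℤ) - ((j : ℕ) : ℤ) : ℝ)| < 5 / 8 := by exact_mod_cast hk.2.2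
        have h7 : |((k : ℕ) : ℤ) - ((j : ℕ) : ℤ)| < 1 := by
          have : ((|((k : ℕ) : ℤ) - ((j : ℕ) : ℤ)| : ℤ) : ℝ) < 1 := by push_cast; linarith
          exact_mod_cast this
        rw [Int.abs_lt_one_iff] at h7
        have h8 : (((k : ℕ) : ℤ) - ((j : ℕ) : ℤ) : ℝ) = 0 := by exact_mod_cast h7
        rw [h8, abs_zero] at h5
        linarith
  have hmem : i ∈ E := Finset.mem_range.2 (by omega)
  have hmem' : i + 1 ∈ E := Finset.mem_range.2 hi
  -- The loop around `i` follows the upper point `A`. It remains to see that the lower point passes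
  -- beneath it.
  have hnext : e (FreeGroup.of ⟨i, hmem⟩) = FreeGroup.of ⟨i + 1, hmem'⟩ := by
    refine he.apply_of hu hv ⟨i, hmem⟩ ⟨i + 1, hmem'⟩ ?_
    filter_upwards [eventually_ge_atTop (13 * (((i : ℝ) + 1) + 1))] with R hR
    refine moves_slide fun s t k => ?_
    rw [hp]
    intro h
    have key := slide_spec hR (by simp) (by simp) s t h.symm (x := (i : ℝ) + t) (by
      push_cast; ring)
    have ht0 := t.2.1
    have ht1 := t.2.2
    simp only [F] at key
    split_ifs at key with h3 h4
    · simp only [A, sub_self, abs_zero] at key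
      rcases key (by nlinarith [sq_nonneg (2 * (t : ℝ) - 1)]) with hk | hk
      · nlinarith [hk.1]
      · linarith [hk.2.1]
    · simp only [B] at key
      -- The height of `B t` is `(1 - 2 * t) ^ 2 - 1`. Where `|1 - 2 * t| < 5 / 8` this is less than
      -- `-1 / 2`, so `B t` is below the moving triangle.
      have h5 : (i : ℝ) + 1 - t - (i + t) = 1 - 2 * t := by ring
      rw [h5] at key
      have hk : -1 / 2 ≤ -(4 * (t : ℝ) * (1 - t)) ∧ |1 - 2 * (t : ℝ)| < 5 / 8 := by
        rcases key (by nlinarith) with hk | hk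
        · exact ⟨hk.1.ge, by linarith [hk.2]⟩
        · exact ⟨hk.1, hk.2.2⟩
      have h6 := abs_lt.1 hk.2
      nlinarith [hk.1]
    · rcases key (by simp) with hk | hk
      · rw [Complex.natCast_im] at hk
        linarith [hk.1]
      · rw [Complex.natCast_re] at hk
        have h5 := abs_lt.1 hk.2.2
        rcases hoff k h3 h4 with h6 | h6 <;> linarith
  have hlet : ∀ j, j ≠ i + 1 → e (letter E j) = hurwitzInv i (letter E) j := by
    intro j hj
    by_cases hji : j = i
    · subst hji
      rw [letter_of_mem hmem, hnext, hurwitzInv, if_pos rfl, letter_of_mem hmem']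
    · rw [hurwitzInv, if_neg hji, if_neg hj]
      by_cases hjE : j ∈ E
      · rw [letter_of_mem hjE]
        exact hfix ⟨j, hjE⟩ hji hj
      · rw [letter_of_notMem hjE, map_one]
  intro j
  by_cases hj : j = i + 1
  · subst hj
    -- The image of the generator `δ_(i+1)` is forced by the invariance of the ordered product.
    refine eq_of_prod_range_eq hi hlet ?_
    have h1 : e (orderedProd E) = orderedProd E := he.orderedProd hu hv
    rw [orderedProd_eq (Finset.Subset.refl _), map_list_prod, List.map_map] at h1
    rw [prod_range_congr (z := hurwitzInv i (letter E)) (y := letter E) hi (fun j h h' => by simp [hurwitzInv, h, h'])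
      (by simp [hurwitzInv, mul_assoc])]
    exact h1
  · exact hlet j hj

/-- The reversed motion starts at `u.perm τ`. Relabelling by the involution `τ` makes it start at
`u` again; the action does not depend on labels. -/
theorem exists_act_symm {ι : Type*} [Fintype ι] {u : Config ι} {τ : Equiv.Perm ι}
    (hτ : u = (u.perm τ).perm τ) {E : Finset ℕ} (hu : range u.1 = punct E)
    {p : Path u (u.perm τ)} {e : FreeOn E ≃* FreeOn E} (he : Act p e.toMonoidHom) :
    ∃ q : Path u (u.perm τ), Act q e.symm.toMonoidHom :=
  ⟨(Braid.permPath τ p.symm).cast hτ rfl,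
    (he.symm hu ((Config.range_perm τ u).trans hu)).comp_strings τ fun _ _ => rfl⟩

/-- The inverse exchange of two neighbouring points. -/
theorem exists_twist_inv {n i : ℕ} (hi : i + 1 < n) :
    ∃ (p : Path (base n) ((base n).perm (Equiv.swap ⟨i, Nat.lt_of_succ_lt hi⟩ ⟨i + 1, hi⟩)))
      (e : FreeOn (Finset.range n) ≃* FreeOn (Finset.range n)), Act p e.toMonoidHom ∧
      ∀ j, e (letter _ j) = hurwitz i (letter (Finset.range n)) j := by
  obtain ⟨p, e, he, h⟩ := exists_twist hi
  obtain ⟨q, hq⟩ := exists_act_symm (Config.perm_perm_swap _ _ _) (range_base n) he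
  refine ⟨q, e.symm, hq, fun j => ?_⟩
  rw [MulEquiv.symm_apply_eq]
  have h1 := map_hurwitz e.toMonoidHom i (letter (Finset.range n)) j
  have h2 : (fun j => e.toMonoidHom (letter (Finset.range n) j)) =
      hurwitzInv i (letter (Finset.range n)) := funext h
  rw [h2, hurwitz_hurwitzInv] at h1
  exact h1.symm

/-- Conjugates of generators with the right product are realized by a motion. -/
theorem exists_realization {n : ℕ} {E : Finset ℕ} (hE : E.card = n) (y W : ℕ → FreeOn E)
    (ν : ℕ → E) (hy : ∀ i < n, y i = (W i)⁻¹ * FreeGroup.of (ν i) * W i)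
    (hprod : ((List.range n).map y).prod = orderedProd E) :
    ∃ (v : Config (Fin n)) (p : Path (base n) v) (e : FreeOn (Finset.range n) →* FreeOn E),
      range v.1 = punct E ∧ Act p e ∧ ∀ i < n, e (letter _ i) = y i := by
  -- The exchange is performed before the motion `p`, so its action is precomposed: a homomorphism
  -- applied to a Hurwitz transform of the letters gives the Hurwitz transform of their images.
  have step : ∀ (τ : Equiv.Perm (Fin n)) (t : Path (base n) ((base n).perm τ))
      (f : FreeOn (Finset.range n) ≃* FreeOn (Finset.range n)), Act t f.toMonoidHom →
      ∀ (v : Config (Fin n)) (p : Path (base n) v) (e : FreeOn (Finset.range n) →* FreeOn E),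
        range v.1 = punct E → Act p e → range (v.perm τ).1 = punct E ∧
          Act (t.trans (Braid.permPath τ p)) (e.comp f.toMonoidHom) := by
    intro τ t f hf v p e hv he
    exact ⟨(Config.range_perm τ v).trans hv, hf.trans (he.comp_strings τ fun t i => rfl)⟩
  refine hurwitz_induction (E := E) (P := fun y => ∃ (v : Config (Fin n)) (p : Path (base n) v)
    (e : FreeOn (Finset.range n) →* FreeOn E),
      range v.1 = punct E ∧ Act p e ∧ ∀ i < n, e (letter _ i) = y i) ?_ ?_ ?_ y
      -- The value `1` from index `n` on meets the convention of `hurwitz_induction` for the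
      -- conjugator after the last one.
      (fun i => if i < n then W i else 1) ν (by simp [hE]) (fun i hi => ?_) (hE ▸ hprod)
  · intro y ν' hν hy
    rw [hE] at hν hy
    obtain ⟨v, p, e, hv, he, h⟩ := exists_increasing ν' hν hE
    refine ⟨v, p, e, hv, he, fun i hi => ?_⟩
    rw [hy i hi, letter_of_mem (Finset.mem_range.2 hi)]
    exact h ⟨i, _⟩
  · rintro y i hi ⟨v, p, e, hv, he, h⟩
    rw [hE] at hi
    obtain ⟨t, f, hf, hf'⟩ := exists_twist_inv hi
    obtain ⟨h1, h2⟩ := step _ t f hf v p e hv he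
    refine ⟨_, _, _, h1, h2, fun j hj => ?_⟩
    refine (congrArg e (hf' j)).trans ((map_hurwitz e i _ j).trans ?_)
    simp [hurwitz, h i (by omega), h (i + 1) hi, h j hj]
  · rintro y i hi ⟨v, p, e, hv, he, h⟩
    rw [hE] at hi
    obtain ⟨t, f, hf, hf'⟩ := exists_twist hi
    obtain ⟨h1, h2⟩ := step _ t f hf v p e hv he
    refine ⟨_, _, _, h1, h2, fun j hj => ?_⟩
    refine (congrArg e (hf' j)).trans ((map_hurwitzInv e i _ j).trans ?_)
    simp [hurwitzInv, h i (by omega), h (i + 1) hi, h j hj]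
  · rw [hE] at hi
    simp only [if_pos hi]
    exact hy i hi

end Motions

/-! ### The unrestricted free product -/

section Unrestricted

theorem proj_pFin {E F : Finset ℕ} (h : E ⊆ F) (x : unrestricted) :
    proj F E (pFin F x) = pFin E x := by
  have hF : F ⊆ Finset.range (F.sup id + 1) := fun i hi =>
    Finset.mem_range.2 (Nat.lt_succ_of_le (Finset.le_sup (f := id) hi))
  rw [pFin_eq hF, pFin_eq (h.trans hF), ← MonoidHom.comp_apply, proj_comp_proj h]

theorem pFin_range (n : ℕ) (x : unrestricted) : pFin (Finset.range n) x = pNat n x := by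
  rw [pFin_eq (Finset.Subset.refl _), proj_self]
  rfl

theorem proj_pNat {n m : ℕ} (h : n ≤ m) (x : unrestricted) :
    proj (Finset.range m) (Finset.range n) (pNat m x) = pNat n x := x.2 n m h

theorem unrestricted_ext {x y : unrestricted} (h : ∀ n, pNat n x = pNat n y) : x = y :=
  Subtype.ext (funext h)

/-- The element of the inverse limit with given components. -/
theorem exists_pNat_eq (g : ∀ n, FreeOn (Finset.range n))
    (h : ∀ n m, n ≤ m → proj (Finset.range m) (Finset.range n) (g m) = g n) :
    ∃ x : unrestricted, ∀ n, pNat n x = g n := ⟨⟨g, h⟩, fun _ => rfl⟩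

theorem pNat_surjective (n : ℕ) : Function.Surjective (pNat n) := by
  intro g
  obtain ⟨x, hx⟩ := exists_pNat_eq (fun k => proj (Finset.range n) (Finset.range k) g)
    fun k m h => by rw [← MonoidHom.comp_apply, proj_comp_proj (Finset.range_mono h)]
  exact ⟨x, by rw [hx, proj_self]; rfl⟩

/-- The set `σ[n]`. -/
def imageSet (ν : Equiv.Perm ℕ) (n : ℕ) : Finset ℕ := (Finset.range n).map ν.toEmbedding

theorem mem_imageSet {ν : Equiv.Perm ℕ} {n k : ℕ} : ν k ∈ imageSet ν n ↔ k < n := by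
  simp [imageSet]

theorem mem_imageSet' {ν : Equiv.Perm ℕ} {n k : ℕ} : k ∈ imageSet ν n ↔ ν.symm k < n := by
  rw [← mem_imageSet (ν := ν), ν.apply_symm_apply]

theorem imageSet_mono (ν : Equiv.Perm ℕ) {n m : ℕ} (h : n ≤ m) : imageSet ν n ⊆ imageSet ν m :=
  Finset.map_subset_map.2 (Finset.range_mono h)

theorem subset_range (E : Finset ℕ) : ∃ n, E ⊆ Finset.range n := ⟨E.sup id + 1, fun _ hi =>
  Finset.mem_range.2 (Nat.lt_succ_of_le (Finset.le_sup (f := id) hi))⟩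

theorem subset_imageSet (ν : Equiv.Perm ℕ) (E : Finset ℕ) : ∃ n, E ⊆ imageSet ν n := by
  obtain ⟨n, hn⟩ := subset_range (E.map ν.symm.toEmbedding)
  refine ⟨n, fun k hk => mem_imageSet'.2 (Finset.mem_range.1 (hn ?_))⟩
  exact Finset.mem_map_of_mem _ hk

/-- The sets `σ[n]` are cofinal. -/
theorem exists_pFin_eq (ν : Equiv.Perm ℕ) (z : ∀ n, FreeOn (imageSet ν n))
    (h : ∀ n m, n ≤ m → proj (imageSet ν m) (imageSet ν n) (z m) = z n) :
    ∃ x : unrestricted, ∀ n, pFin (imageSet ν n) x = z n := by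
  choose k hk using fun N => subset_imageSet ν (Finset.range N)
  have key : ∀ N m, k N ≤ m → proj (imageSet ν (k N)) (Finset.range N) (z (k N)) =
      proj (imageSet ν m) (Finset.range N) (z m) := by
    intro N m hm
    rw [← h _ _ hm, ← MonoidHom.comp_apply, proj_comp_proj (hk N)]
  obtain ⟨x, hx⟩ := exists_pNat_eq
    (fun N => proj (imageSet ν (k N)) (Finset.range N) (z (k N))) fun N M hNM => by
      rw [key N _ (le_max_left (k N) (k M)), key M _ (le_max_right (k N) (k M)),
        ← MonoidHom.comp_apply, proj_comp_proj (Finset.range_mono hNM)]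
  refine ⟨x, fun n => ?_⟩
  obtain ⟨N, hN⟩ := subset_range (imageSet ν n)
  rw [pFin_eq hN, hx, key N _ (le_max_left (k N) n), ← MonoidHom.comp_apply, proj_comp_proj hN,
    h _ _ (le_max_right _ _)]

theorem unrestricted_ext_imageSet (ν : Equiv.Perm ℕ) {x y : unrestricted}
    (h : ∀ n, pFin (imageSet ν n) x = pFin (imageSet ν n) y) : x = y := by
  refine unrestricted_ext fun N => ?_
  obtain ⟨n, hn⟩ := subset_imageSet ν (Finset.range N)
  rw [← pFin_range, ← pFin_range, ← proj_pFin hn, ← proj_pFin hn, h]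

/-- A compatible system of isomorphisms induces an automorphism. -/
theorem exists_mulAut (ν : Equiv.Perm ℕ)
    (e : ∀ n, FreeOn (Finset.range n) ≃* FreeOn (imageSet ν n))
    (h : ∀ n m, n ≤ m → (proj (imageSet ν m) (imageSet ν n)).comp (e m).toMonoidHom =
      (e n).toMonoidHom.comp (proj (Finset.range m) (Finset.range n))) :
    ∃ a : MulAut unrestricted, ∀ n x, pFin (imageSet ν n) (a x) = e n (pNat n x) := by
  have h' : ∀ n m, n ≤ m → ∀ g, proj (imageSet ν m) (imageSet ν n) (e m g) =
      e n (proj (Finset.range m) (Finset.range n) g) :=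
    fun n m hnm g => DFunLike.congr_fun (h n m hnm) g
  choose α hα using fun x : unrestricted => exists_pFin_eq ν (fun n => e n (pNat n x))
    fun n m hnm => by rw [h' n m hnm, proj_pNat hnm]
  choose β hβ using fun x : unrestricted => exists_pNat_eq
    (fun n => (e n).symm (pFin (imageSet ν n) x)) fun n m hnm => by
      rw [MulEquiv.eq_symm_apply, ← h' n m hnm, MulEquiv.apply_symm_apply,
        proj_pFin (imageSet_mono ν hnm)]
  refine ⟨MulEquiv.mk' ⟨α, β, fun x => ?_, fun x => ?_⟩ fun x y => ?_, fun n x => hα x n⟩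
  · refine unrestricted_ext fun n => ?_
    rw [hβ, hα, MulEquiv.symm_apply_apply]
  · refine unrestricted_ext_imageSet ν fun n => ?_
    rw [hα, hβ, MulEquiv.apply_symm_apply]
  · refine unrestricted_ext_imageSet ν fun n => ?_
    change pFin _ (α (x * y)) = pFin _ (α x * α y)
    rw [map_mul, hα, hα, hα, map_mul, map_mul]

/-! ### Exponent sums and the underlying permutation -/

/-- The exponent sum of the generator `δ_k`. -/
def expo (E : Finset ℕ) (k : ℕ) : FreeOn E →* Multiplicative ℤ :=
  FreeGroup.lift fun i => if (i : ℕ) = k then Multiplicative.ofAdd 1 else 1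

theorem expo_of {E : Finset ℕ} (k : ℕ) (i : E) :
    expo E k (FreeGroup.of i) = if (i : ℕ) = k then Multiplicative.ofAdd 1 else 1 :=
  FreeGroup.lift_apply_of

theorem expo_conj {E : Finset ℕ} (k : ℕ) (i : E) (U : FreeOn E) :
    expo E k (U⁻¹ * FreeGroup.of i * U) = if (i : ℕ) = k then Multiplicative.ofAdd 1 else 1 := by
  rw [map_mul, map_mul, map_inv, expo_of, mul_comm, mul_inv_cancel_left]

theorem expo_conj_ne_one_iff {E : Finset ℕ} (k : ℕ) (i : E) (U : FreeOn E) :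
    expo E k (U⁻¹ * FreeGroup.of i * U) ≠ 1 ↔ (i : ℕ) = k := by
  rw [expo_conj]
  split_ifs with h
  · simp only [h, iff_true]
    decide
  · simp [h]

theorem expo_proj {E F : Finset ℕ} {k : ℕ} (hk : k ∈ E) (g : FreeOn F) :
    expo E k (proj F E g) = expo F k g := by
  rw [← MonoidHom.comp_apply]
  congr 1
  ext i
  by_cases h : (i : ℕ) ∈ E
  · simp [proj, expo, h]
  · have : (i : ℕ) ≠ k := fun h' => h (h' ▸ hk)
    simp [proj, expo, h, this]

/-- The generator `δ_i` of the inverse limit. -/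
theorem exists_gen (i : ℕ) : ∃ x : unrestricted, ∀ E, pFin E x = letter E i := by
  obtain ⟨x, hx⟩ := exists_pNat_eq (fun n => letter (Finset.range n) i)
    fun n m h => proj_letter (Finset.range_mono h) i
  refine ⟨x, fun E => ?_⟩
  obtain ⟨n, hn⟩ := subset_range E
  rw [pFin_eq hn, hx, proj_letter hn]

/-- The isomorphisms that belong to an automorphism with property `(†)` are compatible. -/
theorem Dagger.exists_perm {a : MulAut unrestricted} (ha : Dagger a) :
    ∃ ν : Equiv.Perm ℕ, ∀ n, ∃ h : FreeOn (Finset.range n) ≃* FreeOn (imageSet ν n),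
      (∀ g, pFin (imageSet ν n) (a g) = h (pNat n g)) ∧
      (∀ i : Finset.range n, ∃ U : FreeOn (imageSet ν n), h (FreeGroup.of i) =
        U⁻¹ * FreeGroup.of ⟨ν i, mem_imageSet.2 (Finset.mem_range.1 i.2)⟩ * U) ∧
      h (orderedProd (Finset.range n)) = orderedProd (imageSet ν n) := by
  choose E h s h1 h2 h3 using ha
  choose δ hδ using exists_gen
  have hδn : ∀ n i, pNat n (δ i) = letter (Finset.range n) i := fun n i => by
    rw [← pFin_range, hδ]
  -- The sets `E n` are governed by kernels: through `a`, projecting to `E n` has the same kernel as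
  -- `p_n`. As these kernels decrease with `n`, the sets `E n` increase.
  have hker : ∀ n x, pFin (E n) (a x) = 1 ↔ pNat n x = 1 := fun n x => by
    rw [h1, map_eq_one_iff _ (h n).injective]
  have hletter : ∀ {F : Finset ℕ} {k : ℕ}, letter F k = 1 ↔ k ∉ F := by
    intro F k
    constructor
    · intro hl hk
      rw [letter_of_mem hk] at hl
      exact FreeGroup.of_ne_one _ hl
    · exact letter_of_notMem
  have hmono : ∀ n m, n ≤ m → E n ⊆ E m := by
    intro n m hnm k hk
    by_contra hk'
    have h4 : pNat m (a.symm (δ k)) = 1 := by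
      rw [← hker, MulEquiv.apply_symm_apply, hδ]
      exact hletter.2 hk'
    have h5 : pFin (E n) (a (a.symm (δ k))) = 1 := by
      rw [hker, ← proj_pNat hnm, h4, map_one]
    rw [MulEquiv.apply_symm_apply, hδ] at h5
    exact hletter.1 h5 hk
  -- The exponent sums of `a(δ_i)` detect the end point of `i`, and they are compatible with
  -- projections. So the bijections at different levels agree.
  have hval : ∀ n (i : Finset.range n) k, k ∈ E n →
      (expo (E n) k (pFin (E n) (a (δ i))) ≠ 1 ↔ (s n i : ℕ) = k) := by
    intro n i k _
    obtain ⟨U, hU⟩ := h2 n i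
    rw [h1, hδn, letter_coe, hU]
    exact expo_conj_ne_one_iff _ _ _
  have hcompat : ∀ n m (hnm : n ≤ m) i (hi : i ∈ Finset.range n),
      (s m ⟨i, Finset.range_mono hnm hi⟩ : ℕ) = s n ⟨i, hi⟩ := by
    intro n m hnm i hi
    have h4 := (hval n ⟨i, hi⟩ (s n ⟨i, hi⟩) (s n ⟨i, hi⟩).2).2 rfl
    rw [← hval m ⟨i, Finset.range_mono hnm hi⟩ _ (hmono n m hnm (s n ⟨i, hi⟩).2)]
    rw [← proj_pFin (hmono n m hnm), expo_proj (s n ⟨i, hi⟩).2] at h4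
    exact h4
  let f : ℕ → ℕ := fun i => s (i + 1) ⟨i, Finset.self_mem_range_succ i⟩
  have hf : ∀ n i (hi : i ∈ Finset.range n), f i = s n ⟨i, hi⟩ := fun n i hi =>
    (hcompat (i + 1) n (Finset.mem_range.1 hi) i _).symm
  have hfinj : Function.Injective f := by
    intro i j hij
    have hi : i ∈ Finset.range (max i j + 1) := Finset.mem_range.2 (by omega)
    have hj : j ∈ Finset.range (max i j + 1) := Finset.mem_range.2 (by omega)
    rw [hf _ i hi, hf _ j hj] at hij
    exact congrArg Subtype.val ((s _).injective (Subtype.ext hij))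
  have hfsurj : Function.Surjective f := by
    intro k
    by_contra hk
    push Not at hk
    -- If `k` were missed, then `a⁻¹(δ_k)` would be trivial at all levels, hence trivial.
    have h4 : ∀ n, k ∉ E n := by
      intro n hkn
      obtain ⟨i, hi⟩ := (s n).surjective ⟨k, hkn⟩
      exact hk i (by rw [hf n i i.2, Subtype.coe_eta, hi])
    have h5 : a.symm (δ k) = 1 := unrestricted_ext fun n => by
      rw [map_one, ← hker, MulEquiv.apply_symm_apply, hδ]
      exact hletter.2 (h4 n)
    have h6 : δ k = 1 := by
      rw [← a.apply_symm_apply (δ k), h5, map_one]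
    have h7 := hδ k {k}
    rw [h6, map_one] at h7
    exact hletter.1 h7.symm (by simp)
  let ν : Equiv.Perm ℕ := Equiv.ofBijective f ⟨hfinj, hfsurj⟩
  have hE : ∀ n, E n = imageSet ν n := by
    intro n
    ext k
    simp only [imageSet, Finset.mem_map]
    constructor
    · intro hk
      obtain ⟨i, hi⟩ := (s n).surjective ⟨k, hk⟩
      exact ⟨i, i.2, (hf n i i.2).trans (congrArg Subtype.val hi)⟩
    · rintro ⟨i, hi, rfl⟩
      change f i ∈ E n
      rw [hf n i hi]
      exact (s n _).2
  refine ⟨ν, fun n => ?_⟩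
  have hs : ∀ i : Finset.range n, (s n i : ℕ) = ν i := fun i => (hf n i i.2).symm
  have h1n := h1 n
  have h2n := h2 n
  have h3n := h3 n
  -- The types of `h n` and `s n` involve `E n`. Everything about level `n` is generalized so that
  -- `E n` can be replaced by `imageSet ν n`.
  generalize s n = sn at *
  generalize h n = hn at *
  have hEn := hE n
  generalize E n = En at *
  subst hEn
  refine ⟨hn, h1n, fun i => ?_, h3n⟩
  obtain ⟨U, hU⟩ := h2n i
  refine ⟨U, hU.trans ?_⟩
  congr 3
  exact Subtype.ext (hs i)

end Unrestricted

/-! ### Braids and automorphisms -/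

section Main

theorem range_first_perm (ν : Equiv.Perm ℕ) (n : ℕ) :
    range ((omega.perm ν).first n).1 = punct (imageSet ν n) := by
  ext z
  simp only [punct, imageSet, mem_range, mem_image, Finset.coe_map, Finset.coe_range,
    exists_exists_and_eq_and, mem_Iio]
  exact ⟨fun ⟨i, h⟩ => ⟨i, i.2, h⟩, fun ⟨i, h, h'⟩ => ⟨⟨i, h⟩, h'⟩⟩

theorem movesTo_iff {f : Braid omega} {n : ℕ} {x : ℂ} {γ γ' : Path x x} :
    MovesTo f n γ γ' ↔ Moves (firstPath n f.path) γ γ' := by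
  constructor
  · rintro ⟨H, h0, h1, h2, h3⟩
    exact ⟨H, h0, h1, h2, fun s t i => h3 s t i i.2⟩
  · rintro ⟨H, h0, h1, h2, h3⟩
    exact ⟨H, h0, h1, h2, fun s t i hi => h3 s t ⟨i, hi⟩⟩

theorem isArtinIso_iff {f : Braid omega} {n : ℕ}
    {e : FreeOn (Finset.range n) ≃* FreeOn (endSet f n)} :
    IsArtinIso f n e ↔ Act (firstPath n f.path) e.toMonoidHom := by
  unfold IsArtinIso
  simp only [movesTo_iff]
  exact ⟨fun h => act_of_gen (range_base n) (range_first_perm f.perm n) h,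
    fun h => h.gen (range_base n) (range_first_perm f.perm n)⟩

/-- The action of the first strings on the free groups determines the induced automorphism. -/
theorem induces_iff {f : Braid omega} {a : MulAut unrestricted} :
    Induces f a ↔ ∀ n, ∃ e : FreeOn (Finset.range n) ≃* FreeOn (imageSet f.perm n),
      Act (firstPath n f.path) e.toMonoidHom ∧
        ∀ g, pFin (imageSet f.perm n) (a g) = e (pNat n g) := by
  unfold Induces
  simp only [isArtinIso_iff]
  rfl

theorem exists_induces (f : Braid omega) : ∃ a, Induces f a := by
  choose e he _ using fun n =>
    exists_act_equiv (firstPath n f.path) (range_base n) (range_first_perm f.perm n)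
  obtain ⟨a, ha⟩ := exists_mulAut f.perm e fun n m hnm =>
    Act.restrict (range_base n) (range_first_perm f.perm n) (Fin.castLE hnm) (fun t i => rfl)
      (he m) (he n)
  exact ⟨a, induces_iff.2 fun n => ⟨e n, he n, ha n⟩⟩

theorem Induces.unique {f : Braid omega} {a b : MulAut unrestricted} (ha : Induces f a)
    (hb : Induces f b) : a = b := by
  rw [induces_iff] at ha hb
  refine MulEquiv.ext fun x => unrestricted_ext_imageSet f.perm fun n => ?_
  obtain ⟨e, he, h⟩ := ha n
  obtain ⟨e', he', h'⟩ := hb n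
  have h1 := he.unique (range_base n) (range_first_perm f.perm n) he'
  rw [h, h']
  exact DFunLike.congr_fun h1 _

theorem Induces.of_equiv {f g : Braid omega} {a : MulAut unrestricted} (ha : Induces f a)
    (h : f ≈ g) : Induces g a := by
  obtain ⟨ν, p⟩ := f
  obtain ⟨q, rfl, hpq⟩ := Braid.exists_mk_of_equiv h
  rw [induces_iff] at ha ⊢
  intro n
  obtain ⟨e, he, h1⟩ := ha n
  exact ⟨e, he.of_homotopic (hpq.map ⟨_, Config.continuous_first n⟩), h1⟩

/-- After `f`, the first `n` strings continue as those strings of `g` that start in `f.perm[n]`.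
They are among the first `N` strings of `g` for large `N`, so their action is a restriction of a
known one. -/
theorem Induces.mul {f g : Braid omega} {a b : MulAut unrestricted} (ha : Induces f a)
    (hb : Induces g b) : Induces (f.mul g) (b * a) := by
  rw [induces_iff] at ha hb ⊢
  intro n
  obtain ⟨e, he, h1⟩ := ha n
  obtain ⟨N, hN⟩ := subset_range (imageSet f.perm n)
  obtain ⟨e', he', h2⟩ := hb N
  obtain ⟨d, hd, -⟩ := exists_act_equiv (firstPath n (Braid.permPath f.perm g.path))
    (range_first_perm f.perm n) (range_first_perm (g.perm * f.perm) n)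
  have hmem : ∀ i : Fin n, f.perm i < N := fun i =>
    Finset.mem_range.1 (hN (mem_imageSet.2 i.2))
  have hsub : imageSet (g.perm * f.perm) n ⊆ imageSet g.perm N := by
    intro k hk
    rw [mem_imageSet'] at hk ⊢
    have := hmem ⟨_, hk⟩
    simpa [Equiv.Perm.mul_def] using this
  have h3 := Act.restrict (range_first_perm f.perm n) (range_first_perm (g.perm * f.perm) n)
    (fun i => ⟨f.perm i, hmem i⟩) (fun t i => rfl) he' hd
  refine ⟨e.trans d, ?_, fun x => ?_⟩
  · have h4 := he.trans hd
    have h5 : firstPath n (f.mul g).path =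
        (firstPath n f.path).trans (firstPath n (Braid.permPath f.perm g.path)) :=
      Path.map_trans _ _ _
    rw [h5]
    exact h4
  · have h4 := DFunLike.congr_fun h3 (pNat N (a x))
    simp only [MonoidHom.comp_apply] at h4
    change pFin (imageSet (g.perm * f.perm) n) (b (a x)) = d (e (pNat n x))
    rw [← h1, ← proj_pFin hsub, h2, pFin_eq hN]
    exact h4

theorem Induces.dagger {f : Braid omega} {a : MulAut unrestricted} (h : Induces f a) :
    Dagger a := by
  rw [induces_iff] at h
  intro n
  obtain ⟨e, he, h1⟩ := h n
  have hu := range_base n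
  have hv := range_first_perm f.perm n
  refine ⟨imageSet f.perm n, e, f.perm.subtypeEquiv fun k => ?_, h1, fun i => ?_,
    he.orderedProd hu hv⟩
  · rw [mem_imageSet, Finset.mem_range]
  · exact he.conj hu hv ⟨i, Finset.mem_range.1 i.2⟩ rfl rfl

/-- The image of `δ_i` is conjugate to the generator at the end point of string `i`, and exponent
sums show that this is `i` itself. Then all finite actions are trivial, and `homotopic_refl_of_act`
applies. -/
theorem Induces.equiv_one {f : Braid omega} (h : Induces f 1) : f ≈ Braid.one omega := by
  rw [induces_iff] at h
  have hperm : f.perm = 1 := by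
    ext i
    obtain ⟨e, he, h1⟩ := h (i + 1)
    obtain ⟨x, hx⟩ := exists_gen i
    have hi : i ∈ Finset.range (i + 1) := Finset.self_mem_range_succ i
    have hi' : f.perm i ∈ imageSet f.perm (i + 1) := mem_imageSet.2 (Nat.lt_succ_self i)
    obtain ⟨V, hV⟩ := he.conj (range_base _) (range_first_perm f.perm _) (Fin.last i)
      (k := ⟨i, hi⟩) (l := ⟨f.perm i, hi'⟩) rfl rfl
    have h2 := h1 x
    rw [MulAut.one_apply, hx, ← pFin_range, hx, letter_of_mem hi] at h2
    have h3 := (expo_conj_ne_one_iff (f.perm i) ⟨f.perm i, hi'⟩ V).2 rfl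
    rw [← hV] at h3
    change expo _ _ (e _) ≠ 1 at h3
    rw [← h2] at h3
    by_contra hne
    have hne : f.perm i ≠ i := hne
    apply h3
    by_cases hm : i ∈ imageSet f.perm (i + 1)
    · rw [letter_of_mem hm, expo_of, if_neg (Ne.symm hne)]
    · rw [letter_of_notMem hm, map_one]
  obtain ⟨ν, p⟩ := f
  obtain rfl : ν = 1 := hperm
  refine Braid.equivalent_mk (homotopic_refl_of_act (p := p) fun n => ?_)
  obtain ⟨e, he, h1⟩ := h n
  have hn : imageSet (1 : Equiv.Perm ℕ) n = Finset.range n := by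
    ext k; rw [mem_imageSet', Finset.mem_range]; rfl
  have key : ∀ {E : Finset ℕ} (_ : E = Finset.range n) {e : FreeOn (Finset.range n) ≃* FreeOn E},
      Act (firstPath n p) e.toMonoidHom → (∀ g, pFin E g = e (pNat n g)) →
        Act (firstPath n p) (MonoidHom.id (FreeOn (Finset.range n))) := by
    rintro E rfl e he h
    have h2 : e.toMonoidHom = MonoidHom.id _ := by
      refine MonoidHom.ext fun g => ?_
      obtain ⟨x, rfl⟩ := pNat_surjective n g
      exact (h x).symm.trans (pFin_range n x)
    exact h2 ▸ he
  exact key hn he h1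

/-! ### Realization of automorphisms by braids -/

/-- An isomorphism of the required form is realized by a motion of the first points. -/
theorem exists_path_act (ν : Equiv.Perm ℕ) (n : ℕ)
    (h : FreeOn (Finset.range n) ≃* FreeOn (imageSet ν n))
    (hconj : ∀ i : Finset.range n, ∃ U : FreeOn (imageSet ν n), h (FreeGroup.of i) =
      U⁻¹ * FreeGroup.of ⟨ν i, mem_imageSet.2 (Finset.mem_range.1 i.2)⟩ * U)
    (hprod : h (orderedProd (Finset.range n)) = orderedProd (imageSet ν n)) :
    ∃ p : Path (base n) ((omega.perm ν).first n), Act p h.toMonoidHom := by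
  rcases n with - | n
  · have hs : Subsingleton (Config (Fin 0)) := ⟨fun u v => Subtype.ext (funext fun i => i.elim0)⟩
    let p : Path (base 0) ((omega.perm ν).first 0) :=
      (Path.refl (base 0)).cast rfl (Subsingleton.elim _ _)
    obtain ⟨e, he⟩ := exists_act p (range_base 0) (range_first_perm ν 0)
    refine ⟨p, ?_⟩
    have : e = h.toMonoidHom := by
      ext i
      exact absurd i.2 (by simp)
    exact this ▸ he
  · have hmem : ∀ i < n + 1, i ∈ Finset.range (n + 1) := fun i hi => Finset.mem_range.2 hi
    choose U hU using hconj
    obtain ⟨v, p, e, hv, he, hy⟩ := exists_realization (n := n + 1) (E := imageSet ν (n + 1))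
      (by simp [imageSet]) (fun i => h (letter _ i))
      (fun i => if hi : i < n + 1 then U ⟨i, hmem i hi⟩ else 1)
      (fun i => if hi : i < n + 1 then ⟨ν i, mem_imageSet.2 hi⟩
        else ⟨ν 0, mem_imageSet.2 n.succ_pos⟩)
      (fun i hi => by
        rw [letter_of_mem (hmem i hi), hU]
        simp only [dif_pos hi])
      (by rw [← hprod, orderedProd_eq (Finset.Subset.refl _), map_list_prod, List.map_map]; rfl)
    have heh : e = h.toMonoidHom := by
      ext i
      have := hy i (Finset.mem_range.1 i.2)
      rw [letter_coe] at this
      exact this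
    subst heh
    -- The realization ends at the right set of points. That string `i` ends at `ν i` follows by
    -- comparing exponent sums in two descriptions of the image of `δ_i` as a conjugate.
    have hvν : v = (omega.perm ν).first (n + 1) := by
      apply Subtype.ext
      funext i
      obtain ⟨l, hl, hl'⟩ : v.1 i ∈ punct (imageSet ν (n + 1)) := hv ▸ mem_range_self i
      obtain ⟨V, hV⟩ := he.conj (range_base _) hv i (k := ⟨i, hmem i i.2⟩) (l := ⟨l, hl⟩) rfl
        hl'.symm
      have h1 : expo _ (ν i) (h (FreeGroup.of ⟨i, hmem i i.2⟩)) ≠ 1 := by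
        rw [hU]
        exact (expo_conj_ne_one_iff _ _ _).2 rfl
      change h _ = _ at hV
      rw [hV, expo_conj_ne_one_iff] at h1
      rw [← hl']
      change (l : ℂ) = (ν i : ℂ)
      exact congrArg _ h1
    subst hvν
    exact ⟨p, he⟩

/-- Every automorphism with property `(†)` is induced by a braid. -/
theorem Dagger.exists_induces {a : MulAut unrestricted} (ha : Dagger a) :
    ∃ f : Braid omega, Induces f a := by
  obtain ⟨ν, hν⟩ := ha.exists_perm
  choose h h1 h2 h3 using hν
  have hcomp : ∀ n, (proj (imageSet ν (n + 1)) (imageSet ν n)).comp (h (n + 1)).toMonoidHom =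
      (h n).toMonoidHom.comp (proj (Finset.range (n + 1)) (Finset.range n)) := by
    intro n
    refine MonoidHom.ext fun g => ?_
    obtain ⟨x, rfl⟩ := pNat_surjective (n + 1) g
    change proj _ _ (h (n + 1) _) = h n (proj _ _ _)
    rw [← h1, proj_pFin (imageSet_mono ν n.le_succ), h1, proj_pNat n.le_succ]
  let N : ℕ → Type := fun n =>
    {p : Path (base n) ((omega.perm ν).first n) // Act p (h n).toMonoidHom}
  have hstep : ∀ n (p : N n), ∃ q : N (n + 1), ∀ t, (q.1 t).init = p.1 t := by
    intro n p
    -- A realization `b` of the next level restricts to a motion with the same action as `p`, hence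
    -- homotopic to `p`. Extending this homotopy over the last string replaces `b` by a motion that
    -- restricts exactly to `p`.
    obtain ⟨b, hb⟩ := exists_path_act ν (n + 1) (h (n + 1)) (h2 _) (h3 _)
    have hb' : Act (initPath b) (h n).toMonoidHom :=
      Act.init (u := base (n + 1)) (v := (omega.perm ν).first (n + 1)) (range_base n) (range_first_perm ν n)
        (Finset.range_mono n.le_succ) hb (hcomp n)
    obtain ⟨H⟩ := homotopic_of_act (range_first_perm ν n) hb' p.2
    obtain ⟨-, q, -, -, -, hq, -, hbq⟩ := exists_carry_last b H.toContinuousMap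
      (fun t => H.apply_zero t) fun s => ⟨H.source s, H.target s⟩
    exact ⟨⟨q, hb.of_homotopic hbq⟩, fun t => (hq t).trans (H.apply_one t)⟩
  choose next hnext using hstep
  obtain ⟨p₀, hp₀⟩ := exists_path_act ν 0 (h 0) (h2 _) (h3 _)
  let S : ∀ n, N n := fun n => Nat.rec ⟨p₀, hp₀⟩ (fun n p => next n p) n
  obtain ⟨F, hF⟩ := exists_of_coherent (fun n => (S n).1.toContinuousMap)
    fun n t => hnext n (S n) t
  have hF' : ∀ n t, (F t).first n = (S n).1 t := hF
  let p : Path omega (omega.perm ν) := ⟨F,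
    Config.ext_first fun n => (hF' n 0).trans (S n).1.source,
    Config.ext_first fun n => (hF' n 1).trans (S n).1.target⟩
  refine ⟨⟨ν, p⟩, induces_iff.2 fun n => ⟨h n, ?_, h1 n⟩⟩
  have : firstPath n p = (S n).1 := by
    ext1
    funext t
    exact hF' n t
  exact this ▸ (S n).2

/-- The automorphism induced by a braid. -/
def braidAut (f : Braid omega) : MulAut unrestricted := (exists_induces f).choose

theorem induces_braidAut (f : Braid omega) : Induces f (braidAut f) := (exists_induces f).choose_spec

theorem braidAut_eq_iff {f : Braid omega} {a : MulAut unrestricted} :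
    Induces f a ↔ a = braidAut f :=
  ⟨fun h => h.unique (induces_braidAut f), fun h => h ▸ induces_braidAut f⟩

/-- The homomorphism `[f] ↦ a_f⁻¹`. -/
def braidHom : BraidGroup omega →* MulAut unrestricted :=
  MonoidHom.mk' (Quotient.lift (fun f => (braidAut f)⁻¹) fun f g h => by
    rw [braidAut_eq_iff.1 ((induces_braidAut f).of_equiv h)]) <| by
    rintro ⟨f⟩ ⟨g⟩
    change (braidAut (f.mul g))⁻¹ = (braidAut f)⁻¹ * (braidAut g)⁻¹
    rw [← mul_inv_rev, braidAut_eq_iff.1 ((induces_braidAut f).mul (induces_braidAut g))]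

theorem braidHom_mk (f : Braid omega) : braidHom (BraidGroup.mk f) = (braidAut f)⁻¹ := rfl

theorem braidHom_injective : Function.Injective braidHom := by
  rw [injective_iff_map_eq_one]
  rintro ⟨f⟩ hf
  have h1 : (braidAut f)⁻¹ = 1 := hf
  rw [inv_eq_one] at h1
  exact Quotient.sound (Induces.equiv_one (h1 ▸ induces_braidAut f))

theorem mem_range_braidHom {a : MulAut unrestricted} : a ∈ braidHom.range ↔ Dagger a := by
  constructor
  · rintro ⟨c, rfl⟩
    obtain ⟨f, hf⟩ : ∃ f, BraidGroup.mk f = c⁻¹ := Quotient.exists_rep _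
    have h : braidHom c = braidAut f := by
      rw [← inv_inv (braidAut f), ← braidHom_mk, hf, map_inv, inv_inv]
    exact h ▸ (induces_braidAut f).dagger
  · intro ha
    obtain ⟨f, hf⟩ := ha.exists_induces
    refine ⟨(BraidGroup.mk f)⁻¹, ?_⟩
    rw [map_inv, braidHom_mk, inv_inv, ← braidAut_eq_iff.1 hf]

end Main

end

end OmegaBraid

theorem theorem3p1 :
    ∃ D : Subgroup (MulAut OmegaBraid.unrestricted),
      (∀ a, a ∈ D ↔ OmegaBraid.Dagger a) ∧
      ∃ Φ : OmegaBraid.BraidGroup OmegaBraid.omega ≃* D,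
        ∀ (f : OmegaBraid.Braid OmegaBraid.omega) (a : MulAut OmegaBraid.unrestricted),
          OmegaBraid.Induces f a ↔
            a = (Φ (OmegaBraid.BraidGroup.mk f) : MulAut OmegaBraid.unrestricted)⁻¹ := by
  refine ⟨OmegaBraid.braidHom.range, fun a => OmegaBraid.mem_range_braidHom,
    MonoidHom.ofInjective OmegaBraid.braidHom_injective, fun f a => ?_⟩
  rw [OmegaBraid.braidAut_eq_iff, MonoidHom.ofInjective_apply, OmegaBraid.braidHom_mk, inv_inv]
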